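/- Let $R$ be a profinite ring with unity (a topological ring whose underlying space is compact, Hausdorff and totally disconnected). Write $\mathrm{DMod}\text{-}R$ for the category of discrete right $R$-modules (right $R$-modules with continuous $R$-action for the discrete topology; linear maps), $R\text{-}\mathrm{PMod}$ for the category of profinite left $R$-modules and continuous linear maps, and $M^\vee=\mathrm{Hom}_{\mathrm{cts}}(M,\mathbb{R}/\mathbb{Z})$ for the Pontryagin dual. For a profinite space $X$ let $\mathcal{O}X$ be the poset of clopen subsets. Consider the following categories. (1) $\mathrm{Shf}\text{-}R$: objects $(A,X)$ with $X$ profinite and $A\colon(\mathcal{O}X)^{op}\to\mathrm{DMod}\text{-}R$ a functor such that for all clopen $U_1,\dots,U_n$ ($n\ge 0$) the sequence $0\to A(\bigcup U_i)\to\prod_i A(U_i)\to\prod_{i,j}A(U_i\cap U_j)$, the last map being the difference of the two restrictions, is exact. A morphism $(A,X)\to(B,Y)$ is a continuous map $f\colon Y\to X$ with maps $\Phi_{U,V}\colon A(U)\to B(f^{-1}(U)\cap V)$, natural in $U\in\mathcal{O}X$, $V\in\mathcal{O}Y$. (2) $R\text{-}\mathrm{CoShf}$: objects $(M,X)$ with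 $X$ profinite and $M\colon\mathcal{O}X\to R\text{-}\mathrm{PMod}$ a functor such that for all clopen $U_1,\dots,U_n$ ($n\ge0$) the sequence $\bigoplus_{i,j}M(U_i\cap U_j)\to\bigoplus_iM(U_i)\to M(\bigcup U_i)\to0$, the first map being the difference of the two corestrictions, is exact. A morphism $(N,Y)\to(M,X)$ is a continuous map $f\colon Y\to X$ with maps $\Psi_{U,V}\colon N(f^{-1}(U)\cap V)\to M(U)$, natural in $U$, $V$. (3) $\text{Étale-}R$: objects are local homeomorphisms $p\colon\mathcal{A}\to X$ with $X$ profinite, together with a continuous zero section and continuous maps $\mathcal{A}\times_X\mathcal{A}\to\mathcal{A}$ (addition) and $\mathcal{A}\times R\to\mathcal{A}$ (action) over $X$ making each fibre $A_x$ a right $R$-module. A morphism $(\mathcal{A},X)\to(\mathcal{B},Y)$ is a continuous $f\colon Y\to X$ with a continuous $\phi\colon\mathcal{A}\times_XY\to\mathcal{B}$ restricting to linear maps $A_{f(y)}\to B_y$. (4) $R\text{-P`Shf'}$: objects are continuous surjections $p\colon\mathcal{M}\to X$ of profinite spaces whose fibres $M_x$ are profinite left $R$-modules such that $R\times\mathcal{M}\to\mathcal{M}$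 and $\mathcal{M}\times_X\mathcal{M}\to\mathcal{M}$ (action and addition) are continuous. A morphism $(\mathcal{N},Y)\to(\mathcal{M},X)$ is a pair of continuous maps $\psi\colon\mathcal{N}\to\mathcal{M}$, $f\colon Y\to X$ restricting to linear maps $N_y\to M_{f(y)}$. Consider the following functors. * The continuous product $\dot\prod\colon\text{Étale-}R\to\mathrm{DMod}\text{-}R$ sends $\mathcal{A}$ to its module of continuous global sections with the discrete topology; $\mathrm{Shf}\colon\text{Étale-}R\to\mathrm{Shf}\text{-}R$ sends $\mathcal{A}$ to the sheaf of continuous sections over clopen sets; $\text{Étale}\colon\mathrm{Shf}\text{-}R\to\text{Étale-}R$ sends $A$ to $\bigsqcup_xA_x$, $A_x=\varinjlim_{U\ni x}A(U)$, with the topology generated by the sets of germs of sections $s\in A(U)$. * $\vee\colon(\mathrm{Shf}\text{-}R)^{op}\to R\text{-}\mathrm{CoShf}$ and $\vee\colon(R\text{-}\mathrm{CoShf})^{op}\to\mathrm{Shf}\text{-}R$ are given by $A^\vee(U)=A(U)^\vee$ and $M^\vee(U)=M(U)^\vee$. * $\mathrm{eval}_X$ sends a (co)sheaf on $X$ to its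 value at $X$. * The profinite direct sum $\boxplus\colon R\text{-P`Shf'}\to R\text{-}\mathrm{PMod}$ sends $\mathcal{M}$ to the profinite module $\boxplus\mathcal{M}$ carrying the universal continuous fibrewise linear map $\omega\colon\mathcal{M}\to\boxplus\mathcal{M}$ to a profinite module. * $\mathrm{CoShf}\colon R\text{-P`Shf'}\to R\text{-}\mathrm{CoShf}$ sends $\mathcal{M}$ to $U\mapsto\boxplus_{u\in U}M_u$; $\text{CoÉtale}\colon R\text{-}\mathrm{CoShf}\to R\text{-P`Shf'}$ sends $M$ to $\bigsqcup_xM_x$, $M_x=\varprojlim_{U\ni x}M(U)$, with the topology generated by the sets $\{(m,x): x\in U,\ m_U\in W\}$ for $U$ clopen and $W\subseteq M(U)$ open, where $m_U$ is the image of $m$ in $M(U)$. Then the following hold. (a) The following pairs of functors are mutually quasi-inverse equivalences: $\mathrm{Shf}$ and $\text{Étale}$ between $(\text{Étale-}R)^{op}$ and $(\mathrm{Shf}\text{-}R)^{op}$; $\vee$ and $\vee$ between $(\mathrm{Shf}\text{-}R)^{op}$ and $R\text{-}\mathrm{CoShf}$; $\mathrm{CoShf}$ and $\text{CoÉtale}$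 between $R\text{-P`Shf'}$ and $R\text{-}\mathrm{CoShf}$; $\vee$ and $\vee$ between $(\mathrm{DMod}\text{-}R)^{op}$ and $R\text{-}\mathrm{PMod}$. (b) The diagram formed by these equivalences and the functors $\dot\prod$, $\mathrm{eval}_X$, $\mathrm{eval}_X$, $\boxplus$ to $(\mathrm{DMod}\text{-}R)^{op}$ and $R\text{-}\mathrm{PMod}$ commutes up to natural isomorphism, whichever direction of each equivalence is used: $\mathrm{eval}_X\circ\mathrm{Shf}\cong\dot\prod$ and $\dot\prod\circ\text{Étale}\cong\mathrm{eval}_X$; $\vee\circ\mathrm{eval}_X\cong\mathrm{eval}_X\circ\vee$ on $(\mathrm{Shf}\text{-}R)^{op}$ and on $R\text{-}\mathrm{CoShf}$; $\mathrm{eval}_X\circ\mathrm{CoShf}\cong\boxplus$ and $\boxplus\circ\text{CoÉtale}\cong\mathrm{eval}_X$. -/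

import Mathlib

open CategoryTheory TopologicalSpace Opposite

universe u

set_option linter.unusedSectionVars false

noncomputable section

/-! ### Discrete right modules and profinite left modules -/

section Modules

variable (R : Type u) [Ring R] [TopologicalSpace R]

/-- A discrete right `R`-module: a right module (a module over `Rᵐᵒᵖ`) with the discrete topology
on which `R` acts continuously. -/
structure DMod where
  carrier : Type u
  [addCommGroup : AddCommGroup carrier]
  [module : Module Rᵐᵒᵖ carrier]
  [topologicalSpace : TopologicalSpace carrier]
  [discreteTopology : DiscreteTopology carrier]
  [continuousSMul : ContinuousSMul Rᵐᵒᵖ carrier]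

/-- A profinite left `R`-module: a topological `R`-module whose underlying space is profinite. -/
structure PMod where
  carrier : Type u
  [addCommGroup : AddCommGroup carrier]
  [module : Module R carrier]
  [topologicalSpace : TopologicalSpace carrier]
  [isTopologicalAddGroup : IsTopologicalAddGroup carrier]
  [continuousSMul : ContinuousSMul R carrier]
  [compactSpace : CompactSpace carrier]
  [t2Space : T2Space carrier]
  [totallyDisconnectedSpace : TotallyDisconnectedSpace carrier]

attribute [instance] DMod.addCommGroup DMod.module DMod.topologicalSpace DMod.discreteTopology
  DMod.continuousSMul PMod.addCommGroup PMod.module PMod.topologicalSpace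
  PMod.isTopologicalAddGroup PMod.continuousSMul PMod.compactSpace PMod.t2Space
  PMod.totallyDisconnectedSpace

instance : CoeSort (DMod.{u} R) (Type u) := ⟨DMod.carrier⟩

instance : CoeSort (PMod.{u} R) (Type u) := ⟨PMod.carrier⟩

variable {R}

/-- Morphisms of discrete modules are the linear maps. -/
@[ext]
structure DMod.Hom (A B : DMod.{u} R) where
  lin : A →ₗ[Rᵐᵒᵖ] B

/-- Morphisms of profinite modules are the continuous linear maps. -/
@[ext]
structure PMod.Hom (A B : PMod.{u} R) where
  lin : A →L[R] B

instance : Category (DMod.{u} R) where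
  Hom := DMod.Hom
  id A := ⟨LinearMap.id⟩
  comp f g := ⟨g.lin.comp f.lin⟩

instance : Category (PMod.{u} R) where
  Hom := PMod.Hom
  id A := ⟨ContinuousLinearMap.id R A⟩
  comp f g := ⟨g.lin.comp f.lin⟩

instance : ConcreteCategory (DMod.{u} R) (fun A B => A →ₗ[Rᵐᵒᵖ] B) where
  hom f := f.lin
  ofHom f := ⟨f⟩

instance : ConcreteCategory (PMod.{u} R) (fun A B => A →L[R] B) where
  hom f := f.lin
  ofHom f := ⟨f⟩

/-- If all annihilators are open then `R` acts continuously on the discrete module `A`. -/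
theorem continuousSMul_of_isOpen_annihilator [IsTopologicalRing R] {A : Type u} [AddCommGroup A]
    [Module Rᵐᵒᵖ A] [TopologicalSpace A] [DiscreteTopology A]
    (h : ∀ a : A, IsOpen {r : R | MulOpposite.op r • a = 0}) : ContinuousSMul Rᵐᵒᵖ A := by
  refine ⟨continuous_iff_continuousAt.2 fun q => ?_⟩
  obtain ⟨r, a⟩ := q
  have h1 : {q : Rᵐᵒᵖ × A | MulOpposite.op ((q.1 - r).unop) • a = 0 ∧ q.2 = a} ∈ nhds (r, a) := by
    refine Filter.inter_mem ?_ ?_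
    · have hc : Continuous fun q : Rᵐᵒᵖ × A => (q.1 - r).unop :=
        MulOpposite.continuous_unop.comp (continuous_fst.sub continuous_const)
      exact ((h a).preimage hc).mem_nhds (by simp)
    · exact (((isOpen_discrete {a}).preimage continuous_snd)).mem_nhds rfl
  rw [ContinuousAt, nhds_discrete A]
  refine tendsto_nhds_of_eventually_eq ?_ |>.mono_right (by rw [nhds_discrete A])
  filter_upwards [h1] with q hq
  obtain ⟨h2, rfl⟩ := hq
  simpa [sub_smul, sub_eq_zero] using h2

theorem DMod.isOpen_annihilator (A : DMod.{u} R) (a : A) :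
    IsOpen {r : R | MulOpposite.op r • a = 0} := by
  have hc : Continuous fun r : R => MulOpposite.op r • a :=
    MulOpposite.continuous_op.smul continuous_const
  exact (isOpen_discrete {(0 : A)}).preimage hc

/-- Open submodules form a neighbourhood base of zero in a profinite module. -/
theorem PMod.exists_openSubmodule [CompactSpace R] (P : PMod.{u} R) {V : Set P} (hV : IsOpen V)
    (h0 : (0 : P) ∈ V) : ∃ L : Submodule R P, IsOpen (L : Set P) ∧ (L : Set P) ⊆ V := by
  obtain ⟨H', hH⟩ := ProfiniteGrp.exist_openNormalAddSubgroup_sub_open_nhds_of_zero hV h0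
  let H : OpenAddSubgroup P := H'.toOpenAddSubgroup
  let L : Submodule R P :=
    { carrier := {p | ∀ r : R, r • p ∈ H}
      zero_mem' := fun r => by rw [smul_zero]; exact H.zero_mem
      add_mem' := fun ha hb r => by rw [smul_add]; exact H.add_mem (ha r) (hb r)
      smul_mem' := fun s p hp r => by rw [smul_smul]; exact hp (r * s) }
  refine ⟨L, ?_, fun p hp => hH (by have := hp 1; rwa [one_smul] at this)⟩
  have hc : IsClosed ((H : Set P)ᶜ) := H.isOpen.isClosed_compl
  have h2 : IsClosed (Prod.snd '' {q : R × P | q.1 • q.2 ∈ ((H : Set P)ᶜ)}) :=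
    isClosedMap_snd_of_compactSpace _ (hc.preimage continuous_smul)
  have : (L : Set P) = (Prod.snd '' {q : R × P | q.1 • q.2 ∈ ((H : Set P)ᶜ)})ᶜ := by
    ext p
    simp [L]
  rw [this]
  exact h2.isOpen_compl

end Modules

/-! ### Pontryagin duality for modules -/

section Pontryagin

variable {R : Type u} [Ring R] [TopologicalSpace R]

/-- The Pontryagin dual `Hom(A, ℝ/ℤ)` (continuous homomorphisms, compact-open topology). -/
abbrev PDual (A : Type u) [AddCommGroup A] [TopologicalSpace A] : Type u :=
  A →ₜ+ UnitAddCircle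

/-- The left action `(r χ)(a) = χ(a r)` on the dual of a right module. -/
instance DMod.dualModule (A : DMod.{u} R) : Module R (PDual A) where
  smul r χ :=
    { toFun := fun a => χ (MulOpposite.op r • a)
      map_zero' := by simp
      map_add' := by simp
      continuous_toFun := continuous_of_discreteTopology }
  one_smul χ := by ext a; change χ (MulOpposite.op 1 • a) = χ a; simp
  mul_smul r s χ := by
    ext a
    change χ (MulOpposite.op (r * s) • a) = χ (MulOpposite.op s • MulOpposite.op r • a)
    simp [smul_smul]
  smul_zero r := rfl
  smul_add r χ ψ := rfl
  add_smul r s χ := by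
    ext a
    change χ (MulOpposite.op (r + s) • a) = χ (MulOpposite.op r • a) + χ (MulOpposite.op s • a)
    rw [← map_add, ← add_smul, MulOpposite.op_add]
  zero_smul χ := by
    ext a
    change χ (MulOpposite.op 0 • a) = 0
    simp

theorem DMod.dual_smul_apply (A : DMod.{u} R) (r : R) (χ : PDual A) (a : A) :
    (r • χ) a = χ (MulOpposite.op r • a) := rfl

/-- The right action `(χ r)(m) = χ(r m)` on the dual of a left module. -/
instance PMod.dualModule (M : PMod.{u} R) : Module Rᵐᵒᵖ (PDual M) where
  smul r χ :=
    { toFun := fun m => χ (r.unop • m)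
      map_zero' := by simp
      map_add' := by simp
      continuous_toFun := χ.continuous_toFun.comp (continuous_const_smul r.unop) }
  one_smul χ := by ext m; change χ ((1 : R) • m) = χ m; simp
  mul_smul r s χ := by
    ext m
    change χ ((s.unop * r.unop) • m) = χ (s.unop • r.unop • m)
    simp [smul_smul]
  smul_zero r := rfl
  smul_add r χ ψ := rfl
  add_smul r s χ := by
    ext m
    change χ ((r.unop + s.unop) • m) = χ (r.unop • m) + χ (s.unop • m)
    rw [← map_add, ← add_smul]
  zero_smul χ := by
    ext m
    change χ ((0 : R) • m) = 0
    simp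

theorem PMod.dual_smul_apply (M : PMod.{u} R) (r : Rᵐᵒᵖ) (χ : PDual M) (m : M) :
    (r • χ) m = χ (r.unop • m) := rfl

theorem exists_nhds_circle_noSmallSubgroups :
    ∃ V : Set UnitAddCircle, IsOpen V ∧ 0 ∈ V ∧ ∀ t, (∀ n : ℕ, n • t ∈ V) → t = 0 := by
  let c : UnitAddCircle → Circle := AddCircle.toCircle
  refine ⟨c ⁻¹' Circle.centeredArc (Real.pi / 2),
    (Circle.isOpen_centeredArc _).preimage AddCircle.continuous_toCircle, ?_, fun t ht => ?_⟩
  · have : c 0 = 1 := AddCircle.toCircle_zero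
    rw [Set.mem_preimage, this, Circle.mem_centeredArc (by linarith [Real.pi_pos])]
    simp [Real.pi_pos]
  · have : c t = 1 := by
      refine Circle.eq_one_of_forall_pow_mem_centeredArc_pi_div_two fun n hn => ?_
      have := ht n
      rw [Set.mem_preimage] at this
      simpa [c, AddCircle.toCircle_nsmul] using this
    exact AddCircle.injective_toCircle one_ne_zero (this.trans AddCircle.toCircle_zero.symm)

instance PMod.dualDiscrete (M : PMod.{u} R) : DiscreteTopology (PDual M) := by
  obtain ⟨V, hV, h0, h⟩ := exists_nhds_circle_noSmallSubgroups
  let W : Set (PDual M) := {ψ | Set.MapsTo ψ Set.univ V}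
  have hW : IsOpen W := isOpen_induced (ContinuousMap.isOpen_setOfPred_mapsTo isCompact_univ hV)
  have hW1 : W = {0} := by
    ext ψ
    rw [Set.mem_singleton_iff]
    refine ⟨fun hψ => ?_, ?_⟩
    · ext1 a
      exact h _ fun n => by simpa using hψ (Set.mem_univ (n • a))
    · rintro rfl _ _
      exact h0
  exact discreteTopology_of_isOpen_singleton_zero (by rw [← hW1]; exact hW)

variable [IsTopologicalRing R] [CompactSpace R]

instance PMod.dualContinuousSMul (M : PMod.{u} R) : ContinuousSMul Rᵐᵒᵖ (PDual M) := by
  refine continuousSMul_of_isOpen_annihilator fun χ => ?_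
  obtain ⟨V, hV, h0, h⟩ := exists_nhds_circle_noSmallSubgroups
  have hcont : Continuous fun q : R × M => χ (q.1 • q.2) :=
    χ.continuous_toFun.comp continuous_smul
  have h2 : IsClosed (Prod.fst '' {q : R × M | χ (q.1 • q.2) ∈ Vᶜ}) :=
    isClosedMap_fst_of_compactSpace _ (hV.isClosed_compl.preimage hcont)
  have : {r : R | MulOpposite.op r • χ = 0} =
      (Prod.fst '' {q : R × M | χ (q.1 • q.2) ∈ Vᶜ})ᶜ := by
    ext r
    simp only [Set.mem_ofPred_eq, Set.mem_compl_iff, Set.mem_image, Prod.exists, exists_and_right,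
      exists_eq_right, not_exists, not_not]
    constructor
    · intro hr m
      have : (MulOpposite.op r • χ) m = 0 := by rw [hr]; rfl
      rw [PMod.dual_smul_apply] at this
      rw [show r • m = (MulOpposite.op r).unop • m from rfl, this]
      exact h0
    · intro hr
      ext m
      refine h _ fun n => ?_
      change n • χ (r • m) ∈ V
      rw [← map_nsmul, show n • r • m = r • n • m from (smul_comm _ _ _)]
      exact hr (n • m)
  rw [this]
  exact h2.isOpen_compl

/-- Every element of a discrete module has finite order. -/
theorem DMod.exists_nsmul_eq_zero (A : DMod.{u} R) (a : A) : ∃ n : ℕ, 0 < n ∧ n • a = 0 := by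
  have hc : Continuous fun r : R => MulOpposite.op r • a :=
    MulOpposite.continuous_op.smul continuous_const
  have hfin : (Set.range fun r : R => MulOpposite.op r • a).Finite :=
    (isCompact_range hc).finite_of_discrete
  by_contra! hcon
  refine Set.infinite_of_injective_forall_mem (f := fun n : ℕ => n • a) ?_ ?_ hfin
  · have key : ∀ m n : ℕ, m < n → m • a ≠ n • a := fun m n hmn h => by
      refine hcon (n - m) (by omega) ?_
      rw [← Nat.sub_add_cancel hmn.le, add_nsmul] at h
      simpa using h.symm
    intro m n h
    rcases lt_trichotomy m n with h1 | h1 | h1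
    · exact (key _ _ h1 h).elim
    · exact h1
    · exact (key _ _ h1 h.symm).elim
  · intro n
    refine ⟨(n : R), ?_⟩
    simp [Nat.cast_smul_eq_nsmul]

instance DMod.dualTotallyDisconnected (A : DMod.{u} R) : TotallyDisconnectedSpace (PDual A) := by
  refine ⟨fun t _ ht => fun χ hχ ψ hψ => ?_⟩
  ext a
  obtain ⟨n, hn, hna⟩ := A.exists_nsmul_eq_zero a
  have hc : Continuous fun χ : PDual A => χ a := continuous_eval_const a
  have hpre := ht.image _ hc.continuousOn
  have hfin : ((fun χ : PDual A => χ a) '' t).Finite := by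
    refine (AddCircle.finite_torsion (1 : ℝ) hn).subset ?_
    rintro _ ⟨χ, -, rfl⟩
    change n • χ a = 0
    rw [← map_nsmul, hna, map_zero]
  by_contra hne
  exact hpre.infinite_of_nontrivial ⟨_, ⟨χ, hχ, rfl⟩, _, ⟨ψ, hψ, rfl⟩, hne⟩ hfin

instance DMod.dualContinuousSMul (A : DMod.{u} R) : ContinuousSMul R (PDual A) := by
  refine ⟨?_⟩
  have hemb : Topology.IsInducing (fun (χ : PDual A) (a : A) => χ a) :=
    ContinuousAddMonoidHom.isClosedEmbedding_coe.isInducing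
  refine hemb.continuous_iff.2 (continuous_pi fun a => ?_)
  change Continuous fun q : R × PDual A => q.2 (MulOpposite.op q.1 • a)
  refine continuous_iff_continuousAt.2 fun q => ?_
  have h1 : ∀ᶠ p : R × PDual A in nhds q, MulOpposite.op p.1 • a = MulOpposite.op q.1 • a := by
    have hc : Continuous fun p : R × PDual A => MulOpposite.op p.1 • a :=
      (MulOpposite.continuous_op.comp continuous_fst).smul continuous_const
    exact ((isOpen_discrete {MulOpposite.op q.1 • a}).preimage hc).mem_nhds rfl
  have h2 : ContinuousAt (fun p : R × PDual A => p.2 (MulOpposite.op q.1 • a)) q :=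
    ((continuous_eval_const (MulOpposite.op q.1 • a)).comp continuous_snd).continuousAt
  refine h2.congr ?_
  filter_upwards [h1] with p hp
  rw [hp]

variable (R)

/-- Pontryagin duality from discrete right modules to profinite left modules. -/
def DMod.dual : (DMod.{u} R)ᵒᵖ ⥤ PMod.{u} R where
  obj A := { carrier := PDual A.unop }
  map {A B} f := ⟨
    { toFun := fun χ => χ.comp ⟨f.unop.lin.toAddMonoidHom, continuous_of_discreteTopology⟩
      map_add' := fun _ _ => rfl
      map_smul' := fun r χ => by
        ext b
        change χ (MulOpposite.op r • f.unop.lin b) = χ (f.unop.lin (MulOpposite.op r • b))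
        exact congrArg χ (f.unop.lin.map_smul _ _).symm
      cont := ContinuousAddMonoidHom.continuous_comp_left _ }⟩

/-- Pontryagin duality from profinite left modules to discrete right modules. -/
def PMod.dual : (PMod.{u} R)ᵒᵖ ⥤ DMod.{u} R where
  obj M := { carrier := PDual M.unop }
  map {M N} f := ⟨
    { toFun := fun χ => χ.comp ⟨f.unop.lin.toLinearMap.toAddMonoidHom, f.unop.lin.continuous⟩
      map_add' := fun _ _ => rfl
      map_smul' := fun r χ => by
        ext n
        change χ (r.unop • f.unop.lin n) = χ (f.unop.lin (r.unop • n))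
        exact congrArg χ (f.unop.lin.map_smul _ _).symm }⟩

end Pontryagin

/-! ### Presheaves and precosheaves over varying profinite spaces -/

section Presheaves

/-- The preimage of a clopen subset under a continuous map. -/
def clopenPreimage {X Y : Type u} [TopologicalSpace X] [TopologicalSpace Y] (f : C(Y, X))
    (U : Clopens X) : Clopens Y :=
  ⟨f ⁻¹' U, U.isClopen.preimage f.continuous⟩

/-- The functor `(U, V) ↦ f⁻¹(U) ∩ V` on poset categories of clopen sets. -/
def meetPreimage {X Y : Type u} [TopologicalSpace X] [TopologicalSpace Y] (f : C(Y, X)) :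
    Clopens X × Clopens Y ⥤ Clopens Y where
  obj p := clopenPreimage f p.1 ⊓ p.2
  map {p q} h := homOfLE (fun _ hy => ⟨leOfHom h.1 hy.1, leOfHom h.2 hy.2⟩)

variable (R : Type u) [Ring R] [TopologicalSpace R]

/-- A presheaf of discrete modules on a profinite space, defined on its clopen subsets. -/
structure Presh where
  base : Profinite.{u}
  fn : (Clopens base)ᵒᵖ ⥤ DMod.{u} R

/-- A precosheaf of profinite modules on a profinite space, defined on its clopen subsets. -/
structure Precosh where
  base : Profinite.{u}
  fn : Clopens base ⥤ PMod.{u} R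

variable {R}

/-- A morphism of presheaves `(A, X) ⟶ (B, Y)`: a continuous map `f : Y → X` and maps
`A(U) ⟶ B(f⁻¹(U) ∩ V)` natural in `U` and `V`. -/
structure Presh.Hom (A B : Presh.{u} R) where
  f : C(B.base, A.base)
  nat : (CategoryTheory.Prod.fst (Clopens A.base) (Clopens B.base)).op ⋙ A.fn ⟶
    (meetPreimage f).op ⋙ B.fn

/-- A morphism of precosheaves `(N, Y) ⟶ (M, X)`: a continuous map `f : Y → X` and maps
`N(f⁻¹(U) ∩ V) ⟶ M(U)` natural in `U` and `V`. -/
structure Precosh.Hom (N M : Precosh.{u} R) where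
  f : C(N.base, M.base)
  nat : meetPreimage f ⋙ N.fn ⟶
    CategoryTheory.Prod.fst (Clopens M.base) (Clopens N.base) ⋙ M.fn

/-- The restriction map of a presheaf along `U ≤ V`. -/
abbrev Presh.res (A : Presh.{u} R) {U V : Clopens A.base} (h : U ≤ V) :
    A.fn.obj (op V) ⟶ A.fn.obj (op U) :=
  A.fn.map (homOfLE h).op

/-- The corestriction map of a precosheaf along `U ≤ V`. -/
abbrev Precosh.cor (M : Precosh.{u} R) {U V : Clopens M.base} (h : U ≤ V) :
    M.fn.obj U ⟶ M.fn.obj V :=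
  M.fn.map (homOfLE h)

theorem Presh.res_res (A : Presh.{u} R) {U V W : Clopens A.base} (h : U ≤ V) (h' : V ≤ W) :
    A.res h' ≫ A.res h = A.res (h.trans h') := by
  rw [← Functor.map_comp]
  rfl

theorem Precosh.cor_cor (A : Precosh.{u} R) {U V W : Clopens A.base} (h : U ≤ V) (h' : V ≤ W) :
    A.cor h ≫ A.cor h' = A.cor (h.trans h') := by
  rw [← Functor.map_comp]
  rfl

theorem Precosh.cor_cor_assoc (A : Precosh.{u} R) {U V W : Clopens A.base} (h : U ≤ V)
    (h' : V ≤ W) {M : PMod.{u} R} (g : A.fn.obj W ⟶ M) :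
    A.cor h ≫ A.cor h' ≫ g = A.cor (h.trans h') ≫ g := by
  rw [← Category.assoc, A.cor_cor]

theorem Presh.res_self (A : Presh.{u} R) {U : Clopens A.base} (h : U ≤ U) : A.res h = 𝟙 _ :=
  A.fn.map_id _

theorem Precosh.cor_self (A : Precosh.{u} R) {U : Clopens A.base} (h : U ≤ U) : A.cor h = 𝟙 _ :=
  A.fn.map_id _

/-- The component `A(U) ⟶ B(f⁻¹(U) ∩ V)` of a morphism of presheaves. -/
abbrev Presh.Hom.app {A B : Presh.{u} R} (F : Presh.Hom A B) (U : Clopens A.base)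
    (V : Clopens B.base) : A.fn.obj (op U) ⟶ B.fn.obj (op (clopenPreimage F.f U ⊓ V)) :=
  F.nat.app (op (U, V))

/-- The component `N(f⁻¹(U) ∩ V) ⟶ M(U)` of a morphism of precosheaves. -/
abbrev Precosh.Hom.app {N M : Precosh.{u} R} (F : Precosh.Hom N M) (U : Clopens M.base)
    (V : Clopens N.base) : N.fn.obj (clopenPreimage F.f U ⊓ V) ⟶ M.fn.obj U :=
  F.nat.app (U, V)

theorem meet_mono {X Y : Type u} [TopologicalSpace X] [TopologicalSpace Y] (f : C(Y, X))
    {U U' : Clopens X} {V V' : Clopens Y} (h : U ≤ U') (k : V ≤ V') :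
    clopenPreimage f U ⊓ V ≤ clopenPreimage f U' ⊓ V' :=
  fun _ hy => ⟨h hy.1, k hy.2⟩

theorem id_meet_le {X : Type u} [TopologicalSpace X] (U V : Clopens X) :
    clopenPreimage (ContinuousMap.id X) U ⊓ V ≤ U :=
  fun _ hy => hy.1

theorem comp_meet_le {X Y Z : Type u} [TopologicalSpace X] [TopologicalSpace Y]
    [TopologicalSpace Z] (f : C(Y, X)) (g : C(Z, Y)) (U : Clopens X) (W : Clopens Z) :
    clopenPreimage (f.comp g) U ⊓ W ≤ clopenPreimage g (clopenPreimage f U ⊓ ⊤) ⊓ W :=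
  fun _ hz => ⟨⟨hz.1, trivial⟩, hz.2⟩

theorem top_le_meet {X Y : Type u} [TopologicalSpace X] [TopologicalSpace Y] (f : C(Y, X)) :
    ⊤ ≤ clopenPreimage f ⊤ ⊓ ⊤ :=
  fun _ _ => ⟨trivial, trivial⟩

theorem Presh.Hom.naturality {A B : Presh.{u} R} (F : Presh.Hom A B) {U U' : Clopens A.base}
    {V V' : Clopens B.base} (h : U ≤ U') (k : V ≤ V') :
    A.res h ≫ F.app U V = F.app U' V' ≫ B.res (meet_mono F.f h k) :=
  F.nat.naturality (X := op (U', V')) (Y := op (U, V)) (Quiver.Hom.op (homOfLE h, homOfLE k))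

theorem Precosh.Hom.naturality {N M : Precosh.{u} R} (F : Precosh.Hom N M) {U U' : Clopens M.base}
    {V V' : Clopens N.base} (h : U ≤ U') (k : V ≤ V') :
    N.cor (meet_mono F.f h k) ≫ F.app U' V' = F.app U V ≫ M.cor h :=
  F.nat.naturality (X := (U, V)) (Y := (U', V')) (homOfLE h, homOfLE k)

/-- Build a morphism of presheaves from its components. -/
def Presh.Hom.mk' {A B : Presh.{u} R} (f : C(B.base, A.base))
    (app : ∀ U V, A.fn.obj (op U) ⟶ B.fn.obj (op (clopenPreimage f U ⊓ V)))
    (nat : ∀ {U U' V V'} (h : U ≤ U') (k : V ≤ V'),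
      A.res h ≫ app U V = app U' V' ≫ B.res (meet_mono f h k)) : Presh.Hom A B where
  f := f
  nat :=
    { app := fun p => app p.unop.1 p.unop.2
      naturality := fun _ _ h => nat (leOfHom h.unop.1) (leOfHom h.unop.2) }

/-- Build a morphism of precosheaves from its components. -/
def Precosh.Hom.mk' {N M : Precosh.{u} R} (f : C(N.base, M.base))
    (app : ∀ U V, N.fn.obj (clopenPreimage f U ⊓ V) ⟶ M.fn.obj U)
    (nat : ∀ {U U' V V'} (h : U ≤ U') (k : V ≤ V'),
      N.cor (meet_mono f h k) ≫ app U' V' = app U V ≫ M.cor h) : Precosh.Hom N M where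
  f := f
  nat :=
    { app := fun p => app p.1 p.2
      naturality := fun _ _ h => nat (leOfHom h.1) (leOfHom h.2) }

theorem Presh.Hom.ext_app {A B : Presh.{u} R} {F G : Presh.Hom A B} (hf : F.f = G.f)
    (h : ∀ U V, F.app U V = G.app U V ≫ B.res (by rw [hf])) : F = G := by
  obtain ⟨f, φ⟩ := F
  obtain ⟨g, ψ⟩ := G
  obtain rfl : f = g := hf
  congr 1
  ext p : 2
  exact (h p.unop.1 p.unop.2).trans (by erw [Presh.res_self, Category.comp_id])

theorem Precosh.Hom.ext_app {N M : Precosh.{u} R} {F G : Precosh.Hom N M} (hf : F.f = G.f)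
    (h : ∀ U V, F.app U V = N.cor (by rw [hf]) ≫ G.app U V) : F = G := by
  obtain ⟨f, φ⟩ := F
  obtain ⟨g, ψ⟩ := G
  obtain rfl : f = g := hf
  congr 1
  ext p : 2
  exact (h p.1 p.2).trans (by erw [Precosh.cor_self, Category.id_comp])

theorem Presh.Hom.ext_heq {A B : Presh.{u} R} {F G : Presh.Hom A B} (hf : F.f = G.f)
    (h : ∀ U V, HEq (F.app U V) (G.app U V)) : F = G := by
  obtain ⟨f, φ⟩ := F
  obtain ⟨g, ψ⟩ := G
  obtain rfl : f = g := hf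
  congr 1
  ext p : 2
  exact eq_of_heq (h p.unop.1 p.unop.2)

theorem Precosh.Hom.ext_heq {N M : Precosh.{u} R} {F G : Precosh.Hom N M} (hf : F.f = G.f)
    (h : ∀ U V, HEq (F.app U V) (G.app U V)) : F = G := by
  obtain ⟨f, φ⟩ := F
  obtain ⟨g, ψ⟩ := G
  obtain rfl : f = g := hf
  congr 1
  ext p : 2
  exact eq_of_heq (h p.1 p.2)

/-- Composition of morphisms of presheaves: on `U` and `W` it is
`A(U) ⟶ B(f⁻¹(U)) ⟶ C(g⁻¹(f⁻¹(U)) ∩ W)`. -/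
def Presh.Hom.comp {A B C : Presh.{u} R} (F : Presh.Hom A B) (G : Presh.Hom B C) :
    Presh.Hom A C :=
  Presh.Hom.mk' (F.f.comp G.f)
    (fun U W => F.app U ⊤ ≫ G.app (clopenPreimage F.f U ⊓ ⊤) W ≫
      C.res (comp_meet_le F.f G.f U W))
    (fun {U U' V V'} h k => by
      rw [← Category.assoc, F.naturality h le_rfl, Category.assoc, ← Category.assoc (B.res _),
        G.naturality _ k]
      simp only [Category.assoc, Presh.res_res])

/-- Composition of morphisms of precosheaves: on `U` and `V` it is
`N(f⁻¹(g⁻¹(U)) ∩ V) ⟶ M(g⁻¹(U)) ⟶ L(U)`. -/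
def Precosh.Hom.comp {N M L : Precosh.{u} R} (F : Precosh.Hom N M) (G : Precosh.Hom M L) :
    Precosh.Hom N L :=
  Precosh.Hom.mk' (G.f.comp F.f)
    (fun U V => N.cor (comp_meet_le G.f F.f U V) ≫
      F.app (clopenPreimage G.f U ⊓ ⊤) V ≫ G.app U ⊤)
    (fun {U U' V V'} h k => by
      rw [Category.assoc, Category.assoc, ← G.naturality h le_rfl, ← Category.assoc (F.app _ _),
        ← F.naturality _ k]
      simp only [← Category.assoc, Precosh.cor_cor])

instance : Category (Presh.{u} R) where
  Hom := Presh.Hom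
  id A := Presh.Hom.mk' (ContinuousMap.id _) (fun U V => A.res (id_meet_le U V)) (fun _ _ => by
    rw [Presh.res_res, Presh.res_res])
  comp F G := F.comp G
  id_comp {A B} F := by
    refine Presh.Hom.ext_app rfl fun U V => ?_
    change A.res (id_meet_le U ⊤) ≫ F.app (clopenPreimage (ContinuousMap.id _) U ⊓ ⊤) V ≫
      B.res (comp_meet_le (ContinuousMap.id _) F.f U V) = F.app U V ≫ B.res le_rfl
    rw [← Category.assoc, F.naturality _ le_rfl, Category.assoc, Presh.res_res]
    rfl
  comp_id {A B} F := by
    refine Presh.Hom.ext_app rfl fun U V => ?_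
    change F.app U ⊤ ≫ B.res (id_meet_le (clopenPreimage F.f U ⊓ ⊤) V) ≫
      B.res (comp_meet_le F.f (ContinuousMap.id _) U V) = F.app U V ≫ B.res le_rfl
    rw [Presh.res_res, Presh.res_self, Category.comp_id]
    have := F.naturality (le_refl U) (le_top : V ≤ ⊤)
    rw [Presh.res_self, Category.id_comp] at this
    exact this.symm
  assoc {A B C D} F G H := by
    refine Presh.Hom.ext_app rfl fun U V => ?_
    change (F.app U ⊤ ≫ G.app _ ⊤ ≫ C.res (comp_meet_le F.f G.f U ⊤)) ≫
        H.app (clopenPreimage (F.f.comp G.f) U ⊓ ⊤) V ≫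
        D.res (comp_meet_le (F.f.comp G.f) H.f U V) =
      (F.app U ⊤ ≫ (G.app (clopenPreimage F.f U ⊓ ⊤) ⊤ ≫ H.app _ V ≫
        D.res (comp_meet_le G.f H.f _ V)) ≫ D.res (comp_meet_le F.f (G.f.comp H.f) U V)) ≫
        D.res le_rfl
    simp only [Category.assoc]
    rw [← Category.assoc (C.res _), H.naturality _ le_rfl]
    simp only [Category.assoc]
    rw [Presh.res_res, Presh.res_res]
    erw [Presh.res_res]

instance : Category (Precosh.{u} R) where
  Hom := Precosh.Hom
  id A := Precosh.Hom.mk' (ContinuousMap.id _) (fun U V => A.cor (id_meet_le U V)) (fun _ _ => by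
    rw [Precosh.cor_cor, Precosh.cor_cor])
  comp F G := F.comp G
  id_comp {A B} F := by
    refine Precosh.Hom.ext_app rfl fun U V => ?_
    change A.cor (comp_meet_le F.f (ContinuousMap.id _) U V) ≫
      A.cor (id_meet_le (clopenPreimage F.f U ⊓ ⊤) V) ≫ F.app U ⊤ = A.cor le_rfl ≫ F.app U V
    rw [Precosh.cor_cor_assoc, Precosh.cor_self A le_rfl, Category.id_comp]
    have := F.naturality (le_refl U) (le_top : V ≤ ⊤)
    rw [Precosh.cor_self, Category.comp_id] at this
    exact this
  comp_id {A B} F := by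
    refine Precosh.Hom.ext_app rfl fun U V => ?_
    change A.cor (comp_meet_le (ContinuousMap.id _) F.f U V) ≫
      F.app (clopenPreimage (ContinuousMap.id _) U ⊓ ⊤) V ≫ B.cor (id_meet_le U ⊤) =
        A.cor le_rfl ≫ F.app U V
    rw [← F.naturality _ le_rfl, Precosh.cor_cor_assoc]
    rfl
  assoc {A B C D} F G H := by
    refine Precosh.Hom.ext_app rfl fun U V => ?_
    change A.cor (comp_meet_le H.f (G.f.comp F.f) U V) ≫
        (A.cor (comp_meet_le G.f F.f (clopenPreimage H.f U ⊓ ⊤) V) ≫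
          F.app (clopenPreimage G.f (clopenPreimage H.f U ⊓ ⊤) ⊓ ⊤) V ≫ G.app _ ⊤) ≫ H.app U ⊤ =
      A.cor le_rfl ≫ A.cor (comp_meet_le (H.f.comp G.f) F.f U V) ≫
        F.app (clopenPreimage (H.f.comp G.f) U ⊓ ⊤) V ≫
        B.cor (comp_meet_le H.f G.f U ⊤) ≫ G.app _ ⊤ ≫ H.app U ⊤
    rw [← Category.assoc (F.app _ _) (B.cor _), ← F.naturality _ le_rfl]
    simp only [Category.assoc]
    rw [Precosh.cor_cor_assoc, Precosh.cor_cor_assoc]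
    erw [Precosh.cor_cor_assoc]

variable (R)

/-- Evaluation `A ↦ A(X)` on presheaves. -/
def Presh.eval : Presh.{u} R ⥤ DMod.{u} R where
  obj A := A.fn.obj (op ⊤)
  map {A B} F := Presh.Hom.app F ⊤ ⊤ ≫ B.res (top_le_meet F.f)
  map_id A := (A.res_res _ _).trans (A.res_self _)
  map_comp {A B C} F G := by
    change (Presh.Hom.app F ⊤ ⊤ ≫ Presh.Hom.app G (clopenPreimage F.f ⊤ ⊓ ⊤) ⊤ ≫
        C.res (comp_meet_le F.f G.f ⊤ ⊤)) ≫ C.res (top_le_meet (F.f.comp G.f)) =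
      (Presh.Hom.app F ⊤ ⊤ ≫ B.res (top_le_meet F.f)) ≫ Presh.Hom.app G ⊤ ⊤ ≫
        C.res (top_le_meet G.f)
    rw [Category.assoc, Category.assoc, Category.assoc, ← Category.assoc (B.res _),
      Presh.Hom.naturality G _ le_rfl]
    simp only [Category.assoc]
    rw [Presh.res_res, Presh.res_res]

/-- Evaluation `M ↦ M(X)` on precosheaves. -/
def Precosh.eval : Precosh.{u} R ⥤ PMod.{u} R where
  obj M := M.fn.obj ⊤
  map {N M} F := N.cor (top_le_meet F.f) ≫ Precosh.Hom.app F ⊤ ⊤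
  map_id A := (A.cor_cor _ _).trans (A.cor_self _)
  map_comp {N M L} F G := by
    change N.cor (top_le_meet (G.f.comp F.f)) ≫ N.cor (comp_meet_le G.f F.f ⊤ ⊤) ≫
        Precosh.Hom.app F (clopenPreimage G.f ⊤ ⊓ ⊤) ⊤ ≫ Precosh.Hom.app G ⊤ ⊤ =
      (N.cor (top_le_meet F.f) ≫ Precosh.Hom.app F ⊤ ⊤) ≫ M.cor (top_le_meet G.f) ≫
        Precosh.Hom.app G ⊤ ⊤
    rw [Category.assoc, ← Category.assoc (Precosh.Hom.app F ⊤ ⊤),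
      ← Precosh.Hom.naturality F _ le_rfl]
    simp only [Category.assoc]
    rw [Precosh.cor_cor_assoc, Precosh.cor_cor_assoc]

variable {R}

/-- The map `A(U₁ ∪ ⋯ ∪ Uₙ) → ∏ A(Uᵢ)`. -/
def Presh.toProd (A : Presh.{u} R) {n : ℕ} (U : Fin n → Clopens A.base) :
    A.fn.obj (op (Finset.univ.sup U)) →ₗ[Rᵐᵒᵖ] (∀ i, A.fn.obj (op (U i))) :=
  LinearMap.pi fun i => (A.res (Finset.le_sup (Finset.mem_univ i))).lin

/-- The map `p - q : ∏ A(Uᵢ) → ∏ A(Uᵢ ∩ Uⱼ)`. -/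
def Presh.diff (A : Presh.{u} R) {n : ℕ} (U : Fin n → Clopens A.base) :
    (∀ i, A.fn.obj (op (U i))) →ₗ[Rᵐᵒᵖ] (∀ ij : Fin n × Fin n, A.fn.obj (op (U ij.1 ⊓ U ij.2))) :=
  LinearMap.pi fun ij => (A.res inf_le_left).lin.comp (LinearMap.proj ij.1) -
    (A.res inf_le_right).lin.comp (LinearMap.proj ij.2)

/-- A presheaf is a sheaf if for all clopen `U₁, …, Uₙ` (`n = 0` allowed, so that `A(∅) = 0`) the
sequence `0 → A(U₁ ∪ ⋯ ∪ Uₙ) → ∏ A(Uᵢ) → ∏ A(Uᵢ ∩ Uⱼ)` is exact. -/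
def Presh.IsSheaf (A : Presh.{u} R) : Prop :=
  ∀ (n : ℕ) (U : Fin n → Clopens A.base),
    Function.Injective (A.toProd U) ∧ Function.Exact (A.toProd U) (A.diff U)

/-- The map `⨁ M(Uᵢ) → M(U₁ ∪ ⋯ ∪ Uₙ)`; the finite direct sum is written as a product. -/
def Precosh.fromSum (M : Precosh.{u} R) {n : ℕ} (U : Fin n → Clopens M.base) :
    (∀ i, M.fn.obj (U i)) →L[R] M.fn.obj (Finset.univ.sup U) :=
  ∑ i, (M.cor (Finset.le_sup (Finset.mem_univ i))).lin.comp
    (ContinuousLinearMap.proj (R := R) (φ := fun i => M.fn.obj (U i)) i)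

/-- The map `p - q : ⨁ M(Uᵢ ∩ Uⱼ) → ⨁ M(Uᵢ)`. -/
def Precosh.diff (M : Precosh.{u} R) {n : ℕ} (U : Fin n → Clopens M.base) :
    (∀ ij : Fin n × Fin n, M.fn.obj (U ij.1 ⊓ U ij.2)) →L[R] (∀ i, M.fn.obj (U i)) :=
  ∑ ij : Fin n × Fin n,
    ((ContinuousLinearMap.single R (fun i => (M.fn.obj (U i) : Type u)) ij.1).comp
        (M.cor inf_le_left).lin -
      (ContinuousLinearMap.single R (fun i => (M.fn.obj (U i) : Type u)) ij.2).comp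
        (M.cor inf_le_right).lin).comp
    (ContinuousLinearMap.proj (R := R)
      (φ := fun ij : Fin n × Fin n => M.fn.obj (U ij.1 ⊓ U ij.2)) ij)

/-- A precosheaf is a cosheaf if for all clopen `U₁, …, Uₙ` (`n = 0` allowed, so that `M(∅) = 0`)
the sequence `⨁ M(Uᵢ ∩ Uⱼ) → ⨁ M(Uᵢ) → M(U₁ ∪ ⋯ ∪ Uₙ) → 0` is exact. -/
def Precosh.IsCosheaf (M : Precosh.{u} R) : Prop :=
  ∀ (n : ℕ) (U : Fin n → Clopens M.base),
    Function.Exact (M.diff U) (M.fromSum U) ∧ Function.Surjective (M.fromSum U)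

variable (R)

/-- The category of sheaves of discrete right `R`-modules over profinite spaces. -/
abbrev Shf : Type (u + 1) :=
  ObjectProperty.FullSubcategory (C := Presh.{u} R) Presh.IsSheaf

/-- The category of cosheaves of profinite left `R`-modules over profinite spaces. -/
abbrev CoShf : Type (u + 1) :=
  ObjectProperty.FullSubcategory (C := Precosh.{u} R) Precosh.IsCosheaf

/-- Evaluation of sheaves at the whole base space. -/
def Shf.eval : Shf.{u} R ⥤ DMod.{u} R :=
  ObjectProperty.ι _ ⋙ Presh.eval R

/-- Evaluation of cosheaves at the whole base space. -/
def CoShf.eval : CoShf.{u} R ⥤ PMod.{u} R :=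
  ObjectProperty.ι _ ⋙ Precosh.eval R

end Presheaves

/-! ### Duality between sheaves and cosheaves -/

section DualSheaves

variable {R : Type u} [Ring R] [TopologicalSpace R]

theorem Presh.toProd_apply (A : Presh.{u} R) {n : ℕ} (U : Fin n → Clopens A.base) (a i) :
    A.toProd U a i = (A.res (Finset.le_sup (Finset.mem_univ i))).lin a := rfl

theorem Presh.diff_apply (A : Presh.{u} R) {n : ℕ} (U : Fin n → Clopens A.base) (s ij) :
    A.diff U s ij = (A.res (inf_le_left : U ij.1 ⊓ U ij.2 ≤ _)).lin (s ij.1) -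
      (A.res (inf_le_right : U ij.1 ⊓ U ij.2 ≤ _)).lin (s ij.2) := rfl

theorem Precosh.fromSum_apply (M : Precosh.{u} R) {n : ℕ} (U : Fin n → Clopens M.base) (m) :
    M.fromSum U m = ∑ i, (M.cor (Finset.le_sup (Finset.mem_univ i))).lin (m i) := by
  simp [Precosh.fromSum]

theorem Precosh.diff_apply (M : Precosh.{u} R) {n : ℕ} (U : Fin n → Clopens M.base) (m) :
    M.diff U m = ∑ ij : Fin n × Fin n,
      (Pi.single ij.1 ((M.cor (inf_le_left : U ij.1 ⊓ U ij.2 ≤ _)).lin (m ij)) -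
        Pi.single ij.2 ((M.cor (inf_le_right : U ij.1 ⊓ U ij.2 ≤ _)).lin (m ij))) := by
  simp [Precosh.diff]

/-- Characters of abelian groups extend along injections. -/
theorem exists_extend_character {A B : Type u} [AddCommGroup A] [AddCommGroup B] (f : A →+ B)
    (hf : Function.Injective f) (χ : A →+ UnitAddCircle) :
    ∃ ψ : B →+ UnitAddCircle, ∀ a, ψ (f a) = χ a := by
  obtain ⟨ψ, hψ⟩ := (Module.Baer.of_divisible UnitAddCircle).extension_property_addMonoidHom
    f hf χ
  exact ⟨ψ, fun a => DFunLike.congr_fun hψ a⟩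

/-- A character vanishing on the kernel of a homomorphism factors through it. -/
theorem exists_factor_character {A B : Type u} [AddCommGroup A] [AddCommGroup B] (f : A →+ B)
    (χ : A →+ UnitAddCircle) (h : ∀ a, f a = 0 → χ a = 0) :
    ∃ ψ : B →+ UnitAddCircle, ∀ a, ψ (f a) = χ a := by
  have hk : f.ker ≤ χ.ker := fun a ha => h a ha
  obtain ⟨ψ, hψ⟩ := exists_extend_character (QuotientAddGroup.kerLift f)
    (QuotientAddGroup.kerLift_injective f) (QuotientAddGroup.lift f.ker χ hk)
  exact ⟨ψ, fun a => hψ (QuotientAddGroup.mk a)⟩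

variable [IsTopologicalRing R] [CompactSpace R]

/-- The dual precosheaf `U ↦ A(U)^∨`. -/
def Presh.dualObj (A : Presh.{u} R) : Precosh.{u} R where
  base := A.base
  fn := A.fn.rightOp ⋙ DMod.dual R

/-- The dual presheaf `U ↦ M(U)^∨`. -/
def Precosh.dualObj (M : Precosh.{u} R) : Presh.{u} R where
  base := M.base
  fn := M.fn.op ⋙ PMod.dual R

theorem Presh.dualObj_cor (A : Presh.{u} R) {U V : Clopens A.base} (h : U ≤ V)
    (χ : PDual (A.fn.obj (op U))) (a : A.fn.obj (op V)) :
    DFunLike.coe (F := PDual (A.fn.obj (op V))) ((A.dualObj.cor h).lin χ) a =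
      χ ((A.res h).lin a) := rfl

theorem Precosh.dualObj_res (M : Precosh.{u} R) {U V : Clopens M.base} (h : U ≤ V)
    (χ : PDual (M.fn.obj V)) (m : M.fn.obj U) :
    DFunLike.coe (F := PDual (M.fn.obj U)) ((M.dualObj.res h).lin χ) m =
      χ ((M.cor h).lin m) := rfl

variable (R)

/-- The dual of a morphism of presheaves has the dual components. -/
def Presh.dual : (Presh.{u} R)ᵒᵖ ⥤ Precosh.{u} R where
  obj A := A.unop.dualObj
  map {A B} F := Precosh.Hom.mk' (N := A.unop.dualObj) (M := B.unop.dualObj) F.unop.f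
    (fun U V => (DMod.dual R).map (Presh.Hom.app F.unop U V).op)
    (fun h k => by
      have := congrArg (fun g => (DMod.dual R).map g.op) (Presh.Hom.naturality F.unop h k)
      simp only [op_comp, Functor.map_comp] at this
      exact this.symm)
  map_id A := by
    refine Precosh.Hom.ext_heq rfl fun U V => heq_of_eq ?_
    rfl
  map_comp {A B C} F G := by
    refine Precosh.Hom.ext_heq rfl fun U V => heq_of_eq ?_
    rfl

/-- The dual of a morphism of precosheaves has the dual components. -/
def Precosh.dual : (Precosh.{u} R)ᵒᵖ ⥤ Presh.{u} R where
  obj A := A.unop.dualObj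
  map {A B} F := Presh.Hom.mk' (A := A.unop.dualObj) (B := B.unop.dualObj) F.unop.f
    (fun U V => (PMod.dual R).map (Precosh.Hom.app F.unop U V).op)
    (fun h k => by
      have := congrArg (fun g => (PMod.dual R).map g.op) (Precosh.Hom.naturality F.unop h k)
      simp only [op_comp, Functor.map_comp] at this
      exact this.symm)
  map_id A := by
    refine Presh.Hom.ext_heq rfl fun U V => heq_of_eq ?_
    rfl
  map_comp {A B C} F G := by
    refine Presh.Hom.ext_heq rfl fun U V => heq_of_eq ?_
    rfl

variable {R}

/-- Evaluation of characters. -/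
def Presh.dualEval (A : Presh.{u} R) (V : Clopens A.base) :
    A.dualObj.fn.obj V →+ A.fn.obj (op V) →+ UnitAddCircle where
  toFun χ := AddMonoidHomClass.toAddMonoidHom (F := PDual (A.fn.obj (op V))) χ
  map_zero' := rfl
  map_add' _ _ := rfl

/-- Evaluation of characters. -/
def Precosh.dualEval (M : Precosh.{u} R) (V : Clopens M.base) :
    M.dualObj.fn.obj (op V) →+ M.fn.obj V →+ UnitAddCircle where
  toFun χ := AddMonoidHomClass.toAddMonoidHom (F := PDual (M.fn.obj V)) χ
  map_zero' := rfl
  map_add' _ _ := rfl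

theorem sum_pairing_single_left {n : ℕ} {A B : Fin n → Type u} [∀ i, AddCommGroup (A i)]
    [∀ i, AddCommGroup (B i)] (ev : ∀ i, A i →+ B i →+ UnitAddCircle) (s : ∀ i, B i) (i : Fin n)
    (x : A i) : ∑ k, ev k ((Pi.single i x : ∀ k, A k) k) (s k) = ev i x (s i) := by
  rw [Finset.sum_eq_single i]
  · simp
  · intro k _ hk
    simp [Pi.single_eq_of_ne hk]
  · simp

theorem sum_pairing_single_right {n : ℕ} {A B : Fin n → Type u} [∀ i, AddCommGroup (A i)]
    [∀ i, AddCommGroup (B i)] (ev : ∀ i, A i →+ B i →+ UnitAddCircle) (s : ∀ i, A i) (i : Fin n)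
    (x : B i) : ∑ k, ev k (s k) ((Pi.single i x : ∀ k, B k) k) = ev i (s i) x :=
  sum_pairing_single_left (fun i => (ev i).flip) s i x

theorem Presh.dual_diff (A : Presh.{u} R) {n : ℕ} (U : Fin n → Clopens A.base)
    (m : ∀ ij : Fin n × Fin n, A.dualObj.fn.obj (U ij.1 ⊓ U ij.2))
    (s : ∀ i, A.fn.obj (op (U i))) :
    ∑ k, A.dualEval (U k) (A.dualObj.diff U m k) (s k) =
      ∑ ij : Fin n × Fin n, A.dualEval (U ij.1 ⊓ U ij.2) (m ij) (A.diff U s ij) := by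
  have h : ∀ k, A.dualEval (U k) (A.dualObj.diff U m k) (s k) = ∑ ij : Fin n × Fin n,
      (A.dualEval (U k) ((Pi.single ij.1 ((A.dualObj.cor (inf_le_left : U ij.1 ⊓ U ij.2 ≤ _)).lin
          (m ij)) : ∀ k, A.dualObj.fn.obj (U k)) k) (s k) -
        A.dualEval (U k) ((Pi.single ij.2 ((A.dualObj.cor (inf_le_right : U ij.1 ⊓ U ij.2 ≤ _)).lin
          (m ij)) : ∀ k, A.dualObj.fn.obj (U k)) k) (s k)) := by
    intro k
    erw [A.dualObj.diff_apply, Finset.sum_apply, map_sum, AddMonoidHom.finsetSum_apply]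
    refine Finset.sum_congr rfl fun ij _ => ?_
    rw [Pi.sub_apply, map_sub, AddMonoidHom.sub_apply]
    rfl
  rw [Finset.sum_congr rfl fun k _ => h k, Finset.sum_comm]
  refine Finset.sum_congr rfl fun ij _ => ?_
  rw [Finset.sum_sub_distrib]
  rw [sum_pairing_single_left (fun i => A.dualEval (U i)),
    sum_pairing_single_left (fun i => A.dualEval (U i)), A.diff_apply, map_sub]
  rfl

theorem Precosh.dual_diff (M : Precosh.{u} R) {n : ℕ} (U : Fin n → Clopens M.base)
    (s : ∀ i, M.dualObj.fn.obj (op (U i)))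
    (m : ∀ ij : Fin n × Fin n, M.fn.obj (U ij.1 ⊓ U ij.2)) :
    ∑ k, M.dualEval (U k) (s k) (M.diff U m k) =
      ∑ ij : Fin n × Fin n, M.dualEval (U ij.1 ⊓ U ij.2) (M.dualObj.diff U s ij) (m ij) := by
  have h : ∀ k, M.dualEval (U k) (s k) (M.diff U m k) = ∑ ij : Fin n × Fin n,
      (M.dualEval (U k) (s k) ((Pi.single ij.1 ((M.cor (inf_le_left : U ij.1 ⊓ U ij.2 ≤ _)).lin
          (m ij)) : ∀ k, M.fn.obj (U k)) k) -
        M.dualEval (U k) (s k) ((Pi.single ij.2 ((M.cor (inf_le_right : U ij.1 ⊓ U ij.2 ≤ _)).lin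
          (m ij)) : ∀ k, M.fn.obj (U k)) k)) := by
    intro k
    rw [M.diff_apply, Finset.sum_apply, map_sum]
    refine Finset.sum_congr rfl fun ij _ => ?_
    rw [Pi.sub_apply, map_sub]
  rw [Finset.sum_congr rfl fun k _ => h k, Finset.sum_comm]
  refine Finset.sum_congr rfl fun ij _ => ?_
  rw [Finset.sum_sub_distrib]
  rw [sum_pairing_single_right (fun i => M.dualEval (U i)),
    sum_pairing_single_right (fun i => M.dualEval (U i))]
  rfl

theorem Presh.dual_fromSum (A : Presh.{u} R) {n : ℕ} (U : Fin n → Clopens A.base)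
    (χ : ∀ i, A.dualObj.fn.obj (U i)) (a : A.fn.obj (op (Finset.univ.sup U))) :
    A.dualEval _ (A.dualObj.fromSum U χ) a = ∑ i, A.dualEval _ (χ i) (A.toProd U a i) := by
  erw [A.dualObj.fromSum_apply, map_sum, AddMonoidHom.finsetSum_apply]
  rfl

theorem Precosh.dual_toProd (M : Precosh.{u} R) {n : ℕ} (U : Fin n → Clopens M.base)
    (χ : M.dualObj.fn.obj (op (Finset.univ.sup U))) (m : ∀ i, M.fn.obj (U i)) :
    M.dualEval _ χ (M.fromSum U m) = ∑ i, M.dualEval _ (M.dualObj.toProd U χ i) (m i) := by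
  refine (congrArg _ (M.fromSum_apply U m)).trans ?_
  exact map_sum (M.dualEval _ χ) _ _

theorem sum_comp_single {ι : Type} [Fintype ι] [DecidableEq ι] {A : ι → Type u}
    [∀ i, AddCommGroup (A i)] (ψ : (∀ i, A i) →+ UnitAddCircle) (s : ∀ i, A i) :
    ∑ i, ψ (Pi.single i (s i)) = ψ s := by
  rw [← map_sum, Finset.univ_sum_single]

theorem Presh.dualEval_injective (A : Presh.{u} R) (V : Clopens A.base) :
    Function.Injective (A.dualEval V) := fun χ _ h =>
  ContinuousAddMonoidHom.ext (f := (χ : PDual (A.fn.obj (op V)))) fun a => DFunLike.congr_fun h a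

theorem Precosh.dualEval_injective (M : Precosh.{u} R) (V : Clopens M.base) :
    Function.Injective (M.dualEval V) := fun χ _ h =>
  ContinuousAddMonoidHom.ext (f := (χ : PDual (M.fn.obj V))) fun a => DFunLike.congr_fun h a

/-- Any additive map on a discrete module is a character. -/
def Presh.dualMk (A : Presh.{u} R) (V : Clopens A.base) (ψ : A.fn.obj (op V) →+ UnitAddCircle) :
    A.dualObj.fn.obj V :=
  (⟨ψ, continuous_of_discreteTopology⟩ : PDual (A.fn.obj (op V)))

theorem Presh.IsSheaf.dual {A : Presh.{u} R} (hA : A.IsSheaf) : A.dualObj.IsCosheaf := by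
  intro n (U : Fin n → Clopens A.base)
  obtain ⟨hinj, hex⟩ := hA n U
  refine ⟨fun χ => ⟨fun hχ => ?_, ?_⟩, fun χ => ?_⟩
  · let X : (∀ i, A.fn.obj (op (U i))) →+ UnitAddCircle :=
      ∑ i, (A.dualEval (U i) (χ i)).comp
        (Pi.evalAddMonoidHom (fun i => (A.fn.obj (op (U i)) : Type u)) i)
    have hX : ∀ s, X s = ∑ i, A.dualEval (U i) (χ i) (s i) := fun s => by
      simp [X]
    obtain ⟨ψ, hψ⟩ := exists_factor_character (A.diff U).toAddMonoidHom X (fun s hs => by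
      obtain ⟨a, rfl⟩ := (hex s).1 hs
      rw [hX]
      refine (A.dual_fromSum U χ a).symm.trans ?_
      rw [hχ]
      rfl)
    let m : ∀ ij : Fin n × Fin n, A.dualObj.fn.obj (U ij.1 ⊓ U ij.2) := fun ij =>
      A.dualMk _ (ψ.comp (AddMonoidHom.single
        (fun ij : Fin n × Fin n => (A.fn.obj (op (U ij.1 ⊓ U ij.2)) : Type u)) ij))
    have hm : ∀ s, ∑ k, A.dualEval (U k) (A.dualObj.diff U m k) (s k) = X s := fun s => by
      rw [A.dual_diff U m s, ← hψ s]
      exact sum_comp_single ψ _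
    refine ⟨m, funext fun k => A.dualEval_injective _ (AddMonoidHom.ext fun a => ?_)⟩
    have := hm (Pi.single k a)
    rw [hX, sum_pairing_single_right (fun i => A.dualEval (U i)),
      sum_pairing_single_right (fun i => A.dualEval (U i))] at this
    exact this
  · rintro ⟨m, rfl⟩
    refine A.dualEval_injective _ (AddMonoidHom.ext fun a => ?_)
    refine ((A.dual_fromSum U _ a).trans (A.dual_diff U m _)).trans ?_
    rw [(hex (A.toProd U a)).2 ⟨a, rfl⟩]
    exact Finset.sum_eq_zero fun ij _ => map_zero _
  · obtain ⟨ψ, hψ⟩ := exists_extend_character (A.toProd U).toAddMonoidHom hinj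
      (A.dualEval _ χ)
    refine ⟨fun i => A.dualMk _ (ψ.comp (AddMonoidHom.single
        (fun i => (A.fn.obj (op (U i)) : Type u)) i)),
      A.dualEval_injective _ (AddMonoidHom.ext fun a => ?_)⟩
    exact ((A.dual_fromSum U _ a).trans (sum_comp_single ψ _)).trans (hψ a)

theorem Precosh.IsCosheaf.dual {M : Precosh.{u} R} (hM : M.IsCosheaf) : M.dualObj.IsSheaf := by
  intro n (U : Fin n → Clopens M.base)
  obtain ⟨hex, hsurj⟩ := hM n U
  refine ⟨?_, fun χ => ⟨fun hχ => ?_, ?_⟩⟩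
  · rw [injective_iff_map_eq_zero]
    intro χ hχ
    refine M.dualEval_injective _ (AddMonoidHom.ext fun x => ?_)
    obtain ⟨m, rfl⟩ := hsurj x
    refine (M.dual_toProd U χ m).trans ?_
    rw [hχ]
    exact Finset.sum_eq_zero fun i _ => rfl
  · let X : (∀ i, M.fn.obj (U i)) →+ UnitAddCircle :=
      ∑ i, (M.dualEval (U i) (χ i)).comp
        (Pi.evalAddMonoidHom (fun i => (M.fn.obj (U i) : Type u)) i)
    have hX : ∀ s, X s = ∑ i, M.dualEval (U i) (χ i) (s i) := fun s => by
      simp [X]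
    have hXc : Continuous X := by
      rw [show (X : _ → _) = fun s => ∑ i, M.dualEval (U i) (χ i) (s i) from funext hX]
      exact continuous_finsetSum _ fun i _ =>
        (χ i : PDual (M.fn.obj (U i))).continuous_toFun.comp (continuous_apply i)
    have hker : ∀ s, M.fromSum U s = 0 → X s = 0 := fun s hs => by
      obtain ⟨m, rfl⟩ := (hex s).1 hs
      rw [hX, M.dual_diff, hχ]
      exact Finset.sum_eq_zero fun ij _ => rfl
    have hX2 : ∀ s t, M.fromSum U s = M.fromSum U t → X s = X t := fun s t h => by
      rw [← sub_eq_zero, ← map_sub]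
      exact hker _ (by rw [map_sub, h, sub_self])
    let g := Function.surjInv hsurj
    have hg : ∀ x, M.fromSum U (g x) = x := Function.surjInv_eq hsurj
    have hq : Topology.IsQuotientMap (M.fromSum U) :=
      (M.fromSum U).continuous.isClosedMap.isQuotientMap (M.fromSum U).continuous hsurj
    let ψ : PDual (M.fn.obj (Finset.univ.sup U)) :=
      { toFun := fun x => X (g x)
        map_zero' := (hX2 _ 0 (by rw [hg, map_zero])).trans (map_zero X)
        map_add' := fun x y => by
          rw [← map_add]
          exact hX2 _ _ (by rw [hg, map_add, hg, hg])
        continuous_toFun := by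
          refine hq.continuous_iff.2 ?_
          rw [show (fun x => X (g x)) ∘ M.fromSum U = X from funext fun s => hX2 _ _ (hg _)]
          exact hXc }
    refine ⟨ψ, funext fun k => M.dualEval_injective _ (AddMonoidHom.ext fun x => ?_)⟩
    have h1 := M.dual_toProd U ψ (Pi.single k x)
    have h2 : M.dualEval _ ψ (M.fromSum U (Pi.single k x)) = X (Pi.single k x) := hX2 _ _ (hg _)
    rw [hX, sum_pairing_single_right (fun i => M.dualEval (U i))] at h2
    rw [sum_pairing_single_right (fun i => M.dualEval (U i))] at h1
    exact h1.symm.trans h2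
  · rintro ⟨ψ, rfl⟩
    refine funext fun ij => M.dualEval_injective _ (AddMonoidHom.ext fun x => ?_)
    change M.dualEval _ ψ ((M.cor _).lin ((M.cor _).lin x)) -
      M.dualEval _ ψ ((M.cor _).lin ((M.cor _).lin x)) = 0
    rw [sub_eq_zero]
    have h1 := congrArg (fun h => h.lin x) (M.cor_cor (inf_le_left : U ij.1 ⊓ U ij.2 ≤ _)
      (Finset.le_sup (Finset.mem_univ ij.1)))
    have h2 := congrArg (fun h => h.lin x) (M.cor_cor (inf_le_right : U ij.1 ⊓ U ij.2 ≤ _)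
      (Finset.le_sup (Finset.mem_univ ij.2)))
    exact congrArg _ (h1.trans h2.symm)

variable (R)

/-- Pontryagin duality from sheaves to cosheaves. -/
def Shf.dual : (Shf.{u} R)ᵒᵖ ⥤ CoShf.{u} R :=
  ObjectProperty.lift _ ((ObjectProperty.ι _).op ⋙ Presh.dual R) fun A => A.unop.property.dual

/-- Pontryagin duality from cosheaves to sheaves. -/
def CoShf.dual : (CoShf.{u} R)ᵒᵖ ⥤ Shf.{u} R :=
  ObjectProperty.lift _ ((ObjectProperty.ι _).op ⋙ Precosh.dual R) fun M => M.unop.property.dual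

end DualSheaves

/-! ### Étale spaces of modules -/

section TotalSpaces

/-- The disjoint union `⨆ₓ Eₓ` of a family of sets indexed by `X`. -/
@[ext]
structure Tot {X : Type u} (E : X → Type u) where
  pt : X
  val : E pt

/-- The fibre product `E ×_X E` of the total space of a family with itself: triples consisting of
a point `x` and two elements of `Eₓ`. -/
structure FibProd {X : Type u} (E : X → Type u) where
  pt : X
  fst : E pt
  snd : E pt

/-- The fibre product `E ×_X Y` of the total space of a family over `X` with a map `Y → X`: pairs
of a point `y` and an element of `E_{f(y)}`. -/
structure Pull {X Y : Type u} (E : X → Type u) (f : Y → X) where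
  pt : Y
  val : E (f pt)

/-- `E ×_X E` carries the subspace topology from `E × E`. -/
instance {X : Type u} (E : X → Type u) [TopologicalSpace (Tot E)] : TopologicalSpace (FibProd E) :=
  TopologicalSpace.induced
    (fun q => ((⟨q.pt, q.fst⟩, ⟨q.pt, q.snd⟩) : Tot E × Tot E)) inferInstance

/-- `E ×_X Y` carries the subspace topology from `E × Y`. -/
instance {X Y : Type u} (E : X → Type u) (f : Y → X) [TopologicalSpace (Tot E)]
    [TopologicalSpace Y] : TopologicalSpace (Pull E f) :=
  TopologicalSpace.induced (fun q => ((⟨f q.pt, q.val⟩, q.pt) : Tot E × Y)) inferInstance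

theorem continuous_fibProd_mk {X T : Type u} (E : X → Type u) [TopologicalSpace (Tot E)]
    [TopologicalSpace T] {g : T → X} {s t : ∀ x, E (g x)}
    (hs : Continuous fun x => (⟨g x, s x⟩ : Tot E))
    (ht : Continuous fun x => (⟨g x, t x⟩ : Tot E)) :
    Continuous fun x => (⟨g x, s x, t x⟩ : FibProd E) :=
  continuous_induced_rng.2 (hs.prodMk ht)

theorem continuous_pull_mk {X Y T : Type u} (E : X → Type u) (f : Y → X) [TopologicalSpace (Tot E)]
    [TopologicalSpace Y] [TopologicalSpace T] {g : T → Y} {s : ∀ x, E (f (g x))}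
    (hs : Continuous fun x => (⟨f (g x), s x⟩ : Tot E)) (hg : Continuous g) :
    Continuous fun x => (⟨g x, s x⟩ : Pull E f) :=
  continuous_induced_rng.2 (hs.prodMk hg)

theorem continuous_pull_pt {X Y : Type u} (E : X → Type u) (f : Y → X) [TopologicalSpace (Tot E)]
    [TopologicalSpace Y] : Continuous fun q : Pull E f => q.pt :=
  continuous_snd.comp (continuous_induced_dom (f := fun q : Pull E f =>
    ((⟨f q.pt, q.val⟩, q.pt) : Tot E × Y)))

theorem continuous_pull_val {X Y : Type u} (E : X → Type u) (f : Y → X) [TopologicalSpace (Tot E)]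
    [TopologicalSpace Y] : Continuous fun q : Pull E f => (⟨f q.pt, q.val⟩ : Tot E) :=
  continuous_fst.comp (continuous_induced_dom (f := fun q : Pull E f =>
    ((⟨f q.pt, q.val⟩, q.pt) : Tot E × Y)))

end TotalSpaces

section Etale

variable (R : Type u) [Ring R] [TopologicalSpace R]

/-- An étale space of right `R`-modules over a profinite space, presented as the disjoint union of
its fibres, with a topology on this disjoint union. -/
structure EtaleSp where
  base : Profinite.{u}
  fibre : base → Type u
  [addCommGroup : ∀ x, AddCommGroup (fibre x)]
  [module : ∀ x, Module Rᵐᵒᵖ (fibre x)]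
  [topTot : TopologicalSpace (Tot fibre)]
  isLocalHomeomorph : IsLocalHomeomorph (Tot.pt : Tot fibre → base)
  continuous_zero : Continuous fun x => (⟨x, 0⟩ : Tot fibre)
  continuous_add : Continuous fun q : FibProd fibre => (⟨q.pt, q.fst + q.snd⟩ : Tot fibre)
  continuous_smul : Continuous fun q : Tot fibre × R =>
    (⟨q.1.pt, MulOpposite.op q.2 • q.1.val⟩ : Tot fibre)

attribute [instance] EtaleSp.addCommGroup EtaleSp.module EtaleSp.topTot

variable {R}

/-- A morphism `(𝒜, X) ⟶ (ℬ, Y)` of étale spaces: a continuous map `f : Y → X` and a continuous map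
`𝒜 ×_X Y → ℬ` consisting of linear maps `A_{f(y)} → B_y`. -/
@[ext]
structure EtaleSp.Hom (A B : EtaleSp.{u} R) where
  f : C(B.base, A.base)
  φ : ∀ y, A.fibre (f y) →ₗ[Rᵐᵒᵖ] B.fibre y
  continuous_φ : Continuous fun q : Pull A.fibre f => (⟨q.pt, φ q.pt q.val⟩ : Tot B.fibre)

instance : Category (EtaleSp.{u} R) where
  Hom := EtaleSp.Hom
  id A :=
    { f := ContinuousMap.id _
      φ := fun _ => LinearMap.id
      continuous_φ := continuous_pull_val A.fibre _ }
  comp {A B C} F G :=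
    { f := F.f.comp G.f
      φ := fun z => (G.φ z).comp (F.φ (G.f z))
      continuous_φ := by
        have hz : Continuous fun q : Pull A.fibre (F.f.comp G.f) => q.pt :=
          continuous_pull_pt A.fibre _
        have ha : Continuous fun q : Pull A.fibre (F.f.comp G.f) =>
            (⟨F.f (G.f q.pt), q.val⟩ : Tot A.fibre) :=
          continuous_pull_val A.fibre _
        have h1 : Continuous fun q : Pull A.fibre (F.f.comp G.f) =>
            (⟨G.f q.pt, q.val⟩ : Pull A.fibre F.f) :=
          continuous_pull_mk A.fibre F.f ha (G.f.continuous.comp hz)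
        exact G.continuous_φ.comp
          (continuous_pull_mk B.fibre G.f (F.continuous_φ.comp h1) hz) }

/-- The module of continuous sections of `𝒜` along a continuous map `g : T → X`, that is, of
continuous maps `T → 𝒜` lifting `g`, with pointwise operations. -/
def EtaleSp.sections (A : EtaleSp.{u} R) {T : Type u} [TopologicalSpace T] (g : C(T, A.base)) :
    Submodule Rᵐᵒᵖ (∀ t, A.fibre (g t)) where
  carrier := {s | Continuous fun t => (⟨g t, s t⟩ : Tot A.fibre)}
  zero_mem' := A.continuous_zero.comp g.continuous
  add_mem' hs ht := A.continuous_add.comp (continuous_fibProd_mk A.fibre hs ht)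
  smul_mem' r _ hs := A.continuous_smul.comp (hs.prodMk (continuous_const (y := r.unop)))

/-- Restriction of sections along a continuous map. -/
def EtaleSp.sectionsComp (A : EtaleSp.{u} R) {S T : Type u} [TopologicalSpace S]
    [TopologicalSpace T] (g : C(T, A.base)) (h : C(S, T)) :
    A.sections g →ₗ[Rᵐᵒᵖ] A.sections (g.comp h) where
  toFun s := ⟨fun x => s.1 (h x), s.2.comp h.continuous⟩
  map_add' _ _ := rfl
  map_smul' _ _ := rfl

/-- The action of a morphism of étale spaces on sections. -/
def EtaleSp.Hom.sections {A B : EtaleSp.{u} R} (F : EtaleSp.Hom A B) {T : Type u}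
    [TopologicalSpace T] (g : C(T, B.base)) :
    A.sections (F.f.comp g) →ₗ[Rᵐᵒᵖ] B.sections g where
  toFun s := ⟨fun t => F.φ (g t) (s.1 t),
    F.continuous_φ.comp (continuous_pull_mk A.fibre F.f s.2 g.continuous)⟩
  map_add' s t := Subtype.ext (funext fun x => map_add (F.φ (g x)) (s.1 x) (t.1 x))
  map_smul' r s := Subtype.ext (funext fun x => map_smul (F.φ (g x)) r (s.1 x))

variable [IsTopologicalRing R] [CompactSpace R]

theorem EtaleSp.isOpen_range_zero (A : EtaleSp.{u} R) :
    IsOpen (Set.range fun x => (⟨x, 0⟩ : Tot A.fibre)) := by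
  rw [isOpen_iff_mem_nhds]
  rintro _ ⟨x, rfl⟩
  obtain ⟨e, he, hfe⟩ := A.isLocalHomeomorph (⟨x, 0⟩ : Tot A.fibre)
  have h1 : ∀ᶠ y in nhds x, (⟨y, 0⟩ : Tot A.fibre) ∈ e.source :=
    A.continuous_zero.continuousAt.eventually (e.open_source.mem_nhds he)
  have h2 : ∀ᶠ a in nhds (⟨x, 0⟩ : Tot A.fibre), (⟨a.pt, 0⟩ : Tot A.fibre) ∈ e.source :=
    (A.isLocalHomeomorph.continuous.tendsto (⟨x, 0⟩ : Tot A.fibre)).eventually h1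
  filter_upwards [h2, e.open_source.mem_nhds he] with a ha ha'
  refine ⟨a.pt, e.injOn ha ha' ?_⟩
  rw [← hfe]

/-- The module of sections over a compact space is a discrete module. -/
theorem EtaleSp.sections_isOpen_annihilator (A : EtaleSp.{u} R) {T : Type u} [TopologicalSpace T]
    [CompactSpace T] (g : C(T, A.base)) (s : A.sections g) :
    IsOpen {r : R | MulOpposite.op r • s = 0} := by
  have hc : Continuous fun q : T × R => (⟨g q.1, MulOpposite.op q.2 • s.1 q.1⟩ : Tot A.fibre) :=
    A.continuous_smul.comp ((s.2.comp continuous_fst).prodMk continuous_snd)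
  have h2 : IsClosed (Prod.snd '' ((fun q : T × R =>
      (⟨g q.1, MulOpposite.op q.2 • s.1 q.1⟩ : Tot A.fibre)) ⁻¹'
        (Set.range fun x => (⟨x, 0⟩ : Tot A.fibre))ᶜ)) :=
    isClosedMap_snd_of_compactSpace _ (A.isOpen_range_zero.isClosed_compl.preimage hc)
  convert h2.isOpen_compl using 1
  ext r
  constructor
  · rintro h ⟨⟨t, r'⟩, ht, rfl⟩
    exact ht ⟨g t, congrArg (Tot.mk (g t)) (congrFun (congrArg Subtype.val h) t).symm⟩
  · intro h
    refine Subtype.ext (funext fun t => ?_)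
    by_contra hne
    refine h ⟨(t, r), ?_, rfl⟩
    rintro ⟨x, hx⟩
    simp only [Tot.mk.injEq] at hx
    obtain ⟨rfl, hx⟩ := hx
    exact hne (eq_of_heq hx).symm

/-- The discrete module of sections of an étale space along a map from a compact space. -/
def EtaleSp.sectionsMod (A : EtaleSp.{u} R) {T : Type u} [TopologicalSpace T] [CompactSpace T]
    (g : C(T, A.base)) : DMod.{u} R :=
  letI : TopologicalSpace (A.sections g) := ⊥
  haveI : DiscreteTopology (A.sections g) := ⟨rfl⟩
  { carrier := A.sections g
    continuousSMul := continuousSMul_of_isOpen_annihilator (A.sections_isOpen_annihilator g) }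

variable (R)

/-- The continuous product: the discrete module of global sections of an étale space. -/
def EtaleSp.contProd : EtaleSp.{u} R ⥤ DMod.{u} R where
  obj A := A.sectionsMod (ContinuousMap.id A.base)
  map {A B} F := ⟨(EtaleSp.Hom.sections (A := A) F (ContinuousMap.id B.base)).comp
    (A.sectionsComp (ContinuousMap.id A.base) (EtaleSp.Hom.f F))⟩

variable {R}

instance {X : Profinite.{u}} (U : Clopens X) : CompactSpace U :=
  isCompact_iff_compactSpace.1 U.isClosed.isCompact

/-- The inclusion of a clopen subset. -/
def clopenIncl {X : Profinite.{u}} (U : Clopens X) : C(U, X) :=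
  ⟨Subtype.val, continuous_subtype_val⟩

/-- The inclusion between clopen subsets. -/
def clopenInclusion {X : Type u} [TopologicalSpace X] {U V : Clopens X} (h : U ≤ V) : C(U, V) :=
  ⟨fun x => ⟨x.1, h x.2⟩, by fun_prop⟩

/-- The presheaf `U ↦ {continuous sections of 𝒜 over U}`, with restriction of functions. -/
def EtaleSp.toPreshObj (A : EtaleSp.{u} R) : Presh.{u} R where
  base := A.base
  fn :=
    { obj := fun U => A.sectionsMod (clopenIncl U.unop)
      map := fun {U V} h => ⟨A.sectionsComp (clopenIncl U.unop)
        (clopenInclusion (leOfHom h.unop))⟩ }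

theorem EtaleSp.isSheaf (A : EtaleSp.{u} R) : A.toPreshObj.IsSheaf := by
  intro n (U : Fin n → Clopens A.base)
  have hle : ∀ i, U i ≤ Finset.univ.sup U := fun i => Finset.le_sup (Finset.mem_univ i)
  have hcov : ∀ x : (Finset.univ.sup U : Clopens A.base), ∃ i, x.1 ∈ U i := fun x => by
    have := x.2
    rw [← SetLike.mem_coe, Clopens.coe_finset_sup] at this
    simpa using this
  refine ⟨?_, fun s => ⟨fun hs => ?_, ?_⟩⟩
  · intro s t hst
    refine Subtype.ext (funext fun x => ?_)
    obtain ⟨i, hi⟩ := hcov x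
    have := congrFun hst i
    exact congrFun (congrArg Subtype.val this) ⟨x.1, hi⟩
  · have hag : ∀ i j (x : A.base) (hi : x ∈ U i) (hj : x ∈ U j),
        (s i).1 ⟨x, hi⟩ = (s j).1 ⟨x, hj⟩ := fun i j x hi hj => by
      have := congrFun (congrArg Subtype.val (congrFun hs (i, j))) ⟨x, hi, hj⟩
      exact sub_eq_zero.1 this
    choose i hi using hcov
    refine ⟨⟨fun x => (s (i x)).1 ⟨x.1, hi x⟩, ?_⟩, ?_⟩
    · refine continuous_iff_continuousAt.2 fun x => ?_
      have h1 := (s (i x)).2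
      have hop : IsOpen {y : (Finset.univ.sup U : Clopens A.base) | y.1 ∈ U (i x)} :=
        (U (i x)).isOpen.preimage continuous_subtype_val
      refine (hop.isOpenEmbedding_subtypeVal.continuousAt_iff (x := ⟨x, hi x⟩)).1 ?_
      have h2 : Continuous fun y : {y : (Finset.univ.sup U : Clopens A.base) | y.1 ∈ U (i x)} =>
          (⟨y.1.1, y.2⟩ : U (i x)) := by fun_prop
      refine ((h1.comp h2).continuousAt).congr (Filter.Eventually.of_forall fun y => ?_)
      exact congrArg (Tot.mk (E := A.fibre) y.1.1) (hag _ _ y.1.1 y.2 (hi y.1))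
    · refine funext fun j => Subtype.ext (funext fun x => ?_)
      exact hag _ _ x.1 _ x.2
  · rintro ⟨t, rfl⟩
    refine funext fun ij => Subtype.ext (funext fun x => ?_)
    exact sub_self _

/-- The restriction `f⁻¹(U) ∩ V → U` of `f`. -/
def clopenRestrict {X Y : Type u} [TopologicalSpace X] [TopologicalSpace Y] (f : C(Y, X))
    (U : Clopens X) (V : Clopens Y) : C((clopenPreimage f U ⊓ V : Clopens Y), U) where
  toFun y := ⟨f y.1, y.2.1⟩
  continuous_toFun := by fun_prop

/-- The map of sections `Φ_{U,V}(s)(y) = φ(s(f(y)), y)`, for `s` a section over `U` and `y` in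
`f⁻¹(U) ∩ V`. -/
def EtaleSp.Hom.sectionsMap {A B : EtaleSp.{u} R} (F : EtaleSp.Hom A B) (U : Clopens A.base)
    (V : Clopens B.base) : A.sectionsMod (clopenIncl U) ⟶
      B.sectionsMod (clopenIncl (clopenPreimage F.f U ⊓ V)) :=
  ⟨(F.sections (clopenIncl (clopenPreimage F.f U ⊓ V))).comp
    (A.sectionsComp (clopenIncl U) (clopenRestrict F.f U V))⟩

variable (R)

/-- The presheaf of sections, as a functor. -/
def EtaleSp.toPresh : EtaleSp.{u} R ⥤ Presh.{u} R where
  obj A := A.toPreshObj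
  map {A B} F := Presh.Hom.mk' (A := A.toPreshObj) (B := B.toPreshObj) (EtaleSp.Hom.f F)
    (EtaleSp.Hom.sectionsMap (A := A) F) (fun _ _ => rfl)
  map_id _ := Presh.Hom.ext_heq rfl fun _ _ => heq_of_eq rfl
  map_comp _ _ := Presh.Hom.ext_heq rfl fun _ _ => heq_of_eq <|
    DMod.Hom.ext <| LinearMap.ext fun _ => Subtype.ext <| funext fun _ => rfl

/-- The sheaf of sections of an étale space. -/
def EtaleSp.toShf : EtaleSp.{u} R ⥤ Shf.{u} R :=
  ObjectProperty.lift _ (EtaleSp.toPresh R) EtaleSp.isSheaf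

end Etale

section EtaleOfSheaf

variable {R : Type u} [Ring R] [TopologicalSpace R]

theorem clopens_mem_top {X : Type u} [TopologicalSpace X] (x : X) : x ∈ (⊤ : Clopens X) :=
  trivial

theorem clopens_mem_inf {X : Type u} [TopologicalSpace X] {x : X} {U V : Clopens X} (hU : x ∈ U)
    (hV : x ∈ V) : x ∈ U ⊓ V :=
  ⟨hU, hV⟩

theorem mem_preimage_inf_top {X Y : Type u} [TopologicalSpace X] [TopologicalSpace Y] {f : C(Y, X)}
    {y : Y} {U : Clopens X} (h : f y ∈ U) : y ∈ clopenPreimage f U ⊓ ⊤ :=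
  ⟨h, trivial⟩

/-- The clopen neighbourhoods of a point, ordered by reverse inclusion. -/
abbrev ClopenNhds {X : Type u} [TopologicalSpace X] (x : X) : Type u :=
  {U : Clopens X // x ∈ U}ᵒᵈ

instance {X : Type u} [TopologicalSpace X] (x : X) : Nonempty (ClopenNhds x) :=
  ⟨OrderDual.toDual ⟨⊤, trivial⟩⟩

instance {X : Type u} [TopologicalSpace X] (x : X) : IsDirectedOrder (ClopenNhds x) :=
  ⟨fun U V => ⟨OrderDual.toDual ⟨U.ofDual.1 ⊓ V.ofDual.1, U.ofDual.2, V.ofDual.2⟩,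
    fun _ h => h.1, fun _ h => h.2⟩⟩

/-- The modules `A(U)` for the clopen neighbourhoods `U` of `x`. -/
abbrev Presh.stalkObj (A : Presh.{u} R) (x : A.base) (U : ClopenNhds x) : Type u :=
  A.fn.obj (op U.ofDual.1)

/-- The restriction maps between the modules `A(U)` for clopen neighbourhoods `U` of `x`. -/
abbrev Presh.stalkMap (A : Presh.{u} R) (x : A.base) (U V : ClopenNhds x) (h : U ≤ V) :
    A.stalkObj x U →ₗ[Rᵐᵒᵖ] A.stalkObj x V :=
  (A.res (show V.ofDual.1 ≤ U.ofDual.1 from h)).lin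

instance (A : Presh.{u} R) (x : A.base) :
    DirectedSystem (A.stalkObj x) fun i j h => A.stalkMap x i j h where
  map_self U a := by
    change (A.res le_rfl).lin a = a
    rw [A.res_self]
    rfl
  map_map U V W hij hjk a := congrArg (fun f => f.lin a) (A.res_res (U := U.ofDual.1)
    (V := V.ofDual.1) (W := W.ofDual.1) hjk hij)

open Classical in
/-- The stalk of a presheaf at `x`: the direct limit of `A(U)` over clopen neighbourhoods `U`. -/
def Presh.stalk (A : Presh.{u} R) (x : A.base) : Type u :=
  Module.DirectLimit (A.stalkObj x) (A.stalkMap x)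

open Classical in
instance (A : Presh.{u} R) (x : A.base) : AddCommGroup (A.stalk x) :=
  inferInstanceAs (AddCommGroup (Module.DirectLimit (A.stalkObj x) (A.stalkMap x)))

open Classical in
instance (A : Presh.{u} R) (x : A.base) : Module Rᵐᵒᵖ (A.stalk x) :=
  inferInstanceAs (Module Rᵐᵒᵖ (Module.DirectLimit (A.stalkObj x) (A.stalkMap x)))

open Classical in
/-- The germ at `x` of a section over a clopen neighbourhood `U` of `x`. -/
def Presh.germ (A : Presh.{u} R) (U : Clopens A.base) (x : A.base) (hx : x ∈ U) :
    A.fn.obj (op U) →ₗ[Rᵐᵒᵖ] A.stalk x :=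
  Module.DirectLimit.of Rᵐᵒᵖ (ClopenNhds x) (A.stalkObj x) (A.stalkMap x)
    (OrderDual.toDual ⟨U, hx⟩)

theorem Presh.germ_res (A : Presh.{u} R) {U V : Clopens A.base} (h : U ≤ V) (x : A.base)
    (hx : x ∈ U) (s : A.fn.obj (op V)) :
    A.germ U x hx ((A.res h).lin s) = A.germ V x (h hx) s := by
  classical
  exact Module.DirectLimit.of_f (G := A.stalkObj x) (f := A.stalkMap x)
    (i := OrderDual.toDual ⟨V, h hx⟩) (j := OrderDual.toDual ⟨U, hx⟩) (hij := h)

theorem Presh.exists_germ (A : Presh.{u} R) (x : A.base) (a : A.stalk x) :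
    ∃ (U : Clopens A.base) (hx : x ∈ U) (s : A.fn.obj (op U)), A.germ U x hx s = a := by
  classical
  obtain ⟨U, s, hs⟩ := Module.DirectLimit.exists_of (G := A.stalkObj x) (f := A.stalkMap x) a
  exact ⟨U.ofDual.1, U.ofDual.2, s, hs⟩

theorem Presh.germ_eq (A : Presh.{u} R) {U V : Clopens A.base} {x : A.base} (hU : x ∈ U)
    (hV : x ∈ V) (s : A.fn.obj (op U)) (t : A.fn.obj (op V))
    (h : A.germ U x hU s = A.germ V x hV t) :
    ∃ (W : Clopens A.base) (h1 : W ≤ U) (h2 : W ≤ V), x ∈ W ∧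
      (A.res h1).lin s = (A.res h2).lin t := by
  classical
  rw [← A.germ_res (inf_le_left : U ⊓ V ≤ U) x (clopens_mem_inf hU hV) s,
    ← A.germ_res (inf_le_right : U ⊓ V ≤ V) x (clopens_mem_inf hU hV) t] at h
  obtain ⟨W, hW, hst⟩ := Module.DirectLimit.exists_eq_of_of_eq (G := A.stalkObj x)
    (f := A.stalkMap x) h
  have hW' : W.ofDual.1 ≤ U ⊓ V := hW
  refine ⟨W.ofDual.1, hW'.trans inf_le_left, hW'.trans inf_le_right, W.ofDual.2, ?_⟩
  have e1 := congrArg (fun f => f.lin s) (A.res_res hW' (inf_le_left : U ⊓ V ≤ U))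
  have e2 := congrArg (fun f => f.lin t) (A.res_res hW' (inf_le_right : U ⊓ V ≤ V))
  exact e1.symm.trans (Eq.trans hst e2)

open Classical in
/-- Linear maps out of a stalk. -/
def Presh.stalkLift (A : Presh.{u} R) (x : A.base) {P : Type u} [AddCommGroup P] [Module Rᵐᵒᵖ P]
    (g : ∀ U : Clopens A.base, x ∈ U → A.fn.obj (op U) →ₗ[Rᵐᵒᵖ] P)
    (hg : ∀ (U V : Clopens A.base) (h : U ≤ V) (hx : x ∈ U) (s : A.fn.obj (op V)),
      g U hx ((A.res h).lin s) = g V (h hx) s) : A.stalk x →ₗ[Rᵐᵒᵖ] P :=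
  Module.DirectLimit.lift Rᵐᵒᵖ (ClopenNhds x) (A.stalkObj x) (A.stalkMap x)
    (fun U => g U.ofDual.1 U.ofDual.2)
    (fun U V h s => hg V.ofDual.1 U.ofDual.1 h V.ofDual.2 s)

theorem Presh.stalkLift_germ (A : Presh.{u} R) (x : A.base) {P : Type u} [AddCommGroup P]
    [Module Rᵐᵒᵖ P] (g : ∀ U : Clopens A.base, x ∈ U → A.fn.obj (op U) →ₗ[Rᵐᵒᵖ] P)
    (hg : ∀ (U V : Clopens A.base) (h : U ≤ V) (hx : x ∈ U) (s : A.fn.obj (op V)),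
      g U hx ((A.res h).lin s) = g V (h hx) s) (U : Clopens A.base) (hx : x ∈ U)
    (s : A.fn.obj (op U)) : A.stalkLift x g hg (A.germ U x hx s) = g U hx s := by
  classical
  exact Module.DirectLimit.lift_of (G := A.stalkObj x) (f := A.stalkMap x)
    (fun U => g U.ofDual.1 U.ofDual.2)
    (fun U V h s => hg V.ofDual.1 U.ofDual.1 h V.ofDual.2 s)
    (i := OrderDual.toDual (⟨U, hx⟩ : {U : Clopens A.base // x ∈ U})) s

/-- The set `O_s` of germs of a section `s` over `U`. -/
def Presh.germSet (A : Presh.{u} R) (U : Clopens A.base) (s : A.fn.obj (op U)) :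
    Set (Tot A.stalk) :=
  {a | ∃ h : a.pt ∈ U, A.germ U a.pt h s = a.val}

/-- The topology on the disjoint union of the stalks generated by the sets `O_s`. -/
instance Presh.germTopology (A : Presh.{u} R) : TopologicalSpace (Tot A.stalk) :=
  TopologicalSpace.generateFrom {O | ∃ U s, A.germSet U s = O}

theorem Presh.isOpen_germSet (A : Presh.{u} R) (U : Clopens A.base) (s : A.fn.obj (op U)) :
    IsOpen (A.germSet U s) :=
  TopologicalSpace.isOpen_generateFrom_of_mem ⟨U, s, rfl⟩

theorem Presh.germSet_res (A : Presh.{u} R) {U V : Clopens A.base} (h : U ≤ V)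
    (s : A.fn.obj (op V)) : A.germSet U ((A.res h).lin s) ⊆ A.germSet V s := by
  rintro a ⟨ha, hs⟩
  exact ⟨h ha, by rw [← hs, A.germ_res]⟩

/-- A germ lying in `O_t` has a representative which restricts to `t`. -/
theorem Presh.exists_res_of_mem (A : Presh.{u} R) {U V : Clopens A.base} {x : A.base} (hx : x ∈ U)
    {s : A.fn.obj (op U)} {t : A.fn.obj (op V)}
    (h : (⟨x, A.germ U x hx s⟩ : Tot A.stalk) ∈ A.germSet V t) :
    ∃ (W : Clopens A.base) (h1 : W ≤ U), x ∈ W ∧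
      A.germSet W ((A.res h1).lin s) ⊆ A.germSet V t := by
  obtain ⟨hV, h⟩ := h
  obtain ⟨W, h1, h2, hxW, hst⟩ := A.germ_eq hV hx t s h
  exact ⟨W, h2, hxW, by rw [← hst]; exact A.germSet_res h1 t⟩

theorem Presh.mk_mem_germSet (A : Presh.{u} R) (U : Clopens A.base) (x : A.base) (hx : x ∈ U)
    (s : A.fn.obj (op U)) : (⟨x, A.germ U x hx s⟩ : Tot A.stalk) ∈ A.germSet U s :=
  ⟨hx, rfl⟩

theorem Presh.isTopologicalBasis_germSet (A : Presh.{u} R) :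
    IsTopologicalBasis {O | ∃ U s, A.germSet U s = O} where
  exists_subset_inter := by
    rintro _ ⟨U, s, rfl⟩ _ ⟨V, t, rfl⟩ ⟨x, a⟩ ⟨⟨hU, hs⟩, hV⟩
    have hU : x ∈ U := hU
    have hs : A.germ U x hU s = a := hs
    subst hs
    obtain ⟨W, h1, hx, hW⟩ := A.exists_res_of_mem hU hV
    refine ⟨_, ⟨W, _, rfl⟩, ?_, Set.subset_inter (A.germSet_res h1 s) hW⟩
    exact ⟨hx, A.germ_res h1 x hx s⟩
  sUnion_eq := by
    refine Set.eq_univ_of_forall fun ⟨x, a⟩ => ?_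
    obtain ⟨U, hx, s, rfl⟩ := A.exists_germ x a
    exact ⟨_, ⟨U, s, rfl⟩, A.mk_mem_germSet U x hx s⟩
  eq_generateFrom := rfl

theorem Presh.continuous_pt (A : Presh.{u} R) : Continuous (Tot.pt : Tot A.stalk → A.base) := by
  refine (isTopologicalBasis_isClopen (X := A.base)).continuous_iff.2 fun U hU => ?_
  rw [isOpen_iff_mem_nhds]
  rintro ⟨x, a⟩ hx
  obtain ⟨V, hxV, s, rfl⟩ := A.exists_germ x a
  have hle : V ⊓ ⟨U, hU⟩ ≤ V := inf_le_left
  refine Filter.mem_of_superset ((A.isOpen_germSet _ ((A.res hle).lin s)).mem_nhds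
    ⟨⟨hxV, hx⟩, A.germ_res hle x ⟨hxV, hx⟩ s⟩) ?_
  rintro b ⟨hb, -⟩
  exact hb.2

theorem Presh.isOpenMap_pt (A : Presh.{u} R) : IsOpenMap (Tot.pt : Tot A.stalk → A.base) := by
  refine A.isTopologicalBasis_germSet.isOpenMap_iff.2 ?_
  rintro _ ⟨U, s, rfl⟩
  convert U.isOpen using 1
  ext x
  constructor
  · rintro ⟨a, ⟨ha, -⟩, rfl⟩
    exact ha
  · intro hx
    exact ⟨_, A.mk_mem_germSet U x hx s, rfl⟩

theorem Presh.isLocalHomeomorph_pt (A : Presh.{u} R) :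
    IsLocalHomeomorph (Tot.pt : Tot A.stalk → A.base) := by
  rw [isLocalHomeomorph_iff_isOpenEmbedding_restrict]
  rintro ⟨x, a⟩
  obtain ⟨U, hx, s, rfl⟩ := A.exists_germ x a
  refine ⟨A.germSet U s, (A.isOpen_germSet U s).mem_nhds (A.mk_mem_germSet U x hx s), ?_⟩
  refine .of_continuous_injective_isOpenMap (A.continuous_pt.comp continuous_subtype_val) ?_
    (A.isOpenMap_pt.comp (A.isOpen_germSet U s).isOpenMap_subtype_val)
  rintro ⟨⟨y, b⟩, hy, hb⟩ ⟨⟨z, c⟩, hz, hc⟩ h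
  change y = z at h
  subst h
  have hbc : b = c := hb.symm.trans hc
  subst hbc
  rfl

theorem Presh.continuous_stalk_add (A : Presh.{u} R) :
    Continuous fun q : FibProd A.stalk => (⟨q.pt, q.fst + q.snd⟩ : Tot A.stalk) := by
  refine continuous_generateFrom_iff.2 ?_
  rintro _ ⟨V, t, rfl⟩
  rw [isOpen_iff_mem_nhds]
  rintro ⟨x, a, b⟩ hq
  obtain ⟨U, hU, r, rfl⟩ := A.exists_germ x a
  obtain ⟨U', hU', s, rfl⟩ := A.exists_germ x b
  have hq' : (⟨x, A.germ (U ⊓ U') x (clopens_mem_inf hU hU') ((A.res inf_le_left).lin r +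
      (A.res inf_le_right).lin s)⟩ : Tot A.stalk) ∈ A.germSet V t := by
    rw [map_add, A.germ_res, A.germ_res]
    exact hq
  obtain ⟨W, h1, hx, hW⟩ := A.exists_res_of_mem (clopens_mem_inf hU hU') hq'
  have hc : Continuous fun q : FibProd A.stalk =>
      ((⟨q.pt, q.fst⟩, ⟨q.pt, q.snd⟩) : Tot A.stalk × Tot A.stalk) := continuous_induced_dom
  have hopen := ((A.isOpen_germSet W ((A.res h1).lin ((A.res inf_le_left).lin r))).prod
    (A.isOpen_germSet W ((A.res h1).lin ((A.res inf_le_right).lin s)))).preimage hc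
  refine Filter.mem_of_superset (hopen.mem_nhds ⟨⟨hx, ?_⟩, hx, ?_⟩) ?_
  · rw [A.germ_res, A.germ_res]
  · rw [A.germ_res, A.germ_res]
  · rintro q ⟨⟨hq1, hq2⟩, ⟨_, hq3⟩⟩
    refine hW ⟨hq1, ?_⟩
    change _ = q.fst + q.snd
    change _ = q.fst at hq2
    change _ = q.snd at hq3
    rw [← hq2, ← hq3, ← map_add, ← map_add]

variable [IsTopologicalRing R]

theorem Presh.continuous_stalk_smul (A : Presh.{u} R) :
    Continuous fun q : Tot A.stalk × R =>
      (⟨q.1.pt, MulOpposite.op q.2 • q.1.val⟩ : Tot A.stalk) := by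
  refine continuous_generateFrom_iff.2 ?_
  rintro _ ⟨V, t, rfl⟩
  rw [isOpen_iff_mem_nhds]
  rintro ⟨⟨x, a⟩, r⟩ hq
  obtain ⟨U, hU, s, rfl⟩ := A.exists_germ x a
  have hq' : (⟨x, A.germ U x hU (MulOpposite.op r • s)⟩ : Tot A.stalk) ∈ A.germSet V t := by
    rw [map_smul]
    exact hq
  obtain ⟨W, h1, hx, hW⟩ := A.exists_res_of_mem hU hq'
  have hc : Continuous fun r' : R => MulOpposite.op r' • s :=
    MulOpposite.continuous_op.smul continuous_const
  have hopen := (A.isOpen_germSet W ((A.res h1).lin s)).prod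
    ((isOpen_discrete {MulOpposite.op r • s}).preimage hc)
  refine Filter.mem_of_superset (hopen.mem_nhds ⟨⟨hx, A.germ_res h1 x hx s⟩, rfl⟩) ?_
  rintro ⟨b, r'⟩ ⟨⟨hb1, hb2⟩, hr⟩
  refine hW ⟨hb1, ?_⟩
  change _ = b.val at hb2
  change MulOpposite.op r' • s = MulOpposite.op r • s at hr
  change _ = MulOpposite.op r' • b.val
  rw [← hb2, A.germ_res, A.germ_res, ← hr, map_smul]

/-- The étale space of a presheaf: the disjoint union of its stalks. -/
def Presh.toEtaleObj (A : Presh.{u} R) : EtaleSp.{u} R where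
  base := A.base
  fibre := A.stalk
  isLocalHomeomorph := A.isLocalHomeomorph_pt
  continuous_zero := by
    refine continuous_generateFrom_iff.2 ?_
    rintro _ ⟨V, t, rfl⟩
    rw [isOpen_iff_mem_nhds]
    intro x hx
    have hx' : (⟨x, A.germ ⊤ x (clopens_mem_top x) 0⟩ : Tot A.stalk) ∈ A.germSet V t := by
      rw [map_zero]
      exact hx
    obtain ⟨W, h1, hxW, hW⟩ := A.exists_res_of_mem (clopens_mem_top x) hx'
    refine Filter.mem_of_superset (W.isOpen.mem_nhds hxW) fun y hy => hW ⟨hy, ?_⟩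
    rw [map_zero, map_zero]
  continuous_add := A.continuous_stalk_add
  continuous_smul := A.continuous_stalk_smul

/-- The map of stalks `A_{f(y)} → B_y` induced by a morphism of presheaves, sending the germ of `s`
in `A(U)` to the germ of its image in `B(f⁻¹(U))`. -/
def Presh.Hom.stalk {A B : Presh.{u} R} (F : Presh.Hom A B) (y : B.base) :
    A.stalk (F.f y) →ₗ[Rᵐᵒᵖ] B.stalk y :=
  A.stalkLift (F.f y)
    (fun U hU => (B.germ (clopenPreimage F.f U ⊓ ⊤) y (mem_preimage_inf_top hU)).comp (F.app U ⊤).lin)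
    (fun U V h hx s => by
      have := congrArg (fun g => g.lin s) (F.naturality h (le_refl ⊤))
      change (F.app U ⊤).lin ((A.res h).lin s) = (B.res _).lin ((F.app V ⊤).lin s) at this
      exact (congrArg _ this).trans (B.germ_res _ y (mem_preimage_inf_top hx) _))

theorem Presh.Hom.stalk_germ {A B : Presh.{u} R} (F : Presh.Hom A B) (y : B.base)
    (U : Clopens A.base) (hU : F.f y ∈ U) (s : A.fn.obj (op U)) :
    F.stalk y (A.germ U (F.f y) hU s) =
      B.germ (clopenPreimage F.f U ⊓ ⊤) y (mem_preimage_inf_top hU) ((F.app U ⊤).lin s) :=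
  A.stalkLift_germ _ _ _ U hU s

/-- The morphism of étale spaces induced by a morphism of presheaves. -/
def Presh.Hom.toEtale {A B : Presh.{u} R} (F : Presh.Hom A B) :
    EtaleSp.Hom A.toEtaleObj B.toEtaleObj where
  f := F.f
  φ := F.stalk
  continuous_φ := by
    refine continuous_generateFrom_iff.2 ?_
    rintro _ ⟨V, t, rfl⟩
    rw [isOpen_iff_mem_nhds]
    rintro ⟨(y : B.base), a⟩ hq
    obtain ⟨U, hU, s, rfl⟩ := A.exists_germ (F.f y) a
    have hq : (⟨y, B.germ (clopenPreimage F.f U ⊓ ⊤) y (mem_preimage_inf_top hU)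
        ((F.app U ⊤).lin s)⟩ : Tot B.stalk) ∈ B.germSet V t := by
      rw [← F.stalk_germ]
      exact hq
    obtain ⟨W, h1, hx, hW⟩ := B.exists_res_of_mem _ hq
    have hopen := ((A.isOpen_germSet U s).preimage (continuous_pull_val A.stalk F.f)).inter
      (W.isOpen.preimage (continuous_pull_pt A.stalk F.f))
    refine Filter.mem_of_superset (hopen.mem_nhds ⟨⟨hU, rfl⟩, hx⟩) ?_
    rintro ⟨(z : B.base), b⟩ ⟨⟨hb1, hb2⟩, hz⟩
    refine hW ⟨hz, ?_⟩
    change A.germ U (F.f z) hb1 s = b at hb2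
    change _ = F.stalk z b
    exact ((B.germ_res h1 z hz _).trans (F.stalk_germ z U hb1 s).symm).trans
      (congrArg (F.stalk z) hb2)

theorem Presh.stalk_ext (A : Presh.{u} R) {x : A.base} {P : Type u} [AddCommGroup P]
    [Module Rᵐᵒᵖ P] {g h : A.stalk x →ₗ[Rᵐᵒᵖ] P}
    (e : ∀ (U : Clopens A.base) (hx : x ∈ U) (s : A.fn.obj (op U)),
      g (A.germ U x hx s) = h (A.germ U x hx s)) : g = h := by
  refine LinearMap.ext fun a => ?_
  obtain ⟨U, hx, s, rfl⟩ := A.exists_germ x a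
  exact e U hx s

variable (R)

/-- The étale space of a presheaf, as a functor. -/
def Presh.toEtale : Presh.{u} R ⥤ EtaleSp.{u} R where
  obj A := A.toEtaleObj
  map F := Presh.Hom.toEtale F
  map_id A := by
    refine EtaleSp.Hom.ext rfl (heq_of_eq (funext fun x => A.stalk_ext fun U hx s => ?_))
    exact (Presh.Hom.stalk_germ (𝟙 A) x U hx s).trans (A.germ_res (id_meet_le U ⊤) x _ s)
  map_comp {A B C} F G := by
    refine EtaleSp.Hom.ext rfl (heq_of_eq (funext fun x => A.stalk_ext fun U hx s => ?_))
    refine (Presh.Hom.stalk_germ (F ≫ G) x U hx s).trans ?_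
    refine (C.germ_res (comp_meet_le (Presh.Hom.f F) (Presh.Hom.f G) U ⊤) x _ _).trans ?_
    refine (Presh.Hom.stalk_germ G x _ (mem_preimage_inf_top (f := Presh.Hom.f F) hx) _).symm.trans ?_
    exact congrArg (Presh.Hom.stalk G x) (Presh.Hom.stalk_germ F _ U hx s).symm

/-- The étale space of a sheaf. -/
def Shf.toEtale : Shf.{u} R ⥤ EtaleSp.{u} R :=
  ObjectProperty.ι _ ⋙ Presh.toEtale R

end EtaleOfSheaf

/-! ### Families of profinite modules and profinite direct sums -/

section ProfiniteSheaves

variable (R : Type u) [Ring R] [TopologicalSpace R]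

/-- A continuously indexed family of profinite left `R`-modules over a profinite space `X`,
presented as the disjoint union `⨆ₓ Mₓ` of its fibres, with a profinite topology on this disjoint
union. The fibres carry the subspace topology. The projection to `X` is automatically surjective,
as every fibre contains `0`. -/
structure PShf where
  base : Profinite.{u}
  fibre : base → Type u
  [addCommGroup : ∀ x, AddCommGroup (fibre x)]
  [module : ∀ x, Module R (fibre x)]
  [topTot : TopologicalSpace (Tot fibre)]
  [compactSpace : CompactSpace (Tot fibre)]
  [t2Space : T2Space (Tot fibre)]
  [totallyDisconnectedSpace : TotallyDisconnectedSpace (Tot fibre)]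
  continuous_pt : Continuous (Tot.pt : Tot fibre → base)
  continuous_smul : Continuous fun q : R × Tot fibre => (⟨q.2.pt, q.1 • q.2.val⟩ : Tot fibre)
  continuous_add : Continuous fun q : FibProd fibre => (⟨q.pt, q.fst + q.snd⟩ : Tot fibre)

attribute [instance] PShf.addCommGroup PShf.module PShf.topTot PShf.compactSpace PShf.t2Space
  PShf.totallyDisconnectedSpace

variable {R}

/-- A morphism `(𝒩, Y) ⟶ (ℳ, X)`: continuous maps `f : Y → X` and `ψ : 𝒩 → ℳ` such that `ψ`
restricts to linear maps `N_y → M_{f(y)}`. -/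
@[ext]
structure PShf.Hom (N M : PShf.{u} R) where
  f : C(N.base, M.base)
  ψ : ∀ y, N.fibre y →ₗ[R] M.fibre (f y)
  continuous_ψ : Continuous fun q : Tot N.fibre => (⟨f q.pt, ψ q.pt q.val⟩ : Tot M.fibre)

instance : Category (PShf.{u} R) where
  Hom := PShf.Hom
  id M :=
    { f := ContinuousMap.id _
      ψ := fun _ => LinearMap.id
      continuous_ψ := continuous_id }
  comp {N M L} F G :=
    { f := G.f.comp F.f
      ψ := fun y => (G.ψ (F.f y)).comp (F.ψ y)
      continuous_ψ := G.continuous_ψ.comp F.continuous_ψ }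

/-- A morphism from a family `ℳ` to a profinite module `P` (regarded as a family over a point): a
continuous map `ℳ → P` which is linear on the fibres. -/
@[ext]
structure PShf.HomTo (M : PShf.{u} R) (P : PMod.{u} R) where
  map : ∀ x, M.fibre x →ₗ[R] P
  continuous_map : Continuous fun q : Tot M.fibre => map q.pt q.val

/-- The universal property of the profinite direct sum. -/
def PShf.IsProfiniteDirectSum (M : PShf.{u} R) (S : PMod.{u} R) (ω : M.HomTo S) : Prop :=
  ∀ (P : PMod.{u} R) (β : M.HomTo P), ∃! g : S ⟶ P, ∀ x m, g.lin (ω.map x m) = β.map x m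

/-! #### Existence of profinite direct sums -/

open Classical in
/-- The abstract direct sum of the fibres. -/
abbrev PShf.AbsSum (M : PShf.{u} R) : Type u := DirectSum M.base M.fibre

open Classical in
/-- The inclusion of a fibre in the abstract direct sum. -/
abbrev PShf.incl (M : PShf.{u} R) (x : M.base) : M.fibre x →ₗ[R] M.AbsSum :=
  DirectSum.lof R M.base M.fibre x

/-- The submodules of the abstract direct sum with finite quotients to which the family maps
continuously. -/
structure PShf.Admissible (M : PShf.{u} R) (K : Submodule R M.AbsSum) : Prop where
  finite : Finite (M.AbsSum ⧸ K)
  isOpen_smul : ∀ v, IsOpen {r : R | r • v ∈ K}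
  isOpen_incl : ∀ v, IsOpen {q : Tot M.fibre | M.incl q.pt q.val - v ∈ K}

/-- A finite quotient of the abstract direct sum, as a discrete module. -/
def PShf.Quo (M : PShf.{u} R) (K : {K // M.Admissible K}) : Type u := M.AbsSum ⧸ K.1

instance (M : PShf.{u} R) (K : {K // M.Admissible K}) : AddCommGroup (M.Quo K) :=
  inferInstanceAs (AddCommGroup (M.AbsSum ⧸ K.1))

instance (M : PShf.{u} R) (K : {K // M.Admissible K}) : Module R (M.Quo K) :=
  inferInstanceAs (Module R (M.AbsSum ⧸ K.1))

instance (M : PShf.{u} R) (K : {K // M.Admissible K}) : TopologicalSpace (M.Quo K) := ⊥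

instance (M : PShf.{u} R) (K : {K // M.Admissible K}) : DiscreteTopology (M.Quo K) := ⟨rfl⟩

instance (M : PShf.{u} R) (K : {K // M.Admissible K}) : Finite (M.Quo K) := K.2.finite

/-- The quotient map. -/
def PShf.quo (M : PShf.{u} R) (K : {K // M.Admissible K}) : M.AbsSum →ₗ[R] M.Quo K := K.1.mkQ

theorem PShf.quo_eq_zero (M : PShf.{u} R) (K : {K // M.Admissible K}) (v : M.AbsSum) :
    M.quo K v = 0 ↔ v ∈ K.1 :=
  Submodule.Quotient.mk_eq_zero K.1

theorem PShf.quo_surjective (M : PShf.{u} R) (K : {K // M.Admissible K}) :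
    Function.Surjective (M.quo K) :=
  K.1.mkQ_surjective

/-- If all annihilators are open then `R` acts continuously on a discrete left module. -/
theorem continuousSMul_left_of_isOpen_annihilator [IsTopologicalRing R] {A : Type u}
    [AddCommGroup A] [Module R A] [TopologicalSpace A] [DiscreteTopology A]
    (h : ∀ a : A, IsOpen {r : R | r • a = 0}) : ContinuousSMul R A := by
  refine ⟨continuous_iff_continuousAt.2 fun q => ?_⟩
  obtain ⟨r, a⟩ := q
  have h1 : {q : R × A | (q.1 - r) • a = 0 ∧ q.2 = a} ∈ nhds (r, a) := by
    refine Filter.inter_mem ?_ ?_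
    · have hc : Continuous fun q : R × A => q.1 - r := continuous_fst.sub continuous_const
      exact ((h a).preimage hc).mem_nhds (by simp)
    · exact (((isOpen_discrete {a}).preimage continuous_snd)).mem_nhds rfl
  rw [ContinuousAt, nhds_discrete A]
  refine tendsto_nhds_of_eventually_eq ?_ |>.mono_right (by rw [nhds_discrete A])
  filter_upwards [h1] with q hq
  obtain ⟨h2, rfl⟩ := hq
  simpa [sub_smul, sub_eq_zero] using h2

instance [IsTopologicalRing R] (M : PShf.{u} R) (K : {K // M.Admissible K}) :
    ContinuousSMul R (M.Quo K) :=
  continuousSMul_left_of_isOpen_annihilator fun a => by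
    obtain ⟨v, rfl⟩ := M.quo_surjective K a
    simp_rw [← map_smul, M.quo_eq_zero]
    exact K.2.isOpen_smul v

/-- The map from the abstract direct sum to the product of its finite quotients. -/
def PShf.diag (M : PShf.{u} R) : M.AbsSum →ₗ[R] (∀ K, M.Quo K) :=
  LinearMap.pi M.quo

variable [IsTopologicalRing R]

/-- The completion of the abstract direct sum, as the closure of its image in the product of its
finite quotients. -/
def PShf.completion (M : PShf.{u} R) : Submodule R (∀ K, M.Quo K) :=
  (LinearMap.range M.diag).topologicalClosure

instance (M : PShf.{u} R) : CompactSpace M.completion :=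
  isCompact_iff_compactSpace.1
    (Submodule.isClosed_topologicalClosure (LinearMap.range M.diag)).isCompact

/-- The completion as a profinite module. -/
def PShf.completionMod (M : PShf.{u} R) : PMod.{u} R where
  carrier := M.completion

/-- The map from the abstract direct sum to its completion. -/
def PShf.toCompletion (M : PShf.{u} R) : M.AbsSum →ₗ[R] M.completion :=
  M.diag.codRestrict _ fun v => Submodule.le_topologicalClosure _ ⟨v, rfl⟩

/-- The canonical morphism to the completion. -/
def PShf.completionHom (M : PShf.{u} R) : M.HomTo M.completionMod where
  map x := M.toCompletion.comp (M.incl x)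
  continuous_map := by
    refine Continuous.subtype_mk (continuous_pi fun K => ?_) _
    refine continuous_discrete_rng.2 fun b => ?_
    obtain ⟨v, rfl⟩ := M.quo_surjective K b
    convert K.2.isOpen_incl v using 1
    ext q
    change M.quo K (M.incl q.pt q.val) = M.quo K v ↔ _ ∈ K.1
    rw [← M.quo_eq_zero K, map_sub, sub_eq_zero]

open Classical in
/-- The linear map from the abstract direct sum induced by a morphism. -/
def PShf.HomTo.linear {M : PShf.{u} R} {P : PMod.{u} R} (β : M.HomTo P) : M.AbsSum →ₗ[R] P :=
  DirectSum.toModule R M.base P β.map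

theorem PShf.HomTo.linear_incl {M : PShf.{u} R} {P : PMod.{u} R} (β : M.HomTo P) (x : M.base)
    (m : M.fibre x) : β.linear (M.incl x m) = β.map x m := by
  classical
  exact DirectSum.toModule_lof R x m

theorem PShf.admissible_comap {M : PShf.{u} R} {P : PMod.{u} R} (β : M.HomTo P)
    (L : Submodule R P) (hL : IsOpen (L : Set P)) : M.Admissible (L.comap β.linear) where
  finite := by
    have : Finite (P ⧸ L) := L.toAddSubgroup.quotient_finite_of_isOpen hL
    exact Finite.of_injective (Submodule.mapQ _ L β.linear le_rfl) <|
      LinearMap.ker_eq_bot.1 (by rw [Submodule.ker_mapQ]; simp)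
  isOpen_smul v := by
    have hc : Continuous fun r : R => r • β.linear v := continuous_id.smul continuous_const
    convert hL.preimage hc using 1
    ext r
    change β.linear (r • v) ∈ L ↔ _
    rw [map_smul]
    rfl
  isOpen_incl v := by
    have hc : Continuous fun q : Tot M.fibre => β.map q.pt q.val - β.linear v :=
      β.continuous_map.sub continuous_const
    convert hL.preimage hc using 1
    ext q
    change β.linear (M.incl q.pt q.val - v) ∈ L ↔ _
    rw [map_sub, β.linear_incl]
    rfl

variable [CompactSpace R]

/-- The closure of the graph of `AbsSum ℳ → P`. -/
def PShf.HomTo.graph {M : PShf.{u} R} {P : PMod.{u} R} (β : M.HomTo P) :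
    Submodule R ((∀ K, M.Quo K) × P) :=
  (LinearMap.range (M.diag.prod β.linear)).topologicalClosure

theorem PShf.HomTo.graph_unique {M : PShf.{u} R} {P : PMod.{u} R} (β : M.HomTo P) {p : P}
    (hp : ((0 : ∀ K, M.Quo K), p) ∈ β.graph) : p = 0 := by
  by_contra hne
  obtain ⟨L, hL, hLV⟩ := P.exists_openSubmodule (V := {p}ᶜ) isOpen_compl_singleton
    (fun h => hne (Set.mem_singleton_iff.1 h).symm)
  let K : {K // M.Admissible K} := ⟨_, PShf.admissible_comap β L hL⟩
  have hcl : IsClosed {z : (∀ K, M.Quo K) × P | z.1 K = 0 → z.2 ∈ L} := by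
    have h1 : IsClosed {z : (∀ K, M.Quo K) × P | z.2 ∈ L} :=
      (L.toAddSubgroup.isClosed_of_isOpen hL).preimage continuous_snd
    have h2 : IsClosed {z : (∀ K, M.Quo K) × P | ¬ z.1 K = 0} :=
      (isClosed_discrete ({0}ᶜ : Set (M.Quo K))).preimage
        ((continuous_apply K).comp continuous_fst)
    convert h2.union h1 using 1
    ext z
    exact imp_iff_not_or
  have hsub : (β.graph : Set ((∀ K, M.Quo K) × P)) ⊆ {z | z.1 K = 0 → z.2 ∈ L} := by
    refine closure_minimal ?_ hcl
    rintro _ ⟨v, rfl⟩ hv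
    exact (M.quo_eq_zero K v).1 hv
  exact hLV (hsub hp rfl) rfl

theorem PShf.HomTo.exists_graph {M : PShf.{u} R} {P : PMod.{u} R} (β : M.HomTo P)
    (s : ∀ K, M.Quo K) : s ∈ M.completion ↔ ∃ p : P, (s, p) ∈ β.graph := by
  have hcomp : IsCompact (β.graph : Set ((∀ K, M.Quo K) × P)) :=
    (Submodule.isClosed_topologicalClosure _).isCompact
  constructor
  · intro hs
    have : (M.completion : Set (∀ K, M.Quo K)) ⊆ Prod.fst '' (β.graph : Set ((∀ K, M.Quo K) × P)) := by
      refine closure_minimal ?_ (hcomp.image continuous_fst).isClosed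
      rintro _ ⟨v, rfl⟩
      exact ⟨_, Submodule.le_topologicalClosure _ ⟨v, rfl⟩, rfl⟩
    obtain ⟨⟨_, p⟩, hp, rfl⟩ := this hs
    exact ⟨p, hp⟩
  · rintro ⟨p, hp⟩
    have : (β.graph : Set ((∀ K, M.Quo K) × P)) ⊆ Prod.fst ⁻¹' (M.completion : Set _) := by
      refine closure_minimal ?_
        ((Submodule.isClosed_topologicalClosure _).preimage continuous_fst)
      rintro _ ⟨v, rfl⟩
      exact Submodule.le_topologicalClosure _ ⟨v, rfl⟩
    exact this hp

/-- The projection of the graph to the completion is bijective. -/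
def PShf.HomTo.graphEquiv {M : PShf.{u} R} {P : PMod.{u} R} (β : M.HomTo P) :
    β.graph ≃ₗ[R] M.completion :=
  LinearEquiv.ofBijective
    (((LinearMap.fst R (∀ K, M.Quo K) P).comp β.graph.subtype).codRestrict M.completion
      fun z => (β.exists_graph _).2 ⟨z.1.2, z.2⟩) <| by
    constructor
    · refine (injective_iff_map_eq_zero _).2 ?_
      rintro ⟨⟨s, p⟩, hz⟩ h
      obtain rfl : s = 0 := congrArg Subtype.val h
      obtain rfl := β.graph_unique hz
      rfl
    · rintro ⟨s, hs⟩
      obtain ⟨p, hp⟩ := (β.exists_graph s).1 hs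
      exact ⟨⟨(s, p), hp⟩, rfl⟩

theorem PShf.HomTo.continuous_graphEquiv_symm {M : PShf.{u} R} {P : PMod.{u} R} (β : M.HomTo P) :
    Continuous β.graphEquiv.symm := by
  have : CompactSpace β.graph :=
    isCompact_iff_compactSpace.1 (Submodule.isClosed_topologicalClosure _).isCompact
  have hc : Continuous β.graphEquiv :=
    (continuous_fst.comp continuous_subtype_val).subtype_mk _
  exact hc.continuous_symm_of_equiv_compact_to_t2 (f := β.graphEquiv.toEquiv)

/-- The extension of a morphism to the completion. -/
def PShf.HomTo.completionLift {M : PShf.{u} R} {P : PMod.{u} R} (β : M.HomTo P) :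
    M.completionMod ⟶ P :=
  ⟨⟨((LinearMap.snd R (∀ K, M.Quo K) P).comp β.graph.subtype).comp β.graphEquiv.symm.toLinearMap,
    continuous_snd.comp (continuous_subtype_val.comp β.continuous_graphEquiv_symm)⟩⟩

theorem PShf.completion_ext {M : PShf.{u} R} {P : PMod.{u} R} {g h : M.completionMod ⟶ P}
    (e : ∀ x m, g.lin (M.completionHom.map x m) = h.lin (M.completionHom.map x m)) : g = h := by
  classical
  have hlin : (g.lin : M.completionMod →ₗ[R] P).comp M.toCompletion =
      (h.lin : M.completionMod →ₗ[R] P).comp M.toCompletion :=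
    DirectSum.linearMap_ext R fun x => LinearMap.ext fun m => e x m
  have hd : DenseRange M.toCompletion := by
    rintro ⟨s, hs⟩
    refine closure_subtype.2 ?_
    refine closure_mono ?_ hs
    rintro _ ⟨v, rfl⟩
    exact ⟨_, ⟨v, rfl⟩, rfl⟩
  refine PMod.Hom.ext (ContinuousLinearMap.ext fun s => congrFun
    (hd.equalizer g.lin.continuous h.lin.continuous ?_) s)
  exact funext fun v => LinearMap.congr_fun hlin v

theorem PShf.HomTo.completionLift_apply {M : PShf.{u} R} {P : PMod.{u} R} (β : M.HomTo P)
    (x : M.base) (m : M.fibre x) :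
    β.completionLift.lin (M.completionHom.map x m) = β.map x m := by
  have : β.graphEquiv.symm (M.toCompletion (M.incl x m)) =
      ⟨(M.diag (M.incl x m), β.linear (M.incl x m)),
        Submodule.le_topologicalClosure _ ⟨_, rfl⟩⟩ :=
    (LinearEquiv.symm_apply_eq _).2 rfl
  refine Eq.trans ?_ (β.linear_incl x m)
  exact congrArg (fun z => z.1.2) this

theorem PShf.exists_isProfiniteDirectSum (M : PShf.{u} R) :
    ∃ (S : PMod.{u} R) (ω : M.HomTo S), M.IsProfiniteDirectSum S ω :=
  ⟨M.completionMod, M.completionHom, fun _ β => ⟨β.completionLift, β.completionLift_apply,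
    fun _ hg => PShf.completion_ext fun x m => (hg x m).trans (β.completionLift_apply x m).symm⟩⟩

/-! #### The profinite direct sum functor -/

/-- The profinite direct sum `⊞ ℳ`. -/
def PShf.bigsumObj (M : PShf.{u} R) : PMod.{u} R :=
  M.exists_isProfiniteDirectSum.choose

/-- The canonical morphism `ω : ℳ → ⊞ ℳ`. -/
def PShf.ω (M : PShf.{u} R) : M.HomTo M.bigsumObj :=
  M.exists_isProfiniteDirectSum.choose_spec.choose

theorem PShf.isProfiniteDirectSum (M : PShf.{u} R) : M.IsProfiniteDirectSum M.bigsumObj M.ω :=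
  M.exists_isProfiniteDirectSum.choose_spec.choose_spec

/-- The morphism `⊞ ℳ ⟶ P` induced by a morphism `ℳ → P`. -/
def PShf.HomTo.lift {M : PShf.{u} R} {P : PMod.{u} R} (β : M.HomTo P) : M.bigsumObj ⟶ P :=
  (M.isProfiniteDirectSum P β).choose

theorem PShf.HomTo.lift_apply {M : PShf.{u} R} {P : PMod.{u} R} (β : M.HomTo P)
    (x : M.base) (m : M.fibre x) : β.lift.lin (M.ω.map x m) = β.map x m :=
  (M.isProfiniteDirectSum P β).choose_spec.1 x m

/-- Composition of a morphism `ℳ → P` with a morphism of profinite modules. -/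
def PShf.HomTo.comp {M : PShf.{u} R} {P Q : PMod.{u} R} (β : M.HomTo P) (g : P ⟶ Q) :
    M.HomTo Q where
  map x := (g.lin : P →ₗ[R] Q).comp (β.map x)
  continuous_map := g.lin.continuous.comp β.continuous_map

/-- Composition of a morphism of families with a morphism `ℳ → P`. -/
def PShf.Hom.compTo {N M : PShf.{u} R} {P : PMod.{u} R} (F : PShf.Hom N M) (β : M.HomTo P) :
    N.HomTo P where
  map y := (β.map (F.f y)).comp (F.ψ y)
  continuous_map := β.continuous_map.comp F.continuous_ψ

theorem PShf.bigsum_ext {M : PShf.{u} R} {P : PMod.{u} R} {g h : M.bigsumObj ⟶ P}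
    (e : ∀ x m, g.lin (M.ω.map x m) = h.lin (M.ω.map x m)) : g = h :=
  (M.isProfiniteDirectSum P (M.ω.comp h)).unique e fun _ _ => rfl

/-- The map `⊞ 𝒩 ⟶ ⊞ ℳ` induced by a morphism of families. -/
def PShf.Hom.bigsumMap {N M : PShf.{u} R} (F : PShf.Hom N M) : N.bigsumObj ⟶ M.bigsumObj :=
  (F.compTo M.ω).lift

theorem PShf.Hom.bigsumMap_ω {N M : PShf.{u} R} (F : PShf.Hom N M) (y : N.base)
    (n : N.fibre y) : F.bigsumMap.lin (N.ω.map y n) = M.ω.map (F.f y) (F.ψ y n) :=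
  (F.compTo M.ω).lift_apply y n

variable (R)

/-- The profinite direct sum, as a functor. -/
def PShf.bigsum : PShf.{u} R ⥤ PMod.{u} R where
  obj M := M.bigsumObj
  map F := PShf.Hom.bigsumMap F
  map_id M := PShf.bigsum_ext fun x m => PShf.Hom.bigsumMap_ω (𝟙 M) x m
  map_comp F G := PShf.bigsum_ext fun x m =>
    (PShf.Hom.bigsumMap_ω (F ≫ G) x m).trans <|
      (PShf.Hom.bigsumMap_ω G _ _).symm.trans <|
        congrArg (PShf.Hom.bigsumMap G).lin (PShf.Hom.bigsumMap_ω F x m).symm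

end ProfiniteSheaves

section CosheafOfFamily

variable {R : Type u} [Ring R] [TopologicalSpace R]

/-- The fibres of the restriction of `ℳ` to the clopen subset `U`. -/
def PShf.restrictFibre (M : PShf.{u} R) (U : Clopens M.base) (x : Profinite.of U) : Type u :=
  M.fibre (Subtype.val (p := fun y => y ∈ U) x)

instance (M : PShf.{u} R) (U : Clopens M.base) (x : Profinite.of U) :
    AddCommGroup (M.restrictFibre U x) :=
  inferInstanceAs (AddCommGroup (M.fibre _))

instance (M : PShf.{u} R) (U : Clopens M.base) (x : Profinite.of U) :
    Module R (M.restrictFibre U x) :=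
  inferInstanceAs (Module R (M.fibre _))

/-- The inclusion `p⁻¹(U) → ℳ`. -/
def PShf.restrictIncl (M : PShf.{u} R) (U : Clopens M.base) (q : Tot (M.restrictFibre U)) :
    Tot M.fibre :=
  ⟨Subtype.val (p := fun y => y ∈ U) q.pt, q.val⟩

/-- `p⁻¹(U)` carries the subspace topology. -/
instance (M : PShf.{u} R) (U : Clopens M.base) : TopologicalSpace (Tot (M.restrictFibre U)) :=
  TopologicalSpace.induced (M.restrictIncl U) inferInstance

theorem PShf.continuous_restrictIncl (M : PShf.{u} R) (U : Clopens M.base) :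
    Continuous (M.restrictIncl U) :=
  continuous_induced_dom

theorem PShf.isClosedEmbedding_restrictIncl (M : PShf.{u} R) (U : Clopens M.base) :
    Topology.IsClosedEmbedding (M.restrictIncl U) where
  eq_induced := rfl
  injective := by
    rintro ⟨⟨x, hx⟩, a⟩ ⟨⟨y, hy⟩, b⟩ h
    simp only [PShf.restrictIncl] at h
    obtain ⟨rfl, h⟩ := h
    rfl
  isClosed_range := by
    convert U.isClosed.preimage M.continuous_pt using 1
    ext q
    constructor
    · rintro ⟨q, rfl⟩
      exact q.pt.2
    · intro hq
      exact ⟨⟨⟨q.pt, hq⟩, q.val⟩, rfl⟩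

/-- The restriction of a family of profinite modules to a clopen subset of the base. -/
def PShf.restrict (M : PShf.{u} R) (U : Clopens M.base) : PShf.{u} R where
  base := Profinite.of U
  fibre := M.restrictFibre U
  compactSpace := (M.isClosedEmbedding_restrictIncl U).compactSpace
  t2Space := (M.isClosedEmbedding_restrictIncl U).isEmbedding.t2Space
  totallyDisconnectedSpace :=
    (M.isClosedEmbedding_restrictIncl U).isEmbedding.isTotallyDisconnected_range.1
      (isTotallyDisconnected_of_totallyDisconnectedSpace _)
  continuous_pt :=
    continuous_induced_rng.2 (M.continuous_pt.comp (M.continuous_restrictIncl U))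
  continuous_smul := continuous_induced_rng.2 <|
    M.continuous_smul.comp
      (continuous_fst.prodMk ((M.continuous_restrictIncl U).comp continuous_snd))
  continuous_add := continuous_induced_rng.2 <| by
    have h : Continuous fun q : FibProd (M.restrictFibre U) =>
        (((⟨q.pt, q.fst⟩ : Tot (M.restrictFibre U)), (⟨q.pt, q.snd⟩ : Tot (M.restrictFibre U)))) :=
      continuous_induced_dom
    exact M.continuous_add.comp (continuous_fibProd_mk M.fibre
      (g := fun q : FibProd (M.restrictFibre U) => Subtype.val (p := fun y => y ∈ U) q.pt)
      (s := fun q => q.fst) (t := fun q => q.snd)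
      ((M.continuous_restrictIncl U).comp (continuous_fst.comp h))
      ((M.continuous_restrictIncl U).comp (continuous_snd.comp h)))

/-- The morphism `𝒩|_V ⟶ ℳ|_U` given by a morphism `𝒩 ⟶ ℳ` whose map on base spaces maps `V`
to `U`. -/
def PShf.Hom.restrict {N M : PShf.{u} R} (F : PShf.Hom N M) (V : Clopens N.base)
    (U : Clopens M.base) (h : ∀ y ∈ V, F.f y ∈ U) :
    PShf.Hom (N.restrict V) (M.restrict U) where
  f := ⟨fun y : V => (⟨F.f y.1, h y.1 y.2⟩ : U), by fun_prop⟩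
  ψ y := F.ψ (Subtype.val (p := fun y => y ∈ V) y)
  continuous_ψ := continuous_induced_rng.2 <|
    F.continuous_ψ.comp (N.continuous_restrictIncl V)

/-- The inclusion `ℳ|_V ⟶ ℳ|_U` for `V ≤ U`. -/
def PShf.restrictLE (M : PShf.{u} R) {V U : Clopens M.base} (h : V ≤ U) :
    M.restrict V ⟶ M.restrict U :=
  PShf.Hom.restrict (𝟙 M : M ⟶ M) V U h

variable [IsTopologicalRing R] [CompactSpace R]

/-- The precosheaf `U ↦ ⊞_{u ∈ U} M_u`. -/
def PShf.toPrecoshObj (M : PShf.{u} R) : Precosh.{u} R where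
  base := M.base
  fn :=
    { obj := fun U => (PShf.bigsum R).obj (M.restrict U)
      map := fun h => (PShf.bigsum R).map (M.restrictLE (leOfHom h))
      map_id := fun U => (PShf.bigsum R).map_id (M.restrict U)
      map_comp := fun h k => (PShf.bigsum R).map_comp (M.restrictLE (leOfHom h))
        (M.restrictLE (leOfHom k)) }

/-- A closed submodule of `⊞ ℳ` which contains the image of `ℳ` is everything. -/
theorem PShf.eq_top_of_closed (M : PShf.{u} R) (L : Submodule R M.bigsumObj)
    (hL : IsClosed (L : Set M.bigsumObj)) (h : ∀ x m, M.ω.map x m ∈ L) : L = ⊤ := by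
  have : CompactSpace L := isCompact_iff_compactSpace.1 hL.isCompact
  let P : PMod.{u} R := { carrier := L }
  let β : M.HomTo P :=
    { map := fun x => (M.ω.map x).codRestrict L (h x)
      continuous_map := M.ω.continuous_map.subtype_mk _ }
  let i : P ⟶ M.bigsumObj := ⟨L.subtypeL⟩
  have e : β.lift ≫ i = 𝟙 _ := PShf.bigsum_ext fun x m =>
    congrArg Subtype.val (β.lift_apply x m)
  refine eq_top_iff.2 fun s _ => ?_
  have := congrArg (fun g : M.bigsumObj ⟶ M.bigsumObj => g.lin s) e
  have h2 : (β.lift.lin s).1 = s := this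
  rw [← h2]
  exact (β.lift.lin s).2

/-- The element of `⊞_{u ∈ U} M_u` given by an element of a fibre. -/
def PShf.ωU (M : PShf.{u} R) (U : Clopens M.base) (x : M.base) (hx : x ∈ U) :
    M.fibre x →ₗ[R] M.toPrecoshObj.fn.obj U :=
  (M.restrict U).ω.map (⟨x, hx⟩ : U)

theorem PShf.cor_ωU (M : PShf.{u} R) {V U : Clopens M.base} (h : V ≤ U) (x : M.base) (hx : x ∈ V)
    (m : M.fibre x) :
    (M.toPrecoshObj.cor h).lin (M.ωU V x hx m) = M.ωU U x (h hx) m :=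
  PShf.Hom.bigsumMap_ω (M.restrictLE h) (⟨x, hx⟩ : V) m

theorem Precosh.fromSum_single (M : Precosh.{u} R) {n : ℕ} (U : Fin n → Clopens M.base) (i : Fin n)
    (a : M.fn.obj (U i)) :
    M.fromSum U (Pi.single i a) = (M.cor (Finset.le_sup (Finset.mem_univ i))).lin a := by
  rw [M.fromSum_apply, Finset.sum_eq_single i, Pi.single_eq_same]
  · intro j _ hj
    rw [Pi.single_eq_of_ne hj, map_zero]
  · exact fun h => (h (Finset.mem_univ i)).elim

theorem Precosh.diff_single (M : Precosh.{u} R) {n : ℕ} (U : Fin n → Clopens M.base)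
    (ij : Fin n × Fin n) (a : M.fn.obj (U ij.1 ⊓ U ij.2)) :
    M.diff U (Pi.single ij a) =
      Pi.single ij.1 ((M.cor (inf_le_left : U ij.1 ⊓ U ij.2 ≤ _)).lin a) -
        Pi.single ij.2 ((M.cor (inf_le_right : U ij.1 ⊓ U ij.2 ≤ _)).lin a) := by
  rw [M.diff_apply, Finset.sum_eq_single ij, Pi.single_eq_same]
  · intro j _ hj
    rw [Pi.single_eq_of_ne hj]
    simp
  · exact fun h => (h (Finset.mem_univ ij)).elim

theorem Precosh.fromSum_diff (M : Precosh.{u} R) {n : ℕ} (U : Fin n → Clopens M.base)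
    (k : ∀ ij : Fin n × Fin n, M.fn.obj (U ij.1 ⊓ U ij.2)) : M.fromSum U (M.diff U k) = 0 := by
  rw [M.diff_apply, map_sum]
  refine Finset.sum_eq_zero fun ij _ => ?_
  rw [map_sub, M.fromSum_single, M.fromSum_single, sub_eq_zero]
  have h : M.cor (inf_le_left : U ij.1 ⊓ U ij.2 ≤ _) ≫
        M.cor (Finset.le_sup (f := U) (Finset.mem_univ ij.1)) =
      M.cor (inf_le_right : U ij.1 ⊓ U ij.2 ≤ _) ≫
        M.cor (Finset.le_sup (f := U) (Finset.mem_univ ij.2)) := by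
    rw [M.cor_cor, M.cor_cor]
  exact congrArg (fun g => g.lin (k ij)) h

theorem PShf.fromSum_surjective (M : PShf.{u} R) {n : ℕ} (U : Fin n → Clopens M.base) :
    Function.Surjective (M.toPrecoshObj.fromSum U) := by
  have hcl : IsClosed (LinearMap.range (M.toPrecoshObj.fromSum U).toLinearMap :
      Set (M.toPrecoshObj.fn.obj (Finset.univ.sup U))) :=
    (isCompact_range (M.toPrecoshObj.fromSum U).continuous).isClosed
  refine LinearMap.range_eq_top.1 (PShf.eq_top_of_closed (M.restrict (Finset.univ.sup U)) _ hcl ?_)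
  rintro ⟨x, hx⟩ m
  have hx' := hx
  rw [← SetLike.mem_coe, Clopens.coe_finset_sup] at hx'
  obtain ⟨i, hi⟩ : ∃ i, x ∈ U i := by simpa using hx'
  exact ⟨Pi.single i (M.ωU (U i) x hi m),
    (M.toPrecoshObj.fromSum_single U i _).trans (M.cor_ωU _ x hi m)⟩

/-- A finite quotient of a profinite module by an open submodule, as a profinite module. -/
def PMod.openQuotient (P : PMod.{u} R) (L : Submodule R P) (hL : IsOpen (L : Set P)) :
    PMod.{u} R :=
  have : DiscreteTopology (P ⧸ L) := QuotientAddGroup.discreteTopology (N := L.toAddSubgroup) hL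
  have : CompactSpace (P ⧸ L) := inferInstanceAs (CompactSpace (Quotient L.quotientRel))
  { carrier := P ⧸ L }

/-- The quotient map. -/
def PMod.openQuotientMap (P : PMod.{u} R) (L : Submodule R P) (hL : IsOpen (L : Set P)) :
    P ⟶ P.openQuotient L hL :=
  ⟨L.mkQL⟩

theorem PMod.openQuotientMap_eq_zero (P : PMod.{u} R) (L : Submodule R P)
    (hL : IsOpen (L : Set P)) (p : P) : (P.openQuotientMap L hL).lin p = 0 ↔ p ∈ L :=
  Submodule.Quotient.mk_eq_zero L

theorem PMod.exists_open_separating (P : PMod.{u} R) (D : Submodule R P) (hD : IsClosed (D : Set P))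
    {p : P} (hp : p ∉ D) : ∃ L : Submodule R P, IsOpen (L : Set P) ∧ D ≤ L ∧ p ∉ L := by
  have hc : Continuous fun q : P => p - q := continuous_const.sub continuous_id
  obtain ⟨L, hL, hLD⟩ := P.exists_openSubmodule (V := {q | p - q ∈ (D : Set P)ᶜ})
    (hD.isOpen_compl.preimage hc) (by simpa using hp)
  refine ⟨L ⊔ D, ?_, le_sup_right, fun h => ?_⟩
  · exact AddSubgroup.isOpen_mono (H₁ := L.toAddSubgroup) (H₂ := (L ⊔ D).toAddSubgroup)
      (fun q hq => (le_sup_left : L ≤ L ⊔ D) hq) hL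
  · obtain ⟨a, ha, b, hb, rfl⟩ := Submodule.mem_sup.1 h
    exact hLD ha (by simpa using hb)

theorem PShf.mem_of_fromSum_eq_zero (M : PShf.{u} R) {n : ℕ} (U : Fin n → Clopens M.base)
    (m : ∀ i, M.toPrecoshObj.fn.obj (U i)) (hm : M.toPrecoshObj.fromSum U m = 0) :
    m ∈ LinearMap.range (M.toPrecoshObj.diff U).toLinearMap := by
  let N : PMod.{u} R := { carrier := ∀ i, M.toPrecoshObj.fn.obj (U i) }
  let D : Submodule R N := LinearMap.range (M.toPrecoshObj.diff U).toLinearMap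
  have hD : IsClosed (D : Set N) :=
    (isCompact_range (M.toPrecoshObj.diff U).continuous).isClosed
  by_contra hmD
  obtain ⟨L, hL, hDL, hmL⟩ := N.exists_open_separating D hD hmD
  have hcov : ∀ x ∈ (Finset.univ.sup U : Clopens M.base), ∃ i, x ∈ U i := fun x hx => by
    rw [← SetLike.mem_coe, Clopens.coe_finset_sup] at hx
    simpa using hx
  let π : N →L[R] N.openQuotient L hL := (N.openQuotientMap L hL).lin
  let b : ∀ i x, x ∈ U i → M.fibre x →ₗ[R] N.openQuotient L hL := fun i x hx =>
    (π : N →ₗ[R] N.openQuotient L hL).comp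
      ((LinearMap.single R (fun i => (M.toPrecoshObj.fn.obj (U i) : Type u)) i).comp
        (M.ωU (U i) x hx))
  have hb : ∀ i j x (hi : x ∈ U i) (hj : x ∈ U j), b i x hi = b j x hj := by
    intro i j x hi hj
    refine LinearMap.ext fun a => sub_eq_zero.1 ?_
    refine ((map_sub π _ _).symm).trans ((N.openQuotientMap_eq_zero L hL _).2 (hDL ?_))
    refine ⟨Pi.single (i, j) (M.ωU (U i ⊓ U j) x (clopens_mem_inf hi hj) a), ?_⟩
    refine (M.toPrecoshObj.diff_single U (i, j) _).trans ?_
    refine congrArg₂ (fun u v => Pi.single i u - Pi.single j v)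
      (M.cor_ωU inf_le_left x _ a) (M.cor_ωU inf_le_right x _ a)
  choose i hi using hcov
  let β : (M.restrict (Finset.univ.sup U)).HomTo (N.openQuotient L hL) :=
    { map := fun x => b _ _ (hi (Subtype.val (p := fun y => y ∈ Finset.univ.sup U) x)
        (Subtype.property (p := fun y => y ∈ Finset.univ.sup U) x))
      continuous_map := by
        refine continuous_iff_continuousAt.2 fun q => ?_
        have hpt : Continuous fun q : Tot (M.restrictFibre (Finset.univ.sup U)) =>
            Subtype.val (p := fun y => y ∈ Finset.univ.sup U) q.pt :=
          M.continuous_pt.comp (M.continuous_restrictIncl _)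
        let k := i _ (Subtype.property (p := fun y => y ∈ Finset.univ.sup U) q.pt)
        let O : Set (Tot (M.restrictFibre (Finset.univ.sup U))) :=
          {q | Subtype.val (p := fun y => y ∈ Finset.univ.sup U) q.pt ∈ U k}
        have hO : IsOpen O := (U k).isOpen.preimage hpt
        refine (hO.isOpenEmbedding_subtypeVal.continuousAt_iff (x := ⟨q, hi _ _⟩)).1 ?_
        have h1 : Continuous fun z : O =>
            (⟨⟨_, z.2⟩, z.1.val⟩ : Tot (M.restrictFibre (U k))) :=
          continuous_induced_rng.2 ((M.continuous_restrictIncl (Finset.univ.sup U)).comp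
            (continuous_subtype_val (p := fun q => q ∈ O)))
        have h2 := (π.continuous.comp (continuous_single (A := fun i =>
          (M.toPrecoshObj.fn.obj (U i) : Type u)) k)).comp
            ((M.restrict (U k)).ω.continuous_map.comp h1)
        refine h2.continuousAt.congr (Filter.Eventually.of_forall fun z => ?_)
        exact LinearMap.congr_fun (hb k _ _ z.2 (hi _ _)) z.1.val }
  have key : β.lift.lin.comp (M.toPrecoshObj.fromSum U) = π := by
    have hk : ∀ k, M.toPrecoshObj.cor (Finset.le_sup (Finset.mem_univ k)) ≫ β.lift =
        (⟨π.comp (ContinuousLinearMap.single R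
          (fun i => (M.toPrecoshObj.fn.obj (U i) : Type u)) k)⟩ :
          M.toPrecoshObj.fn.obj (U k) ⟶ N.openQuotient L hL) := fun k =>
      PShf.bigsum_ext (M := M.restrict (U k)) fun x a => by
        have hx : x.1 ∈ U k := x.2
        refine (congrArg β.lift.lin (M.cor_ωU (Finset.le_sup (Finset.mem_univ k)) x.1 hx a)).trans ?_
        refine (β.lift_apply _ _).trans ?_
        exact LinearMap.congr_fun (hb _ _ _ (hi _ _) hx) a
    refine ContinuousLinearMap.coe_injective (LinearMap.pi_ext fun k a => ?_)
    refine (congrArg β.lift.lin (M.toPrecoshObj.fromSum_single U k a)).trans ?_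
    exact congrArg (fun g => g.lin a) (hk k)
  refine hmL ((N.openQuotientMap_eq_zero L hL m).1 ?_)
  refine (congrArg (fun g => g m) key).symm.trans ?_
  refine (congrArg β.lift.lin hm).trans (map_zero _)

theorem PShf.isCosheaf (M : PShf.{u} R) : M.toPrecoshObj.IsCosheaf := fun _ U =>
  ⟨fun m => ⟨M.mem_of_fromSum_eq_zero U m, by
    rintro ⟨k, rfl⟩
    exact M.toPrecoshObj.fromSum_diff U k⟩, M.fromSum_surjective U⟩

/-- The map `Ψ_{U,V} : ⊞_{f⁻¹(U) ∩ V} 𝒩 ⟶ ⊞_U ℳ` induced by a morphism `𝒩 ⟶ ℳ`. -/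
def PShf.Hom.toPrecosh {N M : PShf.{u} R} (F : PShf.Hom N M) :
    Precosh.Hom N.toPrecoshObj M.toPrecoshObj :=
  Precosh.Hom.mk' (N := N.toPrecoshObj) (M := M.toPrecoshObj) F.f
    (fun U V => PShf.Hom.bigsumMap (F.restrict (clopenPreimage F.f U ⊓ V) U fun _ hy => hy.1))
    (fun {U U' V V'} h k =>
      ((PShf.bigsum R).map_comp (N.restrictLE (meet_mono F.f h k))
        (F.restrict (clopenPreimage F.f U' ⊓ V') U' fun _ hy => hy.1)).symm.trans
      ((PShf.bigsum R).map_comp (F.restrict (clopenPreimage F.f U ⊓ V) U fun _ hy => hy.1)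
        (M.restrictLE h)))

variable (R)

/-- The functor `ℳ ↦ (U ↦ ⊞_{u ∈ U} M_u)`, valued in precosheaves. -/
def PShf.toPrecosh : PShf.{u} R ⥤ Precosh.{u} R where
  obj M := M.toPrecoshObj
  map F := PShf.Hom.toPrecosh F
  map_id _ := Precosh.Hom.ext_heq rfl fun _ _ => heq_of_eq rfl
  map_comp {N M L} F G := Precosh.Hom.ext_heq rfl fun U V => heq_of_eq <| by
    let F' : N.restrict (clopenPreimage (PShf.Hom.f F) (clopenPreimage (PShf.Hom.f G) U ⊓ ⊤) ⊓ V) ⟶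
        M.restrict (clopenPreimage (PShf.Hom.f G) U ⊓ ⊤) :=
      PShf.Hom.restrict F _ _ fun _ hy => hy.1
    let G' : M.restrict (clopenPreimage (PShf.Hom.f G) U ⊓ ⊤) ⟶ L.restrict U :=
      PShf.Hom.restrict G _ _ fun _ hy => hy.1
    exact ((PShf.bigsum R).map_comp
      (N.restrictLE (comp_meet_le (PShf.Hom.f G) (PShf.Hom.f F) U V)) (F' ≫ G')).trans
        (congrArg (fun g => (PShf.bigsum R).map (N.restrictLE
          (comp_meet_le (PShf.Hom.f G) (PShf.Hom.f F) U V)) ≫ g) ((PShf.bigsum R).map_comp F' G'))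

/-- The cosheaf of a family of profinite modules. -/
def PShf.toCoShf : PShf.{u} R ⥤ CoShf.{u} R :=
  ObjectProperty.lift _ (PShf.toPrecosh R) PShf.isCosheaf

end CosheafOfFamily

section FamilyOfCosheaf

variable {R : Type u} [Ring R] [TopologicalSpace R]

/-- The inverse limit `M_x` of the modules `M(U)` over the clopen neighbourhoods `U` of `x`. -/
def Precosh.costalkSub (M : Precosh.{u} R) (x : M.base) :
    Submodule R (∀ U : {U : Clopens M.base // x ∈ U}, M.fn.obj U.1) where
  carrier := {m | ∀ (U V : {U : Clopens M.base // x ∈ U}) (h : U.1 ≤ V.1),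
    (M.cor h).lin (m U) = m V}
  zero_mem' _ _ h := map_zero (M.cor h).lin
  add_mem' {a b} ha hb U V h := (map_add (M.cor h).lin (a U) (b U)).trans
    (congrArg₂ (· + ·) (ha U V h) (hb U V h))
  smul_mem' r a ha U V h := (map_smul (M.cor h).lin r (a U)).trans
    (congrArg (r • ·) (ha U V h))

/-- The inverse limit `M_x`, as a type. -/
def Precosh.costalk (M : Precosh.{u} R) (x : M.base) : Type u := M.costalkSub x

instance (M : Precosh.{u} R) (x : M.base) : AddCommGroup (M.costalk x) :=
  inferInstanceAs (AddCommGroup (M.costalkSub x))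

instance (M : Precosh.{u} R) (x : M.base) : Module R (M.costalk x) :=
  inferInstanceAs (Module R (M.costalkSub x))

/-- The projection `M_x → M(U)`. -/
def Precosh.proj (M : Precosh.{u} R) (U : Clopens M.base) (x : M.base) (hx : x ∈ U) :
    M.costalk x →ₗ[R] M.fn.obj U :=
  (LinearMap.proj (φ := fun U : {U : Clopens M.base // x ∈ U} => (M.fn.obj U.1 : Type u))
    ⟨U, hx⟩).comp (M.costalkSub x).subtype

theorem Precosh.cor_proj (M : Precosh.{u} R) {U V : Clopens M.base} (h : U ≤ V) (x : M.base)
    (hx : x ∈ U) (m : M.costalk x) : (M.cor h).lin (M.proj U x hx m) = M.proj V x (h hx) m :=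
  m.2 ⟨U, hx⟩ ⟨V, h hx⟩ h

theorem Precosh.costalk_ext (M : Precosh.{u} R) {x : M.base} {m n : M.costalk x}
    (h : ∀ U hx, M.proj U x hx m = M.proj U x hx n) : m = n :=
  Subtype.ext (funext fun U => h U.1 U.2)

/-- Elements of `M_x` from compatible families. -/
def Precosh.costalkMk (M : Precosh.{u} R) (x : M.base)
    (m : ∀ U : Clopens M.base, x ∈ U → M.fn.obj U)
    (hm : ∀ U V (h : U ≤ V) (hx : x ∈ U), (M.cor h).lin (m U hx) = m V (h hx)) : M.costalk x :=
  ⟨fun U => m U.1 U.2, fun U V h => hm U.1 V.1 h U.2⟩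

/-- The set `O_{U,W}` of pairs of `x ∈ U` and `m ∈ M_x` with image in `W ⊆ M(U)`. -/
def Precosh.projSet (M : Precosh.{u} R) (U : Clopens M.base) (W : Set (M.fn.obj U)) :
    Set (Tot M.costalk) :=
  {q | ∃ h : q.pt ∈ U, M.proj U q.pt h q.val ∈ W}

/-- The topology on the disjoint union of the modules `M_x` generated by the sets `O_{U,W}`. -/
instance Precosh.costalkTopology (M : Precosh.{u} R) : TopologicalSpace (Tot M.costalk) :=
  TopologicalSpace.generateFrom {O | ∃ U W, IsOpen W ∧ M.projSet U W = O}

theorem Precosh.isOpen_projSet (M : Precosh.{u} R) (U : Clopens M.base) {W : Set (M.fn.obj U)}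
    (hW : IsOpen W) : IsOpen (M.projSet U W) :=
  TopologicalSpace.isOpen_generateFrom_of_mem ⟨U, W, hW, rfl⟩

open Classical in
/-- The projection to `M(U)`, extended by zero. -/
def Precosh.projZero (M : Precosh.{u} R) (U : Clopens M.base) (x : M.base) :
    M.costalk x →ₗ[R] M.fn.obj U :=
  if hx : x ∈ U then M.proj U x hx else 0

theorem Precosh.projZero_pos (M : Precosh.{u} R) {U : Clopens M.base} {x : M.base} (hx : x ∈ U) :
    M.projZero U x = M.proj U x hx :=
  dif_pos hx

theorem Precosh.projZero_neg (M : Precosh.{u} R) {U : Clopens M.base} {x : M.base} (hx : x ∉ U) :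
    M.projZero U x = 0 :=
  dif_neg hx

/-- The embedding of the disjoint union of the modules `M_x` in `∏ M(U) × X`. -/
def Precosh.embed (M : Precosh.{u} R) (q : Tot M.costalk) : (∀ U, M.fn.obj U) × M.base :=
  (fun U => M.projZero U q.pt q.val, q.pt)

theorem Precosh.continuous_costalk_pt (M : Precosh.{u} R) :
    Continuous (Tot.pt : Tot M.costalk → M.base) := by
  refine (isTopologicalBasis_isClopen (X := M.base)).continuous_iff.2 fun U hU => ?_
  convert M.isOpen_projSet ⟨U, hU⟩ isOpen_univ using 1
  ext q
  exact ⟨fun h => ⟨h, trivial⟩, fun h => h.1⟩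

theorem Precosh.continuous_projZero (M : Precosh.{u} R) (U : Clopens M.base) :
    Continuous fun q : Tot M.costalk => M.projZero U q.pt q.val := by
  refine continuous_def.2 fun W hW => ?_
  by_cases h0 : (0 : M.fn.obj U) ∈ W
  · convert (M.isOpen_projSet U hW).union
      (U.isClosed.isOpen_compl.preimage M.continuous_costalk_pt) using 1
    ext q
    by_cases hq : q.pt ∈ U
    · constructor
      · intro h
        refine Or.inl ⟨hq, ?_⟩
        rw [← M.projZero_pos hq]
        exact h
      · rintro (⟨_, h⟩ | h)
        · change M.projZero U q.pt q.val ∈ W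
          rwa [M.projZero_pos hq]
        · exact (h hq).elim
    · constructor
      · exact fun _ => Or.inr hq
      · intro _
        change M.projZero U q.pt q.val ∈ W
        rwa [M.projZero_neg hq]
  · convert M.isOpen_projSet U hW using 1
    ext q
    constructor
    · intro h
      change M.projZero U q.pt q.val ∈ W at h
      by_cases hq : q.pt ∈ U
      · rw [M.projZero_pos hq] at h
        exact ⟨hq, h⟩
      · rw [M.projZero_neg hq] at h
        exact (h0 h).elim
    · rintro ⟨hq, h⟩
      change M.projZero U q.pt q.val ∈ W
      rwa [M.projZero_pos hq]

theorem Precosh.continuous_embed (M : Precosh.{u} R) : Continuous M.embed :=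
  (continuous_pi M.continuous_projZero).prodMk M.continuous_costalk_pt

theorem Precosh.isClosedEmbedding_embed (M : Precosh.{u} R) :
    Topology.IsClosedEmbedding M.embed where
  eq_induced := by
    refine le_antisymm M.continuous_embed.le_induced (le_generateFrom ?_)
    rintro _ ⟨U, W, hW, rfl⟩
    refine isOpen_induced_iff.2 ⟨{z | z.2 ∈ U ∧ z.1 U ∈ W}, ?_, ?_⟩
    · exact (U.isOpen.preimage continuous_snd).inter
        (hW.preimage ((continuous_apply U).comp continuous_fst))
    · ext q
      constructor
      · rintro ⟨hq, h⟩
        have hq : q.pt ∈ U := hq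
        refine ⟨hq, ?_⟩
        rw [← M.projZero_pos hq]
        exact h
      · rintro ⟨hq, h⟩
        refine ⟨hq, ?_⟩
        change M.projZero U q.pt q.val ∈ W
        rwa [M.projZero_pos hq]
  injective := by
    rintro ⟨x, m⟩ ⟨y, n⟩ h
    obtain rfl : x = y := congrArg Prod.snd h
    refine congrArg (Tot.mk x) (M.costalk_ext fun U hx => ?_)
    have : M.projZero U x m = M.projZero U x n := congrFun (congrArg Prod.fst h) U
    rwa [M.projZero_pos hx] at this
  isClosed_range := by
    have h1 : ∀ U : Clopens M.base,
        IsClosed {z : (∀ U, M.fn.obj U) × M.base | z.2 ∉ U → z.1 U = 0} := fun U => by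
      convert (U.isClosed.preimage (continuous_snd (X := ∀ U, M.fn.obj U))).union
        (isClosed_singleton (x := (0 : M.fn.obj U)) |>.preimage
          ((continuous_apply U).comp (continuous_fst (Y := M.base)))) using 1
      ext z
      exact or_iff_not_imp_left.symm
    have h2 : ∀ (U V : Clopens M.base) (h : U ≤ V), IsClosed {z : (∀ U, M.fn.obj U) × M.base |
        z.2 ∈ U → (M.cor h).lin (z.1 U) = z.1 V} := fun U V h => by
      have hc : IsClosed {z : (∀ U, M.fn.obj U) × M.base | (M.cor h).lin (z.1 U) = z.1 V} :=
        isClosed_eq ((M.cor h).lin.continuous.comp ((continuous_apply U).comp continuous_fst))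
          ((continuous_apply V).comp continuous_fst)
      convert (U.isOpen.isClosed_compl.preimage (continuous_snd (X := ∀ U, M.fn.obj U))).union hc
        using 1
      ext z
      exact imp_iff_not_or
    convert (isClosed_iInter h1).inter
      (isClosed_iInter fun U => isClosed_iInter fun V => isClosed_iInter fun h => h2 U V h) using 1
    ext z
    simp only [Set.mem_inter_iff, Set.mem_iInter]
    constructor
    · rintro ⟨q, rfl⟩
      refine ⟨fun U hU => ?_, fun U V h hU => ?_⟩
      · have hU : q.pt ∉ U := hU
        change M.projZero U q.pt q.val = 0
        rw [M.projZero_neg hU]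
        rfl
      · have hU : q.pt ∈ U := hU
        change (M.cor h).lin (M.projZero U q.pt q.val) = M.projZero V q.pt q.val
        rw [M.projZero_pos hU, M.projZero_pos (h hU)]
        exact M.cor_proj h _ hU _
    · rintro ⟨hz1, hz2⟩
      refine ⟨⟨z.2, M.costalkMk z.2 (fun U _ => z.1 U) fun U V h hx => hz2 U V h hx⟩, ?_⟩
      refine Prod.ext (funext fun U => ?_) rfl
      change M.projZero U z.2 _ = z.1 U
      by_cases hU : z.2 ∈ U
      · rw [M.projZero_pos hU]
        rfl
      · rw [M.projZero_neg hU]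
        exact (hz1 U hU).symm

/-- The family of profinite modules `M_x` associated to a precosheaf. -/
def Precosh.toPShfObj (M : Precosh.{u} R) : PShf.{u} R where
  base := M.base
  fibre := M.costalk
  compactSpace := M.isClosedEmbedding_embed.compactSpace
  t2Space := M.isClosedEmbedding_embed.isEmbedding.t2Space
  totallyDisconnectedSpace :=
    M.isClosedEmbedding_embed.isEmbedding.isTotallyDisconnected_range.1
      (isTotallyDisconnected_of_totallyDisconnectedSpace _)
  continuous_pt := M.continuous_costalk_pt
  continuous_smul := by
    refine M.isClosedEmbedding_embed.isEmbedding.continuous_iff.2 ?_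
    have h2 : Continuous fun q : R × Tot M.costalk => q.2.pt :=
      M.continuous_costalk_pt.comp continuous_snd
    refine (continuous_pi fun U => ?_).prodMk h2
    refine (continuous_fst.smul ((M.continuous_projZero U).comp continuous_snd)).congr fun q => ?_
    exact (map_smul (M.projZero U q.2.pt) q.1 q.2.val).symm
  continuous_add := by
    have h : Continuous fun q : FibProd M.costalk =>
        ((⟨q.pt, q.fst⟩, ⟨q.pt, q.snd⟩) : Tot M.costalk × Tot M.costalk) := continuous_induced_dom
    refine M.isClosedEmbedding_embed.isEmbedding.continuous_iff.2 ?_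
    have h2 : Continuous fun q : FibProd M.costalk => q.pt :=
      M.continuous_costalk_pt.comp (continuous_fst.comp h)
    refine (continuous_pi fun U => ?_).prodMk h2
    refine (((M.continuous_projZero U).comp (continuous_fst.comp h)).add
      ((M.continuous_projZero U).comp (continuous_snd.comp h))).congr fun q => ?_
    exact (map_add (M.projZero U q.pt) q.fst q.snd).symm

/-- The map `N_y → M_{f(y)}` induced by the maps `N_y → N(f⁻¹(U)) → M(U)`. -/
def Precosh.Hom.costalk {N M : Precosh.{u} R} (F : Precosh.Hom N M) (y : N.base) :
    N.costalk y →ₗ[R] M.costalk (F.f y) where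
  toFun n := M.costalkMk (F.f y)
    (fun U hU => (F.app U ⊤).lin (N.proj (clopenPreimage F.f U ⊓ ⊤) y (mem_preimage_inf_top hU) n))
    (fun U V h hU => by
      have := congrArg (fun g => g.lin (N.proj _ y (mem_preimage_inf_top hU) n))
        (F.naturality h (le_refl ⊤))
      refine this.symm.trans (congrArg (F.app V ⊤).lin ?_)
      exact N.cor_proj _ y _ n)
  map_add' _ _ := M.costalk_ext fun U _ => map_add (F.app U ⊤).lin _ _
  map_smul' r _ := M.costalk_ext fun U _ => map_smul (F.app U ⊤).lin r _

theorem Precosh.Hom.proj_costalk {N M : Precosh.{u} R} (F : Precosh.Hom N M) (y : N.base)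
    (n : N.costalk y) (U : Clopens M.base) (hU : F.f y ∈ U) :
    M.proj U (F.f y) hU (F.costalk y n) =
      (F.app U ⊤).lin (N.proj (clopenPreimage F.f U ⊓ ⊤) y (mem_preimage_inf_top hU) n) :=
  rfl

theorem Precosh.Hom.continuous_costalk {N M : Precosh.{u} R} (F : Precosh.Hom N M) :
    Continuous fun q : Tot N.costalk => (⟨F.f q.pt, F.costalk q.pt q.val⟩ : Tot M.costalk) := by
  refine continuous_generateFrom_iff.2 ?_
  rintro _ ⟨U, W, hW, rfl⟩
  convert N.isOpen_projSet (clopenPreimage F.f U ⊓ ⊤) (hW.preimage (F.app U ⊤).lin.continuous)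
    using 1
  ext q
  exact ⟨fun h => ⟨mem_preimage_inf_top h.1, h.2⟩, fun h => ⟨h.1.1, h.2⟩⟩

/-- The morphism of families induced by a morphism of precosheaves. -/
def Precosh.Hom.toPShf {N M : Precosh.{u} R} (F : Precosh.Hom N M) :
    PShf.Hom N.toPShfObj M.toPShfObj where
  f := F.f
  ψ := F.costalk
  continuous_ψ := F.continuous_costalk

variable (R)

/-- The functor sending a precosheaf to the family of its modules `M_x`. -/
def Precosh.toPShf : Precosh.{u} R ⥤ PShf.{u} R where
  obj M := M.toPShfObj
  map F := Precosh.Hom.toPShf F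
  map_id M := PShf.Hom.ext rfl <| heq_of_eq <| funext fun x => LinearMap.ext fun m =>
    M.costalk_ext fun U hx => M.cor_proj (id_meet_le U ⊤) x _ m
  map_comp {N M L} F G := PShf.Hom.ext rfl <| heq_of_eq <| funext fun x => LinearMap.ext fun m =>
    L.costalk_ext fun U hx => by
      have hx' : x ∈ clopenPreimage ((PShf.Hom.f (Precosh.Hom.toPShf G)).comp
          (PShf.Hom.f (Precosh.Hom.toPShf F))) U ⊓ ⊤ := mem_preimage_inf_top hx
      exact congrArg (fun z => (Precosh.Hom.app G U ⊤).lin ((Precosh.Hom.app F _ ⊤).lin z))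
        (N.cor_proj (comp_meet_le (Precosh.Hom.f G) (Precosh.Hom.f F) U ⊤) x hx' m)

/-- The family of profinite modules of a cosheaf. -/
def CoShf.toPShf : CoShf.{u} R ⥤ PShf.{u} R :=
  ObjectProperty.ι _ ⋙ Precosh.toPShf R

end FamilyOfCosheaf

end

/-!
The four equivalences and the commutativity of the diagram rest on four comparison isomorphisms.

*Pontryagin duality.* Both duals of a module separate points, because the circle is divisible and a
profinite module is an inverse limit of finite ones. An element of the double dual of a discrete
module `A` is a continuous character of the compact group `A^∨`; by continuity it depends only on
the values at finitely many elements, which have finite order, and hence is an evaluation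
(`DMod.exists_eq_eval`).
The case of a profinite module follows by dualising. It is used below in the form that a morphism
of profinite modules is bijective once it induces a bijection on characters.

*Sheaves and cosheaves.* Dualising values exchanges the two exactness conditions, and the
evaluation isomorphisms `A(U) ≅ A(U)^∨^∨` are natural in `U` and in morphisms over varying base
spaces.

*Étale spaces and sheaves.* A section of a sheaf is determined by its germs, and a continuous
section of the étale space is locally given by sections of the sheaf, which agree on overlaps and
therefore glue (`Presh.IsSheaf.exists_glue`; clopen covers of clopen sets reduce to finite ones).
Conversely, a point of an étale space lies on a local section over a clopen set, and two local
sections which agree at a point agree near it.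

*Families of profinite modules and cosheaves.* For a family `ℳ` one has to identify `M_x` with
`lim ⊞_{u ∈ U} M_u`. Injectivity holds as every finite quotient of `M_x` extends to a fibrewise
linear map on `ℳ|_U` for some `U` (`PShf.exists_extension`), surjectivity by compactness. For a
cosheaf `N` one has to show that `⊞_{u ∈ U} N_u → N(U)` is bijective, that is, that it induces a
bijection on characters. Since the circle has no small subgroups, a character of `N(U)` which
vanishes on `N_x` vanishes on `N(V)` for some neighbourhood `V` of `x`
(`Precosh.exists_character_cor_eq_zero`), and every character of `N_x` comes from some `N(V)`
(`Precosh.exists_character_extension`). In other words the stalk of the sheaf `U ↦ N(U)^∨` at `x`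
is `N_x^∨`; the same holds for the cosheaf `U ↦ ⊞_{u ∈ U} N_u`, which has the same modules `N_x`
by the first half, so the two dual sheaves agree.

The triangles follow by evaluating at the whole base space, where a section over `X` is a global
section and `⊞_{x ∈ X} M_x` is `⊞ ℳ`; the squares commute by definition of the dual.
-/

universe v

noncomputable section

/-! ### Pontryagin duality for discrete and profinite modules -/

section DoubleDual

/-- A character vanishing on the kernel of a homomorphism factors through it, without restriction
on universes. -/
theorem exists_factor_character_univ {A : Type u} {B : Type v} [AddCommGroup A] [AddCommGroup B]
    (f : A →+ B) (χ : A →+ UnitAddCircle) (h : ∀ a, f a = 0 → χ a = 0) :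
    ∃ ψ : B →+ UnitAddCircle, ∀ a, ψ (f a) = χ a := by
  let i : ULift.{v} A ≃+ A := AddEquiv.ulift
  let j : ULift.{u} B ≃+ B := AddEquiv.ulift
  obtain ⟨ψ, hψ⟩ := exists_factor_character (A := ULift.{v} A) (B := ULift.{u} B)
    ((j.symm.toAddMonoidHom.comp f).comp i.toAddMonoidHom) (χ.comp i.toAddMonoidHom)
    (fun a ha => h (i a) (j.symm.injective (ha.trans (map_zero j.symm).symm)))
  exact ⟨ψ.comp j.symm.toAddMonoidHom, fun a => hψ (i.symm a)⟩

/-- Additive maps from the `N`-torsion subgroup of the circle to the circle are multiplications by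
integers, since the torsion subgroup is generated by `1 / N`. -/
theorem exists_zsmul_of_torsion {N : ℕ} (hN : 0 < N)
    (ψ : AddSubgroup.torsionBy UnitAddCircle (N : ℤ) →+ UnitAddCircle) :
    ∃ k : ℤ, ∀ t, ψ t = k • (t : UnitAddCircle) := by
  have key : ∀ t : UnitAddCircle, N • t = 0 → ∃ m : ℕ, t = m • (((1 / N : ℝ)) : UnitAddCircle) := by
    intro t ht
    obtain ⟨m, -, rfl⟩ := (AddCircle.nsmul_eq_zero_iff (p := (1 : ℝ)) hN).1 ht
    exact ⟨m, by rw [AddCircle.natCast_div_mul_eq_nsmul]⟩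
  have hg : N • (((1 / N : ℝ)) : UnitAddCircle) = 0 :=
    (AddCircle.nsmul_eq_zero_iff (p := (1 : ℝ)) hN).2 ⟨1 % N, Nat.mod_lt _ hN, by
      rcases Nat.lt_or_ge 1 N with h | h
      · rw [Nat.mod_eq_of_lt h]; simp
      · obtain rfl : N = 1 := by omega
        have := AddCircle.coe_period (1 : ℝ)
        simpa using this.symm⟩
  let g : AddSubgroup.torsionBy UnitAddCircle (N : ℤ) :=
    ⟨(((1 / N : ℝ)) : UnitAddCircle), (natCast_zsmul _ N).trans hg⟩
  have hψg : N • ψ g = 0 := by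
    rw [← map_nsmul, show N • g = 0 from Subtype.ext hg, map_zero]
  obtain ⟨k, hk⟩ := key _ hψg
  refine ⟨k, fun t => ?_⟩
  obtain ⟨m, hm⟩ := key t ((natCast_zsmul _ N).symm.trans t.2)
  have ht : t = m • g := Subtype.ext hm
  rw [ht, map_nsmul, hk]
  simp only [AddSubgroup.coe_nsmul, natCast_zsmul]
  exact smul_comm _ _ _

/-- A character killed by the common kernel of finitely many characters of finite order is an
integral combination of them. -/
theorem exists_sum_zsmul_of_ker {C : Type u} [AddCommGroup C] {ι : Type v} [Fintype ι] {N : ℕ}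
    (hN : 0 < N) (a : ι → C →+ UnitAddCircle) (ha : ∀ i c, N • a i c = 0)
    (φ : C →+ UnitAddCircle) (hφ : ∀ c, (∀ i, a i c = 0) → φ c = 0) :
    ∃ k : ι → ℤ, ∀ c, φ c = ∑ i, k i • a i c := by
  classical
  let f : C →+ (ι → AddSubgroup.torsionBy UnitAddCircle (N : ℤ)) :=
    AddMonoidHom.mk' (fun c i => ⟨a i c, (natCast_zsmul _ N).trans (ha i c)⟩) fun c d =>
      funext fun i => Subtype.ext (map_add (a i) c d)
  obtain ⟨ψ, hψ⟩ := exists_factor_character_univ f φ fun c hc =>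
    hφ c fun i => congrArg Subtype.val (congrFun hc i)
  choose k hk using fun i => exists_zsmul_of_torsion hN
    (ψ.comp (AddMonoidHom.single (fun _ : ι => AddSubgroup.torsionBy UnitAddCircle (N : ℤ)) i))
  refine ⟨k, fun c => ?_⟩
  rw [← hψ c, ← Finset.univ_sum_single (f c), map_sum]
  exact Finset.sum_congr rfl fun i _ => hk i (f c i)

/-- Characters of abelian groups separate points: the subgroup generated by `a ≠ 0` has a character
of prime order. -/
theorem exists_character_ne_zero {A : Type u} [AddCommGroup A] {a : A} (ha : a ≠ 0) :
    ∃ χ : A →+ UnitAddCircle, χ a ≠ 0 := by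
  have h1 : addOrderOf a ≠ 1 := fun h => ha (AddMonoid.addOrderOf_eq_one_iff.1 h)
  have hp := Nat.minFac_prime h1
  set p := (addOrderOf a).minFac
  let t : UnitAddCircle := ((1 / p : ℝ) : UnitAddCircle)
  have ht : addOrderOf t = p := AddCircle.addOrderOf_period_div hp.pos
  obtain ⟨χ, hχ⟩ := exists_factor_character_univ (zmultiplesHom A a) (zmultiplesHom _ t)
    fun k hk => by
      have hk' : k • a = 0 := hk
      change k • t = 0
      rw [← addOrderOf_dvd_iff_zsmul_eq_zero] at hk' ⊢
      rw [ht]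
      exact (Int.natCast_dvd_natCast.2 (Nat.minFac_dvd _)).trans hk'
  refine ⟨χ, fun h => hp.one_lt.ne' ?_⟩
  have h2 := hχ 1
  simp only [zmultiplesHom_apply, one_smul] at h2
  rw [← ht, ← h2, h, addOrderOf_zero]

variable {R : Type u} [Ring R] [TopologicalSpace R] [IsTopologicalRing R] [CompactSpace R]

/-- Every continuous character of the dual of a discrete module is the evaluation at an element. By
continuity it is killed by the common kernel of finitely many evaluations, and these have finite
order. -/
theorem DMod.exists_eq_eval (A : DMod.{u} R) (φ : PDual (PDual A)) :
    ∃ a : A, ∀ χ : PDual A, φ χ = χ a := by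
  obtain ⟨V, hV, h0, hns⟩ := exists_nhds_circle_noSmallSubgroups
  have hemb : Topology.IsInducing (fun (χ : PDual A) (a : A) => χ a) :=
    ContinuousAddMonoidHom.isClosedEmbedding_coe.isInducing
  obtain ⟨O, hO, hOφ⟩ := hemb.isOpen_iff.1 (hV.preimage φ.continuous_toFun)
  have h0O : (fun _ => 0 : A → UnitAddCircle) ∈ O := by
    have : (0 : PDual A) ∈ φ ⁻¹' V := by
      rw [Set.mem_preimage, map_zero]
      exact h0
    exact (Set.ext_iff.1 hOφ _).2 this
  obtain ⟨I, w, hw, hIw⟩ := isOpen_pi_iff.1 hO _ h0O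
  have hker : ∀ χ : PDual A, (∀ a ∈ I, χ a = 0) → φ χ = 0 := fun χ hχ => by
    refine hns _ fun n => ?_
    rw [← map_nsmul]
    have : (n • χ) ∈ (fun (χ : PDual A) (a : A) => χ a) ⁻¹' O := by
      refine hIw fun a ha => ?_
      have : (n • χ) a = 0 := by
        refine (map_nsmul (AddMonoidHom.mk' (fun χ : PDual A => χ a) fun _ _ => rfl) n χ).trans ?_
        exact (congrArg (n • ·) (hχ a ha)).trans (smul_zero n)
      change (n • χ) a ∈ w a
      rw [this]
      exact (hw a ha).2
    exact (Set.ext_iff.1 hOφ _).1 this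
  choose N hN hNa using A.exists_nsmul_eq_zero
  let ev : I → PDual A →+ UnitAddCircle := fun a =>
    AddMonoidHom.mk' (fun χ => χ a.1) fun _ _ => rfl
  obtain ⟨k, hk⟩ := exists_sum_zsmul_of_ker (N := ∏ a ∈ I, N a)
    (Finset.prod_pos fun a _ => hN a) ev (fun a χ => by
      obtain ⟨m, hm⟩ := Finset.dvd_prod_of_mem N a.2
      change _ • χ a.1 = 0
      rw [hm, mul_comm, mul_smul, ← map_nsmul, hNa, map_zero, smul_zero])
    (φ : PDual A →+ UnitAddCircle) (fun χ hχ => hker χ fun a ha => hχ ⟨a, ha⟩)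
  refine ⟨∑ i, k i • i.1, fun χ => (hk χ).trans ?_⟩
  rw [map_sum]
  exact Finset.sum_congr rfl fun i _ => (map_zsmul χ (k i) i.1).symm

/-- A point outside a closed submodule of a profinite module is separated from it by a continuous
character: it is separated in a finite quotient. -/
theorem PMod.exists_character_ne_zero (P : PMod.{u} R) (D : Submodule R P)
    (hD : IsClosed (D : Set P)) {p : P} (hp : p ∉ D) :
    ∃ χ : PDual P, (∀ d ∈ D, χ d = 0) ∧ χ p ≠ 0 := by
  obtain ⟨L, hL, hDL, hpL⟩ := P.exists_open_separating D hD hp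
  have hne : (P.openQuotientMap L hL).lin p ≠ 0 := fun h =>
    hpL ((P.openQuotientMap_eq_zero L hL p).1 h)
  obtain ⟨χ, hχ⟩ := _root_.exists_character_ne_zero hne
  have hdisc : DiscreteTopology (P.openQuotient L hL) :=
    QuotientAddGroup.discreteTopology (N := L.toAddSubgroup) hL
  refine ⟨⟨χ.comp (P.openQuotientMap L hL).lin.toLinearMap.toAddMonoidHom,
    (continuous_of_discreteTopology (f := χ)).comp (P.openQuotientMap L hL).lin.continuous⟩,
    fun d hd => ?_, hχ⟩
  have : (P.openQuotientMap L hL).lin d = 0 := (P.openQuotientMap_eq_zero L hL d).2 (hDL hd)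
  exact (congrArg χ this).trans (map_zero χ)

/-- A morphism of profinite modules is surjective if composition with it is injective on
characters. -/
theorem PMod.surjective_of_dual_injective {P Q : PMod.{u} R} (g : P ⟶ Q)
    (h : ∀ χ : PDual Q, (∀ p, χ (g.lin p) = 0) → χ = 0) : Function.Surjective g.lin := by
  intro q
  by_contra hq
  obtain ⟨χ, h1, h2⟩ := Q.exists_character_ne_zero (LinearMap.range (g.lin : P →ₗ[R] Q))
    (isCompact_range g.lin.continuous).isClosed (p := q) hq
  refine h2 ?_
  rw [h χ fun p => h1 _ ⟨p, rfl⟩]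
  rfl

/-- A morphism of profinite modules is injective if every character extends along it. -/
theorem PMod.injective_of_dual_surjective {P Q : PMod.{u} R} (g : P ⟶ Q)
    (h : ∀ ψ : PDual P, ∃ χ : PDual Q, ∀ p, χ (g.lin p) = ψ p) : Function.Injective g.lin := by
  refine (injective_iff_map_eq_zero g.lin).2 fun p hp => ?_
  by_contra hne
  obtain ⟨ψ, -, hψ⟩ := P.exists_character_ne_zero ⊥ isClosed_singleton (p := p) hne
  obtain ⟨χ, hχ⟩ := h ψ
  exact hψ ((hχ p).symm.trans (by rw [hp, map_zero]))

/-- A bijective linear map of discrete modules is an isomorphism. -/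
def DMod.isoOfBijective {A B : DMod.{u} R} (g : A →ₗ[Rᵐᵒᵖ] B) (hg : Function.Bijective g) :
    A ≅ B where
  hom := ⟨g⟩
  inv := ⟨(LinearEquiv.ofBijective g hg).symm.toLinearMap⟩
  hom_inv_id := DMod.Hom.ext <| LinearMap.ext fun a =>
    (LinearEquiv.ofBijective g hg).symm_apply_apply a
  inv_hom_id := DMod.Hom.ext <| LinearMap.ext fun b =>
    (LinearEquiv.ofBijective g hg).apply_symm_apply b

/-- A bijective continuous linear map of profinite modules is an isomorphism, by compactness. -/
def PMod.isoOfBijective {P Q : PMod.{u} R} (g : P ⟶ Q) (hg : Function.Bijective g.lin) :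
    P ≅ Q where
  hom := g
  inv := ⟨⟨(LinearEquiv.ofBijective (g.lin : P →ₗ[R] Q) hg).symm.toLinearMap,
    g.lin.continuous.continuous_symm_of_equiv_compact_to_t2
      (f := (LinearEquiv.ofBijective (g.lin : P →ₗ[R] Q) hg).toEquiv)⟩⟩
  hom_inv_id := PMod.Hom.ext <| ContinuousLinearMap.ext fun p =>
    (LinearEquiv.ofBijective (g.lin : P →ₗ[R] Q) hg).symm_apply_apply p
  inv_hom_id := PMod.Hom.ext <| ContinuousLinearMap.ext fun q =>
    (LinearEquiv.ofBijective (g.lin : P →ₗ[R] Q) hg).apply_symm_apply q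

/-- The evaluation map `A → A^∨∨`. -/
def DMod.evalHom (A : DMod.{u} R) :
    A →ₗ[Rᵐᵒᵖ] (PMod.dual R).obj (op ((DMod.dual R).obj (op A))) where
  toFun a := (⟨AddMonoidHom.mk' (fun χ : PDual A => χ a) fun _ _ => rfl,
    continuous_eval_const a⟩ : PDual (PDual A))
  map_add' a b := ContinuousAddMonoidHom.ext (A := PDual A) fun χ => map_add χ a b
  map_smul' _ _ := rfl

/-- The evaluation map `P → P^∨∨`. -/
def PMod.evalHom (P : PMod.{u} R) :
    P ⟶ (DMod.dual R).obj (op ((PMod.dual R).obj (op P))) :=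
  ⟨{ toFun := fun p => (⟨AddMonoidHom.mk' (fun χ : PDual P => χ p) fun _ _ => rfl,
      continuous_of_discreteTopology⟩ : PDual (PDual P))
     map_add' := fun a b => ContinuousAddMonoidHom.ext (A := PDual P) fun χ => map_add χ a b
     map_smul' := fun _ _ => rfl
     cont := by
      have hemb : Topology.IsInducing (fun (φ : PDual (PDual P)) (χ : PDual P) => φ χ) :=
        ContinuousAddMonoidHom.isClosedEmbedding_coe.isInducing
      exact hemb.continuous_iff.2 (continuous_pi fun χ => χ.continuous_toFun) }⟩

theorem DMod.evalHom_bijective (A : DMod.{u} R) : Function.Bijective A.evalHom := by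
  constructor
  · refine (injective_iff_map_eq_zero A.evalHom).2 fun a ha => ?_
    by_contra hne
    obtain ⟨χ, hχ⟩ := exists_character_ne_zero hne
    exact hχ (DFunLike.congr_fun (F := PDual (PDual A)) ha
      (⟨χ, continuous_of_discreteTopology⟩ : PDual A))
  · intro φ
    obtain ⟨a, ha⟩ := A.exists_eq_eval φ
    exact ⟨a, ContinuousAddMonoidHom.ext (A := PDual A) fun χ => (ha χ).symm⟩

theorem PMod.evalHom_bijective (P : PMod.{u} R) : Function.Bijective P.evalHom.lin := by
  constructor
  · exact PMod.injective_of_dual_surjective _ fun ψ =>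
      ⟨((PMod.dual R).obj (op P)).evalHom ψ, fun _ => rfl⟩
  · -- A character of `P^∨∨` is evaluation at some `χ` in `P^∨`; on the image of `P` it is `χ`.
    refine PMod.surjective_of_dual_injective _ fun φ hφ => ?_
    obtain ⟨χ, hχ⟩ : ∃ χ : PDual P, ∀ z : PDual (PDual P),
        DFunLike.coe (F := PDual (PDual (PDual P))) φ z = z χ :=
      ((PMod.dual R).obj (op P)).exists_eq_eval φ
    have h0 : χ = (0 : PDual P) := ContinuousAddMonoidHom.ext fun p =>
      (hχ (P.evalHom.lin p)).symm.trans (hφ p)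
    exact ContinuousAddMonoidHom.ext (A := PDual (PDual P)) fun z =>
      (hχ z).trans ((congrArg z h0).trans (map_zero z))

variable (R)

/-- The double dual of discrete modules is naturally isomorphic to the identity. -/
def DMod.doubleDualIso : 𝟭 (DMod.{u} R) ≅ (DMod.dual R).rightOp ⋙ PMod.dual R :=
  NatIso.ofComponents (fun A => DMod.isoOfBijective A.evalHom A.evalHom_bijective) fun _ => rfl

/-- The double dual of profinite modules is naturally isomorphic to the identity. -/
def PMod.doubleDualIso : 𝟭 (PMod.{u} R) ≅ (PMod.dual R).rightOp ⋙ DMod.dual R :=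
  NatIso.ofComponents (fun P => PMod.isoOfBijective P.evalHom P.evalHom_bijective) fun _ => rfl

/-- Pontryagin duality. -/
def pontryaginEquivalence : (DMod.{u} R)ᵒᵖ ≌ PMod.{u} R :=
  CategoryTheory.Equivalence.mk (DMod.dual R) (PMod.dual R).rightOp
    (NatIso.op (DMod.doubleDualIso R)).symm (PMod.doubleDualIso R).symm

end DoubleDual

/-! ### Morphisms over a fixed base space -/

section FixedBase

variable {R : Type u} [Ring R] [TopologicalSpace R]

theorem Presh.res_res_apply (A : Presh.{u} R) {U V W : Clopens A.base} (h : U ≤ V) (h' : V ≤ W)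
    (s : A.fn.obj (op W)) : (A.res h).lin ((A.res h').lin s) = (A.res (h.trans h')).lin s :=
  congrArg (fun g => g.lin s) (A.res_res h h')

theorem Presh.res_self_apply (A : Presh.{u} R) {U : Clopens A.base} (h : U ≤ U)
    (s : A.fn.obj (op U)) : (A.res h).lin s = s :=
  congrArg (fun g => g.lin s) (A.res_self h)

theorem Precosh.cor_cor_apply (M : Precosh.{u} R) {U V W : Clopens M.base} (h : U ≤ V) (h' : V ≤ W)
    (m : M.fn.obj U) : (M.cor h').lin ((M.cor h).lin m) = (M.cor (h.trans h')).lin m :=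
  congrArg (fun g => g.lin m) (M.cor_cor h h')

theorem Precosh.cor_self_apply (M : Precosh.{u} R) {U : Clopens M.base} (h : U ≤ U)
    (m : M.fn.obj U) : (M.cor h).lin m = m :=
  congrArg (fun g => g.lin m) (M.cor_self h)

theorem Presh.Hom.naturality_apply {A B : Presh.{u} R} (F : Presh.Hom A B) {U U' : Clopens A.base}
    {V V' : Clopens B.base} (h : U ≤ U') (k : V ≤ V') (s : A.fn.obj (op U')) :
    (F.app U V).lin ((A.res h).lin s) = (B.res (meet_mono F.f h k)).lin ((F.app U' V').lin s) :=
  congrArg (fun g => g.lin s) (F.naturality h k)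

theorem Precosh.Hom.naturality_apply {N M : Precosh.{u} R} (F : Precosh.Hom N M)
    {U U' : Clopens M.base} {V V' : Clopens N.base} (h : U ≤ U') (k : V ≤ V')
    (n : N.fn.obj (clopenPreimage F.f U ⊓ V)) :
    (F.app U' V').lin ((N.cor (meet_mono F.f h k)).lin n) = (M.cor h).lin ((F.app U V).lin n) :=
  congrArg (fun g => g.lin n) (F.naturality h k)

/-- A component of a morphism of presheaves is determined by the one with `V` the whole space. -/
theorem Presh.Hom.app_eq_res {A B : Presh.{u} R} (F : Presh.Hom A B) (U : Clopens A.base)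
    (V : Clopens B.base) (s : A.fn.obj (op U)) :
    (F.app U V).lin s = (B.res (meet_mono F.f le_rfl le_top)).lin ((F.app U ⊤).lin s) := by
  rw [← F.naturality_apply le_rfl le_top, A.res_self_apply]

/-- A component of a morphism of precosheaves is determined by the one with `V` the whole space. -/
theorem Precosh.Hom.app_eq_cor {N M : Precosh.{u} R} (F : Precosh.Hom N M) (U : Clopens M.base)
    (V : Clopens N.base) (n : N.fn.obj (clopenPreimage F.f U ⊓ V)) :
    (F.app U V).lin n = (F.app U ⊤).lin ((N.cor (meet_mono F.f le_rfl le_top)).lin n) := by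
  rw [F.naturality_apply le_rfl le_top, M.cor_self_apply]

theorem natTrans_res {X : Profinite.{u}} {F G : (Clopens X)ᵒᵖ ⥤ DMod.{u} R} (α : F ⟶ G)
    {U V : Clopens X} (h : U ≤ V) (s : F.obj (op V)) :
    (α.app (op U)).lin ((F.map (homOfLE h).op).lin s) =
      (G.map (homOfLE h).op).lin ((α.app (op V)).lin s) :=
  congrArg (fun g => g.lin s) (α.naturality (homOfLE h).op)

theorem natTrans_cor {X : Profinite.{u}} {F G : Clopens X ⥤ PMod.{u} R} (α : F ⟶ G)
    {U V : Clopens X} (h : U ≤ V) (m : F.obj U) :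
    (α.app V).lin ((F.map (homOfLE h)).lin m) = (G.map (homOfLE h)).lin ((α.app U).lin m) :=
  congrArg (fun g => g.lin m) (α.naturality (homOfLE h))

/-- A morphism of presheaves on a fixed space, as a morphism over the identity. -/
def Presh.baseHom {X : Profinite.{u}} {F G : (Clopens X)ᵒᵖ ⥤ DMod.{u} R} (α : F ⟶ G) :
    Presh.Hom ⟨X, F⟩ ⟨X, G⟩ :=
  Presh.Hom.mk' (A := ⟨X, F⟩) (B := ⟨X, G⟩) (ContinuousMap.id X)
    (fun U V => α.app (op U) ≫ Presh.res ⟨X, G⟩ (id_meet_le U V))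
    (fun {U _ V _} h _ => DMod.Hom.ext <| LinearMap.ext fun s =>
      (congrArg (Presh.res ⟨X, G⟩ (id_meet_le U V)).lin (natTrans_res α h s)).trans <|
        (Presh.res_res_apply ⟨X, G⟩ _ _ _).trans (Presh.res_res_apply ⟨X, G⟩ _ _ _).symm)

/-- A morphism of precosheaves on a fixed space, as a morphism over the identity. -/
def Precosh.baseHom {X : Profinite.{u}} {F G : Clopens X ⥤ PMod.{u} R} (α : F ⟶ G) :
    Precosh.Hom ⟨X, F⟩ ⟨X, G⟩ :=
  Precosh.Hom.mk' (N := ⟨X, F⟩) (M := ⟨X, G⟩) (ContinuousMap.id X)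
    (fun U V => Precosh.cor ⟨X, F⟩ (id_meet_le U V) ≫ α.app U)
    (fun {_ U' _ _} h _ => PMod.Hom.ext <| ContinuousLinearMap.ext fun _ =>
      (congrArg (α.app U').lin ((Precosh.cor_cor_apply ⟨X, F⟩ _ _ _).trans
        (Precosh.cor_cor_apply ⟨X, F⟩ _ _ _).symm)).trans (natTrans_cor α h _))

theorem Presh.comp_baseHom_app {A : Presh.{u} R} {X : Profinite.{u}}
    {F G : (Clopens X)ᵒᵖ ⥤ DMod.{u} R} (H : Presh.Hom A ⟨X, F⟩) (α : F ⟶ G)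
    (U : Clopens A.base) (V : Clopens X) :
    (H.comp (Presh.baseHom α)).app U V = H.app U V ≫ α.app (op (clopenPreimage H.f U ⊓ V)) :=
  DMod.Hom.ext <| LinearMap.ext fun s =>
    (Presh.res_res_apply ⟨X, G⟩ _ _ _).trans <|
      (natTrans_res α (meet_mono H.f le_rfl le_top) _).symm.trans
        (congrArg (α.app (op (clopenPreimage H.f U ⊓ V))).lin (H.app_eq_res U V s).symm)

theorem Presh.baseHom_comp_app {A : Presh.{u} R} {X : Profinite.{u}}
    {F G : (Clopens X)ᵒᵖ ⥤ DMod.{u} R} (α : F ⟶ G) (H : Presh.Hom ⟨X, G⟩ A)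
    (U : Clopens X) (V : Clopens A.base) :
    ((Presh.baseHom α).comp H).app U V = α.app (op U) ≫ H.app U V :=
  DMod.Hom.ext <| LinearMap.ext fun _ =>
    (congrArg (A.res _).lin (H.naturality_apply (id_meet_le U ⊤) (le_refl V) _)).trans <|
      (A.res_res_apply _ _ _).trans (A.res_self_apply _ _)

theorem Precosh.comp_baseHom_app {N : Precosh.{u} R} {X : Profinite.{u}}
    {F G : Clopens X ⥤ PMod.{u} R} (H : Precosh.Hom N ⟨X, F⟩) (α : F ⟶ G)
    (U : Clopens X) (V : Clopens N.base) :
    (H.comp (Precosh.baseHom α)).app U V = H.app U V ≫ α.app U :=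
  PMod.Hom.ext <| ContinuousLinearMap.ext fun _ =>
    congrArg (α.app U).lin <|
      (H.naturality_apply (id_meet_le U ⊤) (le_refl V) _).symm.trans <|
        congrArg (H.app U V).lin <| (N.cor_cor_apply _ _ _).trans (N.cor_self_apply _ _)

theorem Precosh.baseHom_comp_app {M : Precosh.{u} R} {X : Profinite.{u}}
    {F G : Clopens X ⥤ PMod.{u} R} (α : F ⟶ G) (H : Precosh.Hom ⟨X, G⟩ M)
    (U : Clopens M.base) (V : Clopens X) :
    ((Precosh.baseHom α).comp H).app U V = α.app (clopenPreimage H.f U ⊓ V) ≫ H.app U V :=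
  PMod.Hom.ext <| ContinuousLinearMap.ext fun _ =>
    (congrArg (fun z => (H.app U ⊤).lin ((α.app _).lin z))
      (Precosh.cor_cor_apply ⟨X, F⟩ _ _ _)).trans <|
      (congrArg (H.app U ⊤).lin (natTrans_cor α (meet_mono H.f le_rfl le_top) _)).trans
        (H.app_eq_cor U V _).symm

theorem Presh.baseHom_comp_eq_id {X : Profinite.{u}} {F G : (Clopens X)ᵒᵖ ⥤ DMod.{u} R}
    (α : F ⟶ G) (β : G ⟶ F) (h : α ≫ β = 𝟙 F) :
    (Presh.baseHom α).comp (Presh.baseHom β) = CategoryStruct.id (obj := Presh.{u} R) ⟨X, F⟩ := by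
  refine Presh.Hom.ext_heq rfl fun U V => heq_of_eq ?_
  refine (Presh.baseHom_comp_app α (Presh.baseHom β) U V).trans ?_
  refine DMod.Hom.ext (LinearMap.ext fun s => ?_)
  have h1 : (β.app (op U)).lin ((α.app (op U)).lin s) = s :=
    congrArg (fun g : F ⟶ F => (g.app (op U)).lin s) h
  exact congrArg (Presh.res ⟨X, F⟩ (id_meet_le U V)).lin h1

theorem Precosh.baseHom_comp_eq_id {X : Profinite.{u}} {F G : Clopens X ⥤ PMod.{u} R}
    (α : F ⟶ G) (β : G ⟶ F) (h : α ≫ β = 𝟙 F) :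
    (Precosh.baseHom α).comp (Precosh.baseHom β) =
      CategoryStruct.id (obj := Precosh.{u} R) ⟨X, F⟩ := by
  refine Precosh.Hom.ext_heq rfl fun U V => heq_of_eq ?_
  refine (Precosh.comp_baseHom_app (Precosh.baseHom α) β U V).trans ?_
  refine PMod.Hom.ext (ContinuousLinearMap.ext fun s => ?_)
  exact congrArg (fun g : F ⟶ F => (g.app U).lin ((Precosh.cor ⟨X, F⟩ (id_meet_le U V)).lin s)) h

/-- An isomorphism of presheaves on a fixed space, as an isomorphism over the identity. -/
def Presh.baseIso {X : Profinite.{u}} {F G : (Clopens X)ᵒᵖ ⥤ DMod.{u} R} (α : F ≅ G) :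
    (⟨X, F⟩ : Presh.{u} R) ≅ ⟨X, G⟩ where
  hom := Presh.baseHom α.hom
  inv := Presh.baseHom α.inv
  hom_inv_id := Presh.baseHom_comp_eq_id α.hom α.inv α.hom_inv_id
  inv_hom_id := Presh.baseHom_comp_eq_id α.inv α.hom α.inv_hom_id

/-- An isomorphism of precosheaves on a fixed space, as an isomorphism over the identity. -/
def Precosh.baseIso {X : Profinite.{u}} {F G : Clopens X ⥤ PMod.{u} R} (α : F ≅ G) :
    (⟨X, F⟩ : Precosh.{u} R) ≅ ⟨X, G⟩ where
  hom := Precosh.baseHom α.hom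
  inv := Precosh.baseHom α.inv
  hom_inv_id := Precosh.baseHom_comp_eq_id α.hom α.inv α.hom_inv_id
  inv_hom_id := Precosh.baseHom_comp_eq_id α.inv α.hom α.inv_hom_id

/-- Naturality of morphisms over the identity can be checked on components. -/
theorem Presh.baseHom_naturality {A B : Presh.{u} R} {G : (Clopens A.base)ᵒᵖ ⥤ DMod.{u} R}
    {H : (Clopens B.base)ᵒᵖ ⥤ DMod.{u} R} (α : A.fn ⟶ G) (β : B.fn ⟶ H) (F : Presh.Hom A B)
    (ν : (CategoryTheory.Prod.fst (Clopens A.base) (Clopens B.base)).op ⋙ G ⟶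
      (meetPreimage F.f).op ⋙ H)
    (e : ∀ U V s, (β.app (op (clopenPreimage F.f U ⊓ V))).lin ((F.app U V).lin s) =
      (ν.app (op (U, V))).lin ((α.app (op U)).lin s)) :
    F.comp (Presh.baseHom β) = (Presh.baseHom α).comp (B := ⟨A.base, G⟩) (C := ⟨B.base, H⟩)
      ⟨F.f, ν⟩ :=
  Presh.Hom.ext_heq rfl fun U V => heq_of_eq <|
    (Presh.comp_baseHom_app F β U V).trans <|
      (DMod.Hom.ext (LinearMap.ext fun s => e U V s)).trans
        (Presh.baseHom_comp_app (A := ⟨B.base, H⟩) α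
          (Presh.Hom.mk (A := ⟨A.base, G⟩) (B := ⟨B.base, H⟩) F.f ν) U V).symm

/-- Naturality of morphisms over the identity can be checked on components. -/
theorem Precosh.baseHom_naturality {N M : Precosh.{u} R} {G : Clopens N.base ⥤ PMod.{u} R}
    {H : Clopens M.base ⥤ PMod.{u} R} (α : N.fn ⟶ G) (β : M.fn ⟶ H) (F : Precosh.Hom N M)
    (ν : meetPreimage F.f ⋙ G ⟶
      CategoryTheory.Prod.fst (Clopens M.base) (Clopens N.base) ⋙ H)
    (e : ∀ U V n, (β.app U).lin ((F.app U V).lin n) =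
      (ν.app (U, V)).lin ((α.app (clopenPreimage F.f U ⊓ V)).lin n)) :
    F.comp (Precosh.baseHom β) = (Precosh.baseHom α).comp (M := ⟨N.base, G⟩)
      (L := ⟨M.base, H⟩) ⟨F.f, ν⟩ :=
  Precosh.Hom.ext_heq rfl fun U V => heq_of_eq <|
    (Precosh.comp_baseHom_app F β U V).trans <|
      (PMod.Hom.ext (ContinuousLinearMap.ext fun n => e U V n)).trans
        (Precosh.baseHom_comp_app (M := ⟨M.base, H⟩) α
          (Precosh.Hom.mk (N := ⟨N.base, G⟩) (M := ⟨M.base, H⟩) F.f ν) U V).symm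

end FixedBase

/-! ### Gluing of sections -/

section Gluing

theorem Clopens.exists_finite_subcover {X : Profinite.{u}} {U : Clopens X}
    (V : {x // x ∈ U} → Clopens X) (hxV : ∀ x, x.1 ∈ V x) (hVU : ∀ x, V x ≤ U) :
    ∃ (n : ℕ) (p : Fin n → {x // x ∈ U}), Finset.univ.sup (fun i => V (p i)) = U := by
  obtain ⟨t, ht⟩ := U.isClosed.isCompact.elim_finite_subcover (fun x => (V x : Set X))
    (fun x => (V x).isOpen) fun x hx => Set.mem_iUnion.2 ⟨⟨x, hx⟩, hxV ⟨x, hx⟩⟩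
  refine ⟨t.card, fun i => (t.equivFin.symm i).1, le_antisymm (Finset.sup_le fun i _ => hVU _) ?_⟩
  intro x hx
  obtain ⟨y, hy, hxy⟩ := Set.mem_iUnion₂.1 (ht hx)
  rw [← SetLike.mem_coe, Clopens.coe_finset_sup]
  refine Set.mem_iUnion₂.2 ⟨t.equivFin ⟨y, hy⟩, Finset.mem_univ _, ?_⟩
  simpa using hxy

variable {R : Type u} [Ring R] [TopologicalSpace R]

/-- Separatedness for arbitrary clopen covers of clopen sets, by compactness. -/
theorem Presh.IsSheaf.eq_of_locally_eq {A : Presh.{u} R} (hA : A.IsSheaf) {U : Clopens A.base}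
    {s t : A.fn.obj (op U)} (h : ∀ x ∈ U, ∃ (V : Clopens A.base) (hV : V ≤ U), x ∈ V ∧
      (A.res hV).lin s = (A.res hV).lin t) : s = t := by
  choose V hVU hxV hst using fun x : {x // x ∈ U} => h x.1 x.2
  obtain ⟨n, p, hp⟩ := Clopens.exists_finite_subcover V hxV hVU
  have hUp : U ≤ Finset.univ.sup fun i => V (p i) := hp.ge
  have hpU : (Finset.univ.sup fun i => V (p i)) ≤ U := hp.le
  have key : (A.res hpU).lin s = (A.res hpU).lin t :=
    (hA n fun i => V (p i)).1 <| funext fun i =>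
      (A.res_res_apply _ _ s).trans ((hst (p i)).trans (A.res_res_apply _ _ t).symm)
  have := congrArg (A.res hUp).lin key
  rwa [A.res_res_apply, A.res_res_apply, A.res_self_apply, A.res_self_apply] at this

/-- Gluing for arbitrary clopen covers of clopen sets, by compactness. -/
theorem Presh.IsSheaf.exists_glue {A : Presh.{u} R} (hA : A.IsSheaf) {U : Clopens A.base}
    (V : {x // x ∈ U} → Clopens A.base) (hxV : ∀ x, x.1 ∈ V x) (hVU : ∀ x, V x ≤ U)
    (t : ∀ x, A.fn.obj (op (V x)))
    (ht : ∀ x y, (A.res (inf_le_left : V x ⊓ V y ≤ V x)).lin (t x) =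
      (A.res (inf_le_right : V x ⊓ V y ≤ V y)).lin (t y)) :
    ∃ s : A.fn.obj (op U), ∀ x, (A.res (hVU x)).lin s = t x := by
  obtain ⟨n, p, hp⟩ := Clopens.exists_finite_subcover V hxV hVU
  obtain ⟨s, hs⟩ := ((hA n fun i => V (p i)).2 fun i => t (p i)).1 <| funext fun ij => by
    rw [A.diff_apply]
    exact sub_eq_zero.2 (ht _ _)
  have hUp : U ≤ Finset.univ.sup fun i => V (p i) := hp.ge
  refine ⟨(A.res hUp).lin s, fun x => hA.eq_of_locally_eq fun y hy => ?_⟩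
  have hy' := hUp (hVU x hy)
  rw [← SetLike.mem_coe, Clopens.coe_finset_sup] at hy'
  obtain ⟨i, hi⟩ : ∃ i, y ∈ V (p i) := by simpa using hy'
  refine ⟨V x ⊓ V (p i), inf_le_left, ⟨hy, hi⟩, ?_⟩
  have hsi := congrArg (A.res (inf_le_right : V x ⊓ V (p i) ≤ V (p i))).lin (congrFun hs i)
  rw [A.toProd_apply, A.res_res_apply] at hsi
  rw [A.res_res_apply, A.res_res_apply, ht x (p i), ← hsi]

end Gluing

/-! ### Duality between sheaves and cosheaves -/

section SheafDuality

variable {R : Type u} [Ring R] [TopologicalSpace R] [IsTopologicalRing R] [CompactSpace R]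

/-- The evaluation isomorphism of a presheaf with its double dual. -/
def Presh.evalIso (A : Presh.{u} R) : A ≅ A.dualObj.dualObj :=
  Presh.baseIso (Functor.isoWhiskerLeft A.fn (DMod.doubleDualIso R))

/-- The evaluation isomorphism of a precosheaf with its double dual. -/
def Precosh.evalIso (M : Precosh.{u} R) : M ≅ M.dualObj.dualObj :=
  Precosh.baseIso (Functor.isoWhiskerLeft M.fn (PMod.doubleDualIso R))

theorem Presh.evalIso_naturality {A B : Presh.{u} R} (F : A ⟶ B) :
    F ≫ B.evalIso.hom = A.evalIso.hom ≫ (Precosh.dual R).map ((Presh.dual R).map F.op).op :=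
  Presh.baseHom_naturality (Functor.isoWhiskerLeft A.fn (DMod.doubleDualIso R)).hom
    (Functor.isoWhiskerLeft B.fn (DMod.doubleDualIso R)).hom F
    (Presh.Hom.nat ((Precosh.dual R).map ((Presh.dual R).map F.op).op))
    fun _ _ _ => rfl

theorem Precosh.evalIso_naturality {N M : Precosh.{u} R} (F : N ⟶ M) :
    F ≫ M.evalIso.hom = N.evalIso.hom ≫ (Presh.dual R).map ((Precosh.dual R).map F.op).op :=
  Precosh.baseHom_naturality (Functor.isoWhiskerLeft N.fn (PMod.doubleDualIso R)).hom
    (Functor.isoWhiskerLeft M.fn (PMod.doubleDualIso R)).hom F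
    (Precosh.Hom.nat ((Presh.dual R).map ((Precosh.dual R).map F.op).op))
    fun _ _ _ => rfl

variable (R)

/-- The double dual of sheaves is naturally isomorphic to the identity. -/
def Shf.doubleDualIso : 𝟭 (Shf.{u} R) ≅ (Shf.dual R).rightOp ⋙ CoShf.dual R :=
  NatIso.ofComponents (fun A => ObjectProperty.isoMk _ A.obj.evalIso)
    fun F => ObjectProperty.hom_ext _ (Presh.evalIso_naturality F.hom)

/-- The double dual of cosheaves is naturally isomorphic to the identity. -/
def CoShf.doubleDualIso : 𝟭 (CoShf.{u} R) ≅ (CoShf.dual R).rightOp ⋙ Shf.dual R :=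
  NatIso.ofComponents (fun M => ObjectProperty.isoMk _ M.obj.evalIso)
    fun F => ObjectProperty.hom_ext _ (Precosh.evalIso_naturality F.hom)

/-- Duality between sheaves and cosheaves. -/
def sheafCosheafEquivalence : (Shf.{u} R)ᵒᵖ ≌ CoShf.{u} R :=
  CategoryTheory.Equivalence.mk (Shf.dual R) (CoShf.dual R).rightOp
    (NatIso.op (Shf.doubleDualIso R)).symm (CoShf.doubleDualIso R).symm

end SheafDuality

/-! ### Étale spaces and sheaves -/

section EtaleSheaf

variable {R : Type u} [Ring R] [TopologicalSpace R] [IsTopologicalRing R] [CompactSpace R]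

/-- The value of a point of a total space known to lie over `x`. -/
def Tot.valAt {X : Type u} {E : X → Type u} (q : Tot E) (x : X) (h : q.pt = x) : E x :=
  h ▸ q.val

theorem Tot.mk_valAt {X : Type u} {E : X → Type u} (q : Tot E) (x : X) (h : q.pt = x) :
    (⟨x, q.valAt x h⟩ : Tot E) = q := by
  subst h
  rfl

/-- Every point of an étale space lies on a section over a clopen set: invert the projection
locally. -/
theorem EtaleSp.exists_section (A : EtaleSp.{u} R) (a : Tot A.fibre) :
    ∃ (U : Clopens A.base) (hU : a.pt ∈ U) (s : A.sections (clopenIncl U)),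
      s.1 ⟨a.pt, hU⟩ = a.val := by
  obtain ⟨e, ha, he⟩ := A.isLocalHomeomorph a
  have hx : a.pt ∈ e.target := by
    rw [he]
    exact e.map_source ha
  obtain ⟨U, hU, haU, hUe⟩ := compact_exists_isClopen_in_isOpen e.open_target hx
  have hpt : ∀ x (hx : x ∈ U), (e.symm x).pt = x := fun x hx =>
    (congrFun he _).trans (e.right_inv (hUe hx))
  refine ⟨⟨U, hU⟩, haU, ⟨fun x => (e.symm x.1).valAt x.1 (hpt x.1 x.2), ?_⟩, ?_⟩
  · refine Continuous.congr (f := fun x : U => e.symm x.1) ?_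
      fun x => (Tot.mk_valAt _ x.1 (hpt x.1 x.2)).symm
    exact e.symm.continuousOn.comp_continuous continuous_subtype_val fun x => hUe x.2
  · have h1 : e.symm a.pt = a := by
      rw [he]
      exact e.left_inv ha
    have h2 := (Tot.mk_valAt _ a.pt (hpt a.pt haU)).trans h1
    obtain ⟨x, v⟩ := a
    simp only [Tot.mk.injEq] at h2
    exact eq_of_heq h2.2

/-- Sections of a local homeomorphism which agree at a point agree nearby. -/
theorem EtaleSp.sections_eventually_eq (A : EtaleSp.{u} R) {U : Clopens A.base}
    (s t : A.sections (clopenIncl U)) {x : A.base} (hx : x ∈ U) (h : s.1 ⟨x, hx⟩ = t.1 ⟨x, hx⟩) :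
    ∃ (V : Clopens A.base) (hV : V ≤ U), x ∈ V ∧ ∀ y (hy : y ∈ V),
      s.1 ⟨y, hV hy⟩ = t.1 ⟨y, hV hy⟩ := by
  obtain ⟨O, hO, hxO, hinj⟩ := A.isLocalHomeomorph.isLocallyInjective ⟨x, s.1 ⟨x, hx⟩⟩
  have hxO' : (⟨x, t.1 ⟨x, hx⟩⟩ : Tot A.fibre) ∈ O := h ▸ hxO
  have hW := (hO.preimage s.2).inter (hO.preimage t.2)
  obtain ⟨W, hW1, hW2⟩ := isOpen_induced_iff.1 hW
  have hxW : x ∈ W ∩ U := ⟨(Set.ext_iff.1 hW2 ⟨x, hx⟩).2 ⟨hxO, hxO'⟩, hx⟩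
  obtain ⟨V, hV, hxV, hVW⟩ := compact_exists_isClopen_in_isOpen (hW1.inter U.isOpen) hxW
  refine ⟨⟨V, hV⟩, fun y hy => (hVW hy).2, hxV, fun y hy => ?_⟩
  obtain ⟨h1, h2⟩ := (Set.ext_iff.1 hW2 ⟨y, (hVW hy).2⟩).1 (hVW hy).1
  have := hinj h1 h2 rfl
  simp only [Tot.mk.injEq] at this
  exact eq_of_heq this.2

/-- The stalk at a point of `A.base`, which is the base of `A.toPreshObj` only up to unfolding. -/
instance (A : EtaleSp.{u} R) (x : A.base) : AddCommGroup (Presh.stalk A.toPreshObj x) :=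
  inferInstanceAs (AddCommGroup (Presh.stalk A.toPreshObj (show A.toPreshObj.base from x)))

instance (A : EtaleSp.{u} R) (x : A.base) : Module Rᵐᵒᵖ (Presh.stalk A.toPreshObj x) :=
  inferInstanceAs (Module Rᵐᵒᵖ (Presh.stalk A.toPreshObj (show A.toPreshObj.base from x)))

/-- The map from the stalks of the sheaf of sections to the fibres which evaluates sections. -/
def EtaleSp.stalkValue (A : EtaleSp.{u} R) (x : A.base) :
    A.toPreshObj.stalk x →ₗ[Rᵐᵒᵖ] A.fibre x :=
  A.toPreshObj.stalkLift (P := A.fibre x) x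
    (fun (U : Clopens A.base) hx =>
      ({ toFun := fun s => s.1 ⟨x, hx⟩
         map_add' := fun _ _ => rfl
         map_smul' := fun _ _ => rfl } : A.sections (clopenIncl U) →ₗ[Rᵐᵒᵖ] A.fibre x))
    fun _ _ _ _ _ => rfl

theorem EtaleSp.stalkValue_germ (A : EtaleSp.{u} R) (x : A.base) (U : Clopens A.base) (hx : x ∈ U)
    (s : A.sections (clopenIncl U)) :
    A.stalkValue x (A.toPreshObj.germ U x hx s) = s.1 ⟨x, hx⟩ :=
  A.toPreshObj.stalkLift_germ (P := A.fibre x) x _ _ U hx s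

theorem EtaleSp.stalkValue_bijective (A : EtaleSp.{u} R) (x : A.base) :
    Function.Bijective (A.stalkValue x) := by
  constructor
  · refine (injective_iff_map_eq_zero _).2 fun a ha => ?_
    obtain ⟨U, hx, s, rfl⟩ := A.toPreshObj.exists_germ x a
    obtain ⟨V, hV, hxV, h⟩ := A.sections_eventually_eq s 0 hx
      ((A.stalkValue_germ x U hx s).symm.trans ha)
    rw [← A.toPreshObj.germ_res hV x hxV,
      show (A.toPreshObj.res hV).lin s = 0 from Subtype.ext (funext fun y => h y.1 y.2), map_zero]
  · intro a
    obtain ⟨U, hx, s, hs⟩ := A.exists_section ⟨x, a⟩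
    exact ⟨_, (A.stalkValue_germ x U hx s).trans hs⟩

/-- The map `⨆ₓ Aₓ → 𝒜` from the étale space of the sheaf of sections. -/
def EtaleSp.totValue (A : EtaleSp.{u} R) (q : Tot A.toPreshObj.stalk) : Tot A.fibre :=
  ⟨q.pt, A.stalkValue q.pt q.val⟩

theorem EtaleSp.continuous_totValue (A : EtaleSp.{u} R) : Continuous A.totValue := by
  refine continuous_iff_continuousAt.2 fun ⟨x, a⟩ => ?_
  obtain ⟨U, hx, s, rfl⟩ := A.toPreshObj.exists_germ x a
  have hO := A.toPreshObj.isOpen_germSet U s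
  refine (hO.isOpenEmbedding_subtypeVal.continuousAt_iff
    (x := ⟨_, A.toPreshObj.mk_mem_germSet U x hx s⟩)).1 ?_
  have h1 : Continuous fun q : A.toPreshObj.germSet U s =>
      (⟨q.1.pt, s.1 ⟨q.1.pt, q.2.1⟩⟩ : Tot A.fibre) :=
    Continuous.comp s.2 (Continuous.subtype_mk
      (A.toPreshObj.continuous_pt.comp continuous_subtype_val) fun q => q.2.1)
  refine h1.continuousAt.congr (Filter.Eventually.of_forall fun q => ?_)
  exact congrArg (Tot.mk q.1.pt) ((A.stalkValue_germ q.1.pt U q.2.1 s).symm.trans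
    (congrArg (A.stalkValue q.1.pt) q.2.2))

/-- Both spaces are local homeomorphisms over the base, hence so is the map between them. -/
theorem EtaleSp.isHomeomorph_totValue (A : EtaleSp.{u} R) : IsHomeomorph A.totValue where
  continuous := A.continuous_totValue
  isOpenMap := (IsLocalHomeomorph.of_comp (g := (Tot.pt : Tot A.fibre → A.base))
    A.toPreshObj.isLocalHomeomorph_pt A.isLocalHomeomorph A.continuous_totValue).isOpenMap
  bijective := by
    constructor
    · rintro ⟨x, a⟩ ⟨y, b⟩ h
      obtain rfl : x = y := congrArg Tot.pt h
      exact congrArg (Tot.mk x) ((A.stalkValue_bijective x).1 (eq_of_heq (Tot.ext_iff.1 h).2))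
    · rintro ⟨x, a⟩
      obtain ⟨b, rfl⟩ := (A.stalkValue_bijective x).2 a
      exact ⟨⟨x, b⟩, rfl⟩

/-- The linear equivalences of the stalks of the sheaf of sections with the fibres. -/
def EtaleSp.stalkEquiv (A : EtaleSp.{u} R) (x : A.base) :
    A.toPreshObj.stalk x ≃ₗ[Rᵐᵒᵖ] A.fibre x :=
  LinearEquiv.ofBijective _ (A.stalkValue_bijective x)

/-- The inverse of the evaluation of sections. -/
def EtaleSp.stalkInv (A : EtaleSp.{u} R) (x : A.base) :
    A.fibre x →ₗ[Rᵐᵒᵖ] A.toPreshObj.stalk x :=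
  (A.stalkEquiv x).symm.toLinearMap

theorem EtaleSp.stalkInv_stalkValue (A : EtaleSp.{u} R) (x : A.base) (a : A.toPreshObj.stalk x) :
    A.stalkInv x (A.stalkValue x a) = a :=
  (A.stalkEquiv x).symm_apply_apply a

theorem EtaleSp.stalkValue_stalkInv (A : EtaleSp.{u} R) (x : A.base) (a : A.fibre x) :
    A.stalkValue x (A.stalkInv x a) = a :=
  (A.stalkEquiv x).apply_symm_apply a

theorem EtaleSp.continuous_stalkInv (A : EtaleSp.{u} R) :
    Continuous fun q : Tot A.fibre => (⟨q.pt, A.stalkInv q.pt q.val⟩ :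
      Tot A.toPreshObj.stalk) := by
  convert (A.isHomeomorph_totValue.homeomorph).symm.continuous using 1
  refine funext fun q => ((Homeomorph.symm_apply_eq _).2 ?_).symm
  exact congrArg (Tot.mk q.pt) (A.stalkValue_stalkInv q.pt q.val).symm

/-- The morphism to an étale space from the étale space of its sheaf of sections. -/
def EtaleSp.valueHom (A : EtaleSp.{u} R) : EtaleSp.Hom A.toPreshObj.toEtaleObj A where
  f := ContinuousMap.id A.base
  φ := A.stalkValue
  continuous_φ := A.continuous_totValue.comp
    (continuous_pull_val A.toPreshObj.stalk (ContinuousMap.id A.toPreshObj.base))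

/-- The morphism from an étale space to the étale space of its sheaf of sections. -/
def EtaleSp.valueInv (A : EtaleSp.{u} R) : EtaleSp.Hom A A.toPreshObj.toEtaleObj where
  f := ContinuousMap.id A.base
  φ := A.stalkInv
  continuous_φ := A.continuous_stalkInv.comp
    (continuous_pull_val A.fibre (ContinuousMap.id A.base))

/-- An étale space is isomorphic to the étale space of its sheaf of sections. -/
def EtaleSp.valueIso (A : EtaleSp.{u} R) : A.toPreshObj.toEtaleObj ≅ A where
  hom := A.valueHom
  inv := A.valueInv
  hom_inv_id := EtaleSp.Hom.ext rfl <| heq_of_eq <| funext fun x => LinearMap.ext fun a =>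
    A.stalkInv_stalkValue x a
  inv_hom_id := EtaleSp.Hom.ext rfl <| heq_of_eq <| funext fun x => LinearMap.ext fun a =>
    A.stalkValue_stalkInv x a

theorem EtaleSp.valueIso_naturality {A B : EtaleSp.{u} R} (F : A ⟶ B) :
    (Presh.toEtale R).map ((EtaleSp.toPresh R).map F) ≫ B.valueIso.hom =
      A.valueIso.hom ≫ F := by
  refine EtaleSp.Hom.ext rfl (heq_of_eq (funext fun y => ?_))
  refine LinearMap.ext fun a => ?_
  obtain ⟨U, hx, s, rfl⟩ := A.toPreshObj.exists_germ _ a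
  refine (congrArg (B.stalkValue y)
    (Presh.Hom.stalk_germ ((EtaleSp.toPresh R).map F) y U hx s)).trans ?_
  refine (B.stalkValue_germ y _ _ _).trans ?_
  exact congrArg (EtaleSp.Hom.φ F y) (A.stalkValue_germ _ U hx s).symm

variable (R) in
/-- Passing to sections and back to the étale space is naturally isomorphic to the identity. -/
def EtaleSp.sectionsIso : EtaleSp.toShf R ⋙ Shf.toEtale R ≅ 𝟭 (EtaleSp.{u} R) :=
  NatIso.ofComponents EtaleSp.valueIso EtaleSp.valueIso_naturality

/-- The section `x ↦ sₓ` of the étale space of a presheaf given by an element `s` of `A(U)`. -/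
def Presh.germSection (A : Presh.{u} R) (U : Clopens A.base) :
    A.fn.obj (op U) →ₗ[Rᵐᵒᵖ] A.toEtaleObj.sections (clopenIncl (X := A.base) U) where
  toFun s := ⟨fun x => A.germ U x.1 x.2 s, by
    refine continuous_generateFrom_iff.2 ?_
    rintro _ ⟨V, t, rfl⟩
    rw [isOpen_iff_mem_nhds]
    intro x hx
    obtain ⟨W, h1, hxW, hW⟩ := A.exists_res_of_mem x.2 hx
    refine Filter.mem_of_superset ((W.isOpen.preimage continuous_subtype_val).mem_nhds hxW)
      fun y hy => hW ⟨hy, A.germ_res h1 _ hy s⟩⟩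
  map_add' s t := Subtype.ext <| funext fun x => map_add (A.germ U x.1 x.2) s t
  map_smul' r s := Subtype.ext <| funext fun x => map_smul (A.germ U x.1 x.2) r s

theorem Presh.IsSheaf.germSection_injective {A : Presh.{u} R} (hA : A.IsSheaf)
    (U : Clopens A.base) : Function.Injective (A.germSection U) := by
  intro s t h
  refine hA.eq_of_locally_eq fun x hx => ?_
  obtain ⟨W, h1, h2, hxW, hst⟩ := A.germ_eq hx hx s t
    (congrFun (congrArg Subtype.val h) (⟨x, hx⟩ : U))
  exact ⟨W, h1, hxW, hst⟩

theorem Presh.IsSheaf.germSection_surjective {A : Presh.{u} R} (hA : A.IsSheaf)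
    (U : Clopens A.base) : Function.Surjective (A.germSection U) := by
  intro σ
  have hloc : ∀ x : {x // x ∈ U}, ∃ (V : Clopens A.base) (_ : x.1 ∈ V) (hVU : V ≤ U)
      (t : A.fn.obj (op V)), ∀ y (hy : y ∈ V), A.germ V y hy t = σ.1 ⟨y, hVU hy⟩ := by
    intro x
    obtain ⟨W, hxW, t, ht⟩ := A.exists_germ x.1 (σ.1 x)
    have hO := (A.isOpen_germSet W t).preimage σ.2
    obtain ⟨O, hO1, hO2⟩ := isOpen_induced_iff.1 hO
    have hxO : x.1 ∈ O ∩ U := ⟨(Set.ext_iff.1 hO2 x).2 ⟨hxW, ht⟩, x.2⟩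
    obtain ⟨V, hV, hxV, hVO⟩ := compact_exists_isClopen_in_isOpen (hO1.inter U.isOpen) hxO
    have hmem : ∀ y (hy : y ∈ V), ∃ h : y ∈ W, A.germ W y h t = σ.1 ⟨y, (hVO hy).2⟩ :=
      fun y hy => (Set.ext_iff.1 hO2 ⟨y, (hVO hy).2⟩).1 (hVO hy).1
    have hVW : (⟨V, hV⟩ : Clopens A.base) ≤ W := fun y hy => (hmem y hy).1
    refine ⟨⟨V, hV⟩, hxV, fun y hy => (hVO hy).2, (A.res hVW).lin t, fun y hy => ?_⟩
    rw [A.germ_res]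
    exact (hmem y hy).2
  -- The local sections agree on overlaps, since a section is determined by its germs.
  choose V hxV hVU t ht using hloc
  obtain ⟨s, hs⟩ := hA.exists_glue V hxV hVU t fun x y => by
    refine hA.germSection_injective _ (Subtype.ext (funext fun z => ?_))
    change A.germ _ z.1 z.2 _ = A.germ _ z.1 z.2 _
    rw [A.germ_res, A.germ_res, ht, ht]
  refine ⟨s, Subtype.ext (funext fun x => ?_)⟩
  change A.germ U x.1 x.2 s = _
  have := hs x
  rw [← A.germ_res (hVU x) x.1 (hxV x) s, hs x, ht]

/-- A sheaf is isomorphic to the sheaf of sections of its étale space. -/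
def Presh.IsSheaf.germIso {A : Presh.{u} R} (hA : A.IsSheaf) : A ≅ A.toEtaleObj.toPreshObj :=
  Presh.baseIso (NatIso.ofComponents (fun U => DMod.isoOfBijective
    (B := A.toEtaleObj.toPreshObj.fn.obj U) (A.germSection U.unop)
      ⟨hA.germSection_injective _, hA.germSection_surjective _⟩)
    fun {_ _} h => DMod.Hom.ext <| LinearMap.ext fun s => Subtype.ext <| funext fun x =>
      A.germ_res (leOfHom h.unop) x.1 x.2 s)

theorem Presh.IsSheaf.germIso_naturality {A B : Presh.{u} R} (hA : A.IsSheaf) (hB : B.IsSheaf)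
    (F : A ⟶ B) :
    F ≫ hB.germIso.hom = hA.germIso.hom ≫ (EtaleSp.toPresh R).map ((Presh.toEtale R).map F) :=
  Presh.baseHom_naturality (A := A) (B := B) (G := A.toEtaleObj.toPreshObj.fn)
    (H := B.toEtaleObj.toPreshObj.fn)
    _ _ F (Presh.Hom.nat ((EtaleSp.toPresh R).map ((Presh.toEtale R).map F)))
    fun U V s => Subtype.ext <| funext fun y => by
      refine (congrArg (B.germ _ y.1 y.2) (Presh.Hom.app_eq_res F U V s)).trans ?_
      refine (B.germ_res _ y.1 y.2 _).trans ?_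
      exact (Presh.Hom.stalk_germ F y.1 U y.2.1 s).symm

variable (R) in
/-- Passing to the étale space and back to sections is naturally isomorphic to the identity. -/
def Shf.germIso : 𝟭 (Shf.{u} R) ≅ Shf.toEtale R ⋙ EtaleSp.toShf R :=
  NatIso.ofComponents (fun A => ObjectProperty.isoMk _ A.property.germIso)
    fun {A B} F => ObjectProperty.hom_ext _ (A.property.germIso_naturality B.property F.hom)

variable (R) in
/-- Étale spaces are equivalent to sheaves. -/
def etaleSheafEquivalence : (EtaleSp.{u} R)ᵒᵖ ≌ (Shf.{u} R)ᵒᵖ :=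
  CategoryTheory.Equivalence.mk (EtaleSp.toShf R).op (Shf.toEtale R).op
    (NatIso.op (EtaleSp.sectionsIso R)) (NatIso.op (Shf.germIso R))

end EtaleSheaf

/-! ### Families of profinite modules near a fibre -/

section Fibres

/-- The tube lemma for a map from a compact space to a profinite space. -/
theorem exists_clopen_preimage_subset {X : Profinite.{u}} {T : Type v} [TopologicalSpace T]
    [CompactSpace T] {p : T → X} (hp : Continuous p) {O : Set T} (hO : IsOpen O) {x : X}
    (hx : ∀ t, p t = x → t ∈ O) : ∃ U : Clopens X, x ∈ U ∧ ∀ t, p t ∈ U → t ∈ O := by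
  have hcl : IsClosed (p '' Oᶜ) := (hO.isClosed_compl.isCompact.image hp).isClosed
  have hxn : x ∈ (p '' Oᶜ)ᶜ := by
    rintro ⟨t, ht, h⟩
    exact ht (hx t h)
  obtain ⟨V, hV, hxV, hVO⟩ := compact_exists_isClopen_in_isOpen hcl.isOpen_compl hxn
  exact ⟨⟨V, hV⟩, hxV, fun t ht => by_contra fun hn => hVO ht ⟨t, hn, rfl⟩⟩

variable {R : Type u} [Ring R] [TopologicalSpace R]

theorem FibProd.isClosedEmbedding {X : Profinite.{u}} {E : X → Type u} [TopologicalSpace (Tot E)]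
    (h : Continuous (Tot.pt : Tot E → X)) : Topology.IsClosedEmbedding fun q : FibProd E =>
      ((⟨q.pt, q.fst⟩, ⟨q.pt, q.snd⟩) : Tot E × Tot E) where
  eq_induced := rfl
  injective := by
    rintro ⟨x, a, b⟩ ⟨y, c, d⟩ h
    simp only [Prod.mk.injEq, Tot.mk.injEq] at h
    obtain ⟨⟨rfl, h1⟩, -, h2⟩ := h
    rw [eq_of_heq h1, eq_of_heq h2]
  isClosed_range := by
    convert isClosed_eq (h.comp continuous_fst) (h.comp continuous_snd) using 1
    ext ⟨⟨x, a⟩, ⟨y, b⟩⟩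
    constructor
    · rintro ⟨q, hq⟩
      exact (congrArg (fun z => z.1.pt) hq).symm.trans (congrArg (fun z => z.2.pt) hq)
    · rintro (rfl : x = y)
      exact ⟨⟨x, a, b⟩, rfl⟩

/-- The topology of a fibre as a subspace of the total space. -/
instance PShf.fibreTopology (M : PShf.{u} R) (x : M.base) : TopologicalSpace (M.fibre x) :=
  TopologicalSpace.induced (Tot.mk x) inferInstance

theorem PShf.isClosedEmbedding_mk (M : PShf.{u} R) (x : M.base) :
    Topology.IsClosedEmbedding (Tot.mk x : M.fibre x → Tot M.fibre) where
  eq_induced := rfl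
  injective a b h := eq_of_heq (Tot.ext_iff.1 h).2
  isClosed_range := by
    convert (isClosed_singleton (x := x)).preimage M.continuous_pt using 1
    ext ⟨y, a⟩
    constructor
    · rintro ⟨b, hb⟩
      exact (congrArg Tot.pt hb).symm
    · rintro (rfl : y = x)
      exact ⟨a, rfl⟩

theorem PShf.continuous_mk (M : PShf.{u} R) (x : M.base) :
    Continuous (Tot.mk x : M.fibre x → Tot M.fibre) :=
  (M.isClosedEmbedding_mk x).continuous

/-- A fibre as a profinite module. -/
def PShf.fibreMod (M : PShf.{u} R) (x : M.base) : PMod.{u} R :=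
  have hi := (M.isClosedEmbedding_mk x).isEmbedding
  have hsmul : ContinuousSMul R (M.fibre x) := ⟨hi.continuous_iff.2 <|
    M.continuous_smul.comp (continuous_fst.prodMk (hi.continuous.comp continuous_snd))⟩
  have hadd : ContinuousAdd (M.fibre x) := ⟨hi.continuous_iff.2 <| M.continuous_add.comp <|
    continuous_fibProd_mk M.fibre (hi.continuous.comp continuous_fst)
      (hi.continuous.comp continuous_snd)⟩
  { carrier := M.fibre x
    isTopologicalAddGroup :=
      { continuous_neg := (continuous_const_smul (-1 : R)).congr fun a => neg_one_smul R a }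
    compactSpace := (M.isClosedEmbedding_mk x).compactSpace
    t2Space := hi.t2Space
    totallyDisconnectedSpace :=
      hi.isTotallyDisconnected_range.1 (isTotallyDisconnected_of_totallyDisconnectedSpace _) }

theorem PShf.continuous_comp_mk (M : PShf.{u} R) (x : M.base) {T : Type v} [TopologicalSpace T]
    {g : Tot M.fibre → T} (hg : Continuous g) : Continuous fun m : M.fibreMod x => g ⟨x, m⟩ :=
  hg.comp (M.continuous_mk x)

theorem PShf.continuous_comp_restrictIncl (M : PShf.{u} R) (U : Clopens M.base) {T : Type v}
    [TopologicalSpace T] {g : Tot M.fibre → T} (hg : Continuous g) :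
    Continuous fun q : Tot (M.restrict U).fibre => g (M.restrictIncl U q) :=
  hg.comp (M.continuous_restrictIncl U)

/-- A continuous linear map from a fibre to a finite discrete module extends to a continuous
fibrewise linear map on a neighbourhood of the fibre: it extends to a continuous map, and the
points where this extension is additive and linear form open sets. -/
theorem PShf.exists_extension [CompactSpace R] (M : PShf.{u} R) (x : M.base) {F : PMod.{u} R}
    [DiscreteTopology F] (g : M.fibreMod x ⟶ F) :
    ∃ (U : Clopens M.base) (hx : x ∈ U) (β : (M.restrict U).HomTo F),
      ∀ m : M.fibre x, β.map (⟨x, hx⟩ : U) m = g.lin m := by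
  have hfin : Finite F := finite_of_compact_of_discrete
  have hcs : CompactSpace (M.fibre x) := (M.isClosedEmbedding_mk x).compactSpace
  obtain ⟨G, hG, -, hGg⟩ := Profinite.exists_lift_of_finite_of_injective_of_surjective
    (Tot.mk x : M.fibre x → Tot M.fibre) (M.continuous_mk x)
    (M.isClosedEmbedding_mk x).injective (fun _ : F => PUnit.unit.{1}) (fun _ => ⟨0, rfl⟩)
    (fun m : M.fibre x => g.lin m) g.lin.continuous (fun _ => PUnit.unit) continuous_const rfl
  have hGx : ∀ m : M.fibre x, G ⟨x, m⟩ = g.lin m := fun m => congrFun hGg m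
  have hcompact : CompactSpace (FibProd M.fibre) :=
    (FibProd.isClosedEmbedding M.continuous_pt).compactSpace
  have hpq : Continuous fun q : FibProd M.fibre =>
      ((⟨q.pt, q.fst⟩, ⟨q.pt, q.snd⟩) : Tot M.fibre × Tot M.fibre) := continuous_induced_dom
  obtain ⟨U₁, hxU₁, hU₁⟩ := exists_clopen_preimage_subset (x := x)
    (p := fun q : FibProd M.fibre => q.pt) (M.continuous_pt.comp (continuous_fst.comp hpq))
    (O := {q | G ⟨q.pt, q.fst + q.snd⟩ = G ⟨q.pt, q.fst⟩ + G ⟨q.pt, q.snd⟩})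
    ((isOpen_discrete {z : F × F | z.1 = z.2}).preimage ((hG.comp M.continuous_add).prodMk
      ((hG.comp (continuous_fst.comp hpq)).add (hG.comp (continuous_snd.comp hpq)))))
    (by
      rintro ⟨_, a, b⟩ rfl
      change G _ = G _ + G _
      rw [hGx, hGx, hGx]
      exact map_add g.lin _ _)
  obtain ⟨U₂, hxU₂, hU₂⟩ := exists_clopen_preimage_subset (x := x)
    (p := fun q : R × Tot M.fibre => q.2.pt) (M.continuous_pt.comp continuous_snd)
    (O := {q | G ⟨q.2.pt, q.1 • q.2.val⟩ = q.1 • G q.2})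
    ((isOpen_discrete {z : F × F | z.1 = z.2}).preimage ((hG.comp M.continuous_smul).prodMk
      (continuous_fst.smul (hG.comp continuous_snd))))
    (by
      rintro ⟨r, _, a⟩ rfl
      change G _ = r • G _
      rw [hGx, hGx]
      exact map_smul g.lin _ _)
  refine ⟨U₁ ⊓ U₂, ⟨hxU₁, hxU₂⟩,
    { map := fun y =>
        { toFun := fun m => G ⟨Subtype.val (p := fun y => y ∈ U₁ ⊓ U₂) y, m⟩
          map_add' := fun a b => hU₁ ⟨_, a, b⟩ (Subtype.property (p := fun y => y ∈ U₁ ⊓ U₂) y).1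
          map_smul' := fun r a =>
            hU₂ (r, ⟨_, a⟩) (Subtype.property (p := fun y => y ∈ U₁ ⊓ U₂) y).2 }
      continuous_map := hG.comp (M.continuous_restrictIncl _) }, hGx⟩

end Fibres

/-! ### A family of profinite modules is recovered from its cosheaf -/

section FamilyUnit

variable {R : Type u} [Ring R] [TopologicalSpace R] [IsTopologicalRing R] [CompactSpace R]

theorem PShf.isOpen_image_restrictIncl (M : PShf.{u} R) (U : Clopens M.base)
    {O : Set (Tot (M.restrictFibre U))} (hO : IsOpen O) : IsOpen (M.restrictIncl U '' O) := by
  refine (Topology.IsOpenEmbedding.mk (M.isClosedEmbedding_restrictIncl U).isEmbedding ?_).isOpenMap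
    O hO
  convert U.isOpen.preimage M.continuous_pt using 1
  ext q
  constructor
  · rintro ⟨q, rfl⟩
    exact q.pt.2
  · intro hq
    exact ⟨⟨⟨q.pt, hq⟩, q.val⟩, rfl⟩

/-- The module at a point of `M.base`, which is the base of `M.toPrecoshObj` only up to
unfolding. -/
instance (M : PShf.{u} R) (x : M.base) : AddCommGroup (Precosh.costalk M.toPrecoshObj x) :=
  inferInstanceAs (AddCommGroup (Precosh.costalk M.toPrecoshObj (show M.toPrecoshObj.base from x)))

instance (M : PShf.{u} R) (x : M.base) : Module R (Precosh.costalk M.toPrecoshObj x) :=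
  inferInstanceAs (Module R (Precosh.costalk M.toPrecoshObj (show M.toPrecoshObj.base from x)))

/-- The map from a fibre `M_x` to the inverse limit of the modules `⊞_{u ∈ U} M_u`. -/
def PShf.toCostalk (M : PShf.{u} R) (x : M.base) : M.fibre x →ₗ[R] M.toPrecoshObj.costalk x where
  toFun m := M.toPrecoshObj.costalkMk x (fun U hx => M.ωU U x hx m)
    fun _ _ h hx => M.cor_ωU h x hx m
  map_add' a b := M.toPrecoshObj.costalk_ext fun U hx => map_add (M.ωU U x hx) a b
  map_smul' r a := M.toPrecoshObj.costalk_ext fun U hx => map_smul (M.ωU U x hx) r a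

theorem PShf.proj_toCostalk (M : PShf.{u} R) (x : M.base) (m : M.fibre x) (U : Clopens M.base)
    (hx : x ∈ U) : M.toPrecoshObj.proj U x hx (M.toCostalk x m) = M.ωU U x hx m :=
  rfl

/-- An element `m ≠ 0` of `M_x` survives in a finite quotient of `M_x`, and the quotient map extends
to `⊞_{u ∈ U} M_u` for a neighbourhood `U` of `x`. -/
theorem PShf.toCostalk_injective (M : PShf.{u} R) (x : M.base) :
    Function.Injective (M.toCostalk x) := by
  refine (injective_iff_map_eq_zero _).2 fun m hm => ?_
  by_contra hne
  obtain ⟨L, hL, hLV⟩ := (M.fibreMod x).exists_openSubmodule (V := {(m : M.fibreMod x)}ᶜ)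
    isOpen_compl_singleton (fun h => hne (Set.mem_singleton_iff.1 h).symm)
  have hdisc : DiscreteTopology ((M.fibreMod x).openQuotient L hL) :=
    QuotientAddGroup.discreteTopology (N := L.toAddSubgroup) hL
  obtain ⟨U, hx, β, hβ⟩ := M.exists_extension x ((M.fibreMod x).openQuotientMap L hL)
  have h1 : M.ωU U x hx m = 0 := by
    rw [← M.proj_toCostalk, hm, map_zero]
  have h2 : β.map (⟨x, hx⟩ : U) m = 0 :=
    (β.lift_apply (⟨x, hx⟩ : U) m).symm.trans ((congrArg β.lift.lin h1).trans (map_zero _))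
  exact hLV (((M.fibreMod x).openQuotientMap_eq_zero L hL m).1 ((hβ m).symm.trans h2)) rfl

theorem PShf.continuous_ωU (M : PShf.{u} R) (U : Clopens M.base) (x : M.base) (hx : x ∈ U) :
    Continuous fun m : M.fibre x => M.ωU U x hx m :=
  (M.restrict U).ω.continuous_map.comp (continuous_induced_rng.2 (M.continuous_mk x) :
    Continuous fun m : M.fibre x => (⟨(⟨x, hx⟩ : U), m⟩ : Tot (M.restrictFibre U)))

/-- The image of a point of the inverse limit in `⊞_{u ∈ U} M_u` lies in the image of `M_x`: modulo
an open submodule, the image of a small neighbourhood of `M_x` is contained in that of `M_x`. -/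
theorem PShf.exists_ωU_eq (M : PShf.{u} R) (x : M.base) (c : M.toPrecoshObj.costalk x)
    (U : Clopens M.base) (hx : x ∈ U) :
    ∃ m : M.fibre x, M.ωU U x hx m = M.toPrecoshObj.proj U x hx c := by
  have hcs : CompactSpace (M.fibre x) := (M.isClosedEmbedding_mk x).compactSpace
  by_contra hne
  obtain ⟨L, hL, hDL, hcL⟩ := (M.toPrecoshObj.fn.obj U).exists_open_separating
    (LinearMap.range (M.ωU U x hx)) (isCompact_range (M.continuous_ωU U x hx)).isClosed hne
  obtain ⟨V, hxV, hV⟩ := exists_clopen_preimage_subset (X := M.base) (x := x)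
    (T := Tot (M.restrict U).fibre) (p := fun q => Subtype.val (p := fun y => y ∈ U) q.pt)
    (continuous_subtype_val.comp (M.restrict U).continuous_pt)
    (hL.preimage (M.restrict U).ω.continuous_map) (by
      rintro ⟨⟨y, hy⟩, a⟩ h
      obtain rfl : y = x := h
      exact hDL ⟨a, rfl⟩)
  have htop : L.comap (M.toPrecoshObj.cor (inf_le_right : V ⊓ U ≤ U)).lin.toLinearMap = ⊤ := by
    refine PShf.eq_top_of_closed (M.restrict (V ⊓ U)) _ ?_ fun y a => ?_
    · exact (L.toAddSubgroup.isClosed_of_isOpen hL).preimage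
        (M.toPrecoshObj.cor (inf_le_right : V ⊓ U ≤ U)).lin.continuous
    · have hy : y.1 ∈ V ⊓ U := y.2
      have e := M.cor_ωU (inf_le_right : V ⊓ U ≤ U) y.1 hy a
      have h : M.ωU U y.1 hy.2 a ∈ L := hV ⟨⟨y.1, hy.2⟩, a⟩ hy.1
      exact (congrArg (fun z => z ∈ L) e).mpr h
  refine hcL ?_
  have e := M.toPrecoshObj.cor_proj (inf_le_right : V ⊓ U ≤ U) x ⟨hxV, hx⟩ c
  exact (congrArg (fun z => z ∈ L) e).mp
    (htop.ge (trivial : M.toPrecoshObj.proj (V ⊓ U) x ⟨hxV, hx⟩ c ∈ (⊤ : Submodule R _)))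

/-- A point `c` of the inverse limit comes from `M_x`: the elements of `M_x` with the same image in
`⊞_{u ∈ U} M_u` as `c` form a directed family of nonempty compact sets. -/
theorem PShf.toCostalk_surjective (M : PShf.{u} R) (x : M.base) :
    Function.Surjective (M.toCostalk x) := by
  intro c
  have hcs : CompactSpace (M.fibre x) := (M.isClosedEmbedding_mk x).compactSpace
  let S : {U : Clopens M.base // x ∈ U} → Set (M.fibre x) := fun U =>
    {m | M.ωU U.1 x U.2 m = M.toPrecoshObj.proj U.1 x U.2 c}
  have hS : ∀ U, IsClosed (S U) := fun U =>
    (isClosed_singleton (x := M.toPrecoshObj.proj U.1 x U.2 c)).preimage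
      (M.continuous_ωU U.1 x U.2)
  have hmono : ∀ U V : {U : Clopens M.base // x ∈ U}, U.1 ≤ V.1 → S U ⊆ S V := by
    intro U V h m hm
    change _ = _ at hm
    change _ = _
    rw [← M.cor_ωU h x U.2, ← M.toPrecoshObj.cor_proj h x U.2, hm]
  have hne : Nonempty {U : Clopens M.base // x ∈ U} := ⟨⟨⊤, clopens_mem_top x⟩⟩
  obtain ⟨m, hm⟩ := IsCompact.nonempty_iInter_of_directed_nonempty_isCompact_isClosed S
    (fun U V => ⟨⟨U.1 ⊓ V.1, U.2, V.2⟩, hmono _ _ inf_le_left, hmono _ _ inf_le_right⟩)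
    (fun U => M.exists_ωU_eq x c U.1 U.2) (fun U => (hS U).isCompact) hS
  exact ⟨m, M.toPrecoshObj.costalk_ext fun U hx => Set.mem_iInter.1 hm ⟨U, hx⟩⟩

/-- The map from a family of profinite modules to the family of its cosheaf. -/
def PShf.totToCostalk (M : PShf.{u} R) (q : Tot M.fibre) : Tot M.toPrecoshObj.costalk :=
  ⟨q.pt, M.toCostalk q.pt q.val⟩

/-- The preimages of the generating open sets are open since `ℳ|_U` is open in `ℳ`. -/
theorem PShf.continuous_totToCostalk (M : PShf.{u} R) : Continuous M.totToCostalk := by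
  refine continuous_generateFrom_iff.2 ?_
  rintro _ ⟨U, W, hW, rfl⟩
  convert M.isOpen_image_restrictIncl U (hW.preimage (M.restrict U).ω.continuous_map) using 1
  ext q
  constructor
  · rintro ⟨h, hq⟩
    exact ⟨⟨⟨q.pt, h⟩, q.val⟩, hq, rfl⟩
  · rintro ⟨q, hq, rfl⟩
    exact ⟨q.pt.2, hq⟩

/-- The inverse of `M_x → lim ⊞_{u ∈ U} M_u`. -/
def PShf.ofCostalk (M : PShf.{u} R) (x : M.base) : M.toPrecoshObj.costalk x →ₗ[R] M.fibre x :=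
  (LinearEquiv.ofBijective _ ⟨M.toCostalk_injective x, M.toCostalk_surjective x⟩).symm.toLinearMap

theorem PShf.ofCostalk_toCostalk (M : PShf.{u} R) (x : M.base) (m : M.fibre x) :
    M.ofCostalk x (M.toCostalk x m) = m :=
  (LinearEquiv.ofBijective _
    ⟨M.toCostalk_injective x, M.toCostalk_surjective x⟩).symm_apply_apply m

theorem PShf.toCostalk_ofCostalk (M : PShf.{u} R) (x : M.base) (c : M.toPrecoshObj.costalk x) :
    M.toCostalk x (M.ofCostalk x c) = c :=
  (LinearEquiv.ofBijective _
    ⟨M.toCostalk_injective x, M.toCostalk_surjective x⟩).apply_symm_apply c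

/-- The inverse of a continuous bijection of compact Hausdorff spaces is continuous. -/
theorem PShf.continuous_ofCostalk (M : PShf.{u} R) :
    Continuous fun q : Tot M.toPrecoshObj.costalk => (⟨q.pt, M.ofCostalk q.pt q.val⟩ :
      Tot M.fibre) := by
  let e : Tot M.fibre ≃ Tot M.toPrecoshObj.costalk :=
    { toFun := M.totToCostalk
      invFun := fun q => ⟨q.pt, M.ofCostalk q.pt q.val⟩
      left_inv := fun q => congrArg (Tot.mk q.pt) (M.ofCostalk_toCostalk q.pt q.val)
      right_inv := fun q => congrArg (Tot.mk q.pt) (M.toCostalk_ofCostalk q.pt q.val) }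
  have : T2Space (Tot M.toPrecoshObj.costalk) := M.toPrecoshObj.toPShfObj.t2Space
  exact Continuous.continuous_symm_of_equiv_compact_to_t2 (f := e) M.continuous_totToCostalk

/-- The morphism from a family of profinite modules to the family of its cosheaf. -/
def PShf.costalkHom (M : PShf.{u} R) : PShf.Hom M M.toPrecoshObj.toPShfObj where
  f := ContinuousMap.id M.base
  ψ := M.toCostalk
  continuous_ψ := M.continuous_totToCostalk

/-- The morphism to a family of profinite modules from the family of its cosheaf. -/
def PShf.costalkInv (M : PShf.{u} R) : PShf.Hom M.toPrecoshObj.toPShfObj M where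
  f := ContinuousMap.id M.base
  ψ := M.ofCostalk
  continuous_ψ := M.continuous_ofCostalk

/-- A family of profinite modules is isomorphic to the family of its cosheaf. -/
def PShf.costalkIso (M : PShf.{u} R) : M ≅ M.toPrecoshObj.toPShfObj where
  hom := M.costalkHom
  inv := M.costalkInv
  hom_inv_id := PShf.Hom.ext rfl <| heq_of_eq <| funext fun x => LinearMap.ext fun m =>
    M.ofCostalk_toCostalk x m
  inv_hom_id := PShf.Hom.ext rfl <| heq_of_eq <| funext fun x => LinearMap.ext fun c =>
    M.toCostalk_ofCostalk x c

theorem PShf.costalkIso_naturality {N M : PShf.{u} R} (F : N ⟶ M) :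
    F ≫ M.costalkIso.hom =
      N.costalkIso.hom ≫ (Precosh.toPShf R).map ((PShf.toPrecosh R).map F) := by
  refine PShf.Hom.ext rfl (heq_of_eq (funext fun y => LinearMap.ext fun n => ?_))
  refine M.toPrecoshObj.costalk_ext fun U hU => ?_
  exact (PShf.Hom.bigsumMap_ω (PShf.Hom.restrict F (clopenPreimage (PShf.Hom.f F) U ⊓ ⊤) U
    fun _ hy => hy.1) (⟨y, hU, trivial⟩ :
      (clopenPreimage (PShf.Hom.f F) U ⊓ ⊤ : Clopens N.base)) n).symm

variable (R) in
/-- Passing to the cosheaf and back to the family is naturally isomorphic to the identity. -/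
def PShf.toCoShfCompIso : 𝟭 (PShf.{u} R) ≅ PShf.toCoShf R ⋙ CoShf.toPShf R :=
  NatIso.ofComponents PShf.costalkIso PShf.costalkIso_naturality

end FamilyUnit

/-! ### Characters on the stalks of a cosheaf -/

section CostalkCharacters

variable {R : Type u} [Ring R] [TopologicalSpace R]

/-- If the image of `N(V)` meets a closed subset `Z` of `N(U)` for all clopen `V ⊆ U` containing
`x`, then so does the image of `N_x`: an inverse limit of nonempty compact spaces is nonempty. -/
theorem Precosh.exists_proj_mem (N : Precosh.{u} R) {U : Clopens N.base} {x : N.base} (hx : x ∈ U)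
    {Z : Set (N.fn.obj U)} (hZ : IsClosed Z)
    (h : ∀ (V : Clopens N.base) (hV : V ≤ U), x ∈ V → ∃ n, (N.cor hV).lin n ∈ Z) :
    ∃ m, N.proj U x hx m ∈ Z := by
  classical
  let I := {V : Clopens N.base // x ∈ V}
  -- The families `z` which are compatible from `V` upwards form a compact set.
  let t : {V : I // V.1 ≤ U} → Set (∀ W : I, N.fn.obj W.1) := fun V =>
    {z | z ⟨U, hx⟩ ∈ Z ∧ ∀ (W : I) (h : V.1.1 ≤ W.1), (N.cor h).lin (z V.1) = z W}
  have hclosed : ∀ V, IsClosed (t V) := fun V => by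
    have h2 : IsClosed {z : ∀ W : I, N.fn.obj W.1 | ∀ (W : I) (h : V.1.1 ≤ W.1),
        (N.cor h).lin (z V.1) = z W} := by
      simp only [Set.ofPred_forall]
      exact isClosed_iInter fun W => isClosed_iInter fun h =>
        isClosed_eq ((N.cor h).lin.continuous.comp (continuous_apply _)) (continuous_apply _)
    exact (hZ.preimage (continuous_apply (⟨U, hx⟩ : I))).inter h2
  have hmono : ∀ V V' : {V : I // V.1 ≤ U}, V'.1.1 ≤ V.1.1 → t V' ⊆ t V := by
    intro V V' h z hz
    refine ⟨hz.1, fun W hW => ?_⟩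
    rw [← hz.2 V.1 h, N.cor_cor_apply]
    exact hz.2 W _
  have hne : Nonempty {V : I // V.1 ≤ U} := ⟨⟨⟨U, hx⟩, le_rfl⟩⟩
  obtain ⟨z, hz⟩ := IsCompact.nonempty_iInter_of_directed_nonempty_isCompact_isClosed t
    (fun V V' => ⟨⟨⟨V.1.1 ⊓ V'.1.1, V.1.2, V'.1.2⟩, inf_le_left.trans V.2⟩,
      hmono _ _ inf_le_left, hmono _ _ inf_le_right⟩)
    (fun V => by
      obtain ⟨n, hn⟩ := h V.1.1 V.2 V.1.2
      refine ⟨fun W => if h : V.1.1 ≤ W.1 then (N.cor h).lin n else 0, ?_, fun W hW => ?_⟩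
      · change dite (V.1.1 ≤ U) _ _ ∈ Z
        rwa [dif_pos V.2]
      · change (N.cor hW).lin (dite (V.1.1 ≤ V.1.1) _ _) = dite (V.1.1 ≤ W.1) _ _
        rw [dif_pos le_rfl, dif_pos hW, N.cor_cor_apply])
    (fun V => (hclosed V).isCompact) hclosed
  have hz' : ∀ V, z ∈ t V := fun V => Set.mem_iInter.1 hz V
  refine ⟨N.costalkMk x (fun W hW => z ⟨W, hW⟩) fun V W hVW hxV => ?_, (hz' ⟨⟨U, hx⟩, le_rfl⟩).1⟩
  have h1 := (hz' ⟨⟨V ⊓ U, hxV, hx⟩, inf_le_right⟩).2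
  change (N.cor hVW).lin (z ⟨V, hxV⟩) = z ⟨W, hVW hxV⟩
  rw [← h1 ⟨V, hxV⟩ inf_le_left, N.cor_cor_apply]
  exact h1 ⟨W, hVW hxV⟩ _

/-- A character which vanishes on the image of `N_x` vanishes on the image of `N(V)` for some
neighbourhood `V` of `x`, since the circle has no small subgroups. -/
theorem Precosh.exists_character_cor_eq_zero (N : Precosh.{u} R) {U : Clopens N.base} {x : N.base}
    (hx : x ∈ U) (χ : PDual (N.fn.obj U)) (h : ∀ m, χ (N.proj U x hx m) = 0) :
    ∃ (V : Clopens N.base) (hV : V ≤ U), x ∈ V ∧ ∀ n, χ ((N.cor hV).lin n) = 0 := by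
  obtain ⟨W, hW, h0, hW0⟩ := exists_nhds_circle_noSmallSubgroups
  by_contra! hcon
  obtain ⟨m, hm⟩ := N.exists_proj_mem hx (hW.isClosed_compl.preimage χ.continuous_toFun)
    fun V hV hxV => by
      obtain ⟨n, hn⟩ := hcon V hV hxV
      by_contra! hin
      refine hn (hW0 _ fun k => ?_)
      have h2 : χ ((N.cor hV).lin (k • n)) ∈ W := not_not.1 (hin (k • n))
      rwa [map_nsmul, map_nsmul] at h2
  refine hm ?_
  change χ (N.proj U x hx m) ∈ W
  rwa [h m]

variable [IsTopologicalRing R] [CompactSpace R]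

/-- A character on the value of a cosheaf is determined by its values on the images of the
modules `N_x`. -/
theorem Precosh.IsCosheaf.character_ext {N : Precosh.{u} R} (hN : N.IsCosheaf)
    {U : Clopens N.base} {χ χ' : PDual (N.fn.obj U)}
    (h : ∀ x hx m, χ (N.proj U x hx m) = χ' (N.proj U x hx m)) : χ = χ' := by
  refine hN.dual.eq_of_locally_eq (A := N.dualObj) (s := χ) (t := χ') fun x hx => ?_
  obtain ⟨V, hV, hxV, hV0⟩ := N.exists_character_cor_eq_zero hx (χ - χ') fun m =>
    sub_eq_zero.2 (h x hx m)
  exact ⟨V, hV, hxV, ContinuousAddMonoidHom.ext fun n => sub_eq_zero.1 (hV0 n)⟩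

/-- The image of `ℳ` generates a dense submodule of `⊞ ℳ`, but a character is only additive; hence
the largest submodule on which two characters agree has to be considered. -/
theorem PShf.bigsum_character_ext (M : PShf.{u} R) {χ χ' : PDual M.bigsumObj}
    (h : ∀ x m, χ (M.ω.map x m) = χ' (M.ω.map x m)) : χ = χ' := by
  let L : Submodule R M.bigsumObj :=
    { carrier := {s | ∀ r : R, χ (r • s) = χ' (r • s)}
      zero_mem' := fun r => by rw [smul_zero, map_zero, map_zero]
      add_mem' := fun ha hb r => by rw [smul_add, map_add, map_add, ha r, hb r]
      smul_mem' := fun s a ha r => by rw [smul_smul]; exact ha (r * s) }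
  have hL : IsClosed (L : Set M.bigsumObj) := by
    change IsClosed {s : M.bigsumObj | ∀ r : R, χ (r • s) = χ' (r • s)}
    simp only [Set.ofPred_forall]
    exact isClosed_iInter fun r => isClosed_eq
      (χ.continuous_toFun.comp (continuous_const_smul r))
      (χ'.continuous_toFun.comp (continuous_const_smul r))
  have htop := M.eq_top_of_closed L hL fun x m r => by
    rw [← map_smul]
    exact h x (r • m)
  refine ContinuousAddMonoidHom.ext fun s => ?_
  have h1 : χ ((1 : R) • s) = χ' ((1 : R) • s) := htop.ge (trivial : s ∈ (⊤ : Submodule R _)) 1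
  rwa [one_smul] at h1

/-- The projection `N_x → N(U)`, as a morphism of profinite modules. -/
def Precosh.projHom (N : Precosh.{u} R) (U : Clopens N.base) (x : N.base) (hx : x ∈ U) :
    N.toPShfObj.fibreMod x ⟶ N.fn.obj U where
  lin :=
    { toLinearMap := (N.proj U x hx : N.costalk x →ₗ[R] N.fn.obj U)
      cont := by
        refine (N.toPShfObj.continuous_comp_mk x (N.continuous_projZero U)).congr fun m => ?_
        exact congrArg (fun g : N.costalk _ →ₗ[R] N.fn.obj U => g m) (N.projZero_pos hx) }

theorem Precosh.cor_projHom (N : Precosh.{u} R) {U V : Clopens N.base} (h : U ≤ V) (x : N.base)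
    (hx : x ∈ U) (m : N.toPShfObj.fibreMod x) :
    (N.cor h).lin ((N.projHom U x hx).lin m) = (N.projHom V x (h hx)).lin m :=
  N.cor_proj h x hx m

/-- Every character of `N_x` extends to `N(V)` for some neighbourhood `V` of `x`. -/
theorem Precosh.exists_character_extension (N : Precosh.{u} R) (x : N.base)
    (χ : PDual (N.toPShfObj.fibreMod x)) :
    ∃ (V : Clopens N.base) (hx : x ∈ V) (θ : PDual (N.fn.obj V)),
      ∀ m, θ ((N.projHom V x hx).lin m) = χ m := by
  obtain ⟨W, hW, h0, hW0⟩ := exists_nhds_circle_noSmallSubgroups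
  have hclosed : IsClosed {m : N.toPShfObj.fibreMod x | χ m ∉ W} :=
    hW.isClosed_compl.preimage χ.continuous_toFun
  -- The kernels of the projections have trivial intersection, so by compactness one of them
  -- avoids the closed set on which `χ` is not small.
  obtain ⟨V, hx, hV⟩ : ∃ (V : Clopens N.base) (hx : x ∈ V), ∀ m : N.toPShfObj.fibreMod x,
      (N.projHom V x hx).lin m = 0 → χ m ∈ W := by
    by_contra! hcon
    let S : {V : Clopens N.base // x ∈ V} → Set (N.toPShfObj.fibreMod x) := fun V =>
      {m | (N.projHom V.1 x V.2).lin m = 0} ∩ {m | χ m ∉ W}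
    have hS : ∀ V, IsClosed (S V) := fun V =>
      (isClosed_eq (N.projHom V.1 x V.2).lin.continuous continuous_const).inter hclosed
    have hmono : ∀ V V' : {V : Clopens N.base // x ∈ V}, V.1 ≤ V'.1 → S V ⊆ S V' := by
      intro V V' h m hm
      refine ⟨?_, hm.2⟩
      have h1 : (N.projHom V.1 x V.2).lin m = 0 := hm.1
      change (N.projHom V'.1 x V'.2).lin m = 0
      rw [← N.cor_projHom h x V.2, h1, map_zero]
    have hne : Nonempty {V : Clopens N.base // x ∈ V} := ⟨⟨⊤, clopens_mem_top x⟩⟩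
    obtain ⟨m, hm⟩ := IsCompact.nonempty_iInter_of_directed_nonempty_isCompact_isClosed S
      (fun V V' => ⟨⟨V.1 ⊓ V'.1, V.2, V'.2⟩, hmono _ _ inf_le_left, hmono _ _ inf_le_right⟩)
      (fun V => hcon V.1 V.2) (fun V => (hS V).isCompact) hS
    have hm0 : m = 0 := N.costalk_ext fun V hV =>
      (Set.mem_iInter.1 hm ⟨V, hV⟩).1.trans (map_zero (N.proj V x hV)).symm
    refine (Set.mem_iInter.1 hm ⟨⊤, clopens_mem_top x⟩).2 ?_
    rw [hm0, map_zero]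
    exact h0
  have hclosed2 : IsClosed ((N.projHom V x hx).lin '' {m | χ m ∉ W}) :=
    (hclosed.isCompact.image (N.projHom V x hx).lin.continuous).isClosed
  obtain ⟨L, hL, hLW⟩ := (N.fn.obj V).exists_openSubmodule hclosed2.isOpen_compl (by
    rintro ⟨m, hm, hm0⟩
    exact hm (hV m hm0))
  have hLχ : ∀ m, (N.projHom V x hx).lin m ∈ L → χ m = 0 := fun m hm =>
    hW0 _ fun k => by
      by_contra hk
      refine hLW (?_ : (N.projHom V x hx).lin (k • m) ∈ L) ⟨k • m, ?_, rfl⟩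
      · rw [map_nsmul]
        exact L.smul_of_tower_mem k hm
      · change χ (k • m) ∉ W
        rwa [map_nsmul]
  have hdisc : DiscreteTopology ((N.fn.obj V).openQuotient L hL) :=
    QuotientAddGroup.discreteTopology (N := L.toAddSubgroup) hL
  let f := N.projHom V x hx ≫ (N.fn.obj V).openQuotientMap L hL
  obtain ⟨g, hg⟩ := exists_factor_character f.lin.toLinearMap.toAddMonoidHom
    χ.toAddMonoidHom fun m hm => hLχ m (((N.fn.obj V).openQuotientMap_eq_zero L hL _).1 hm)
  exact ⟨V, hx, ⟨g.comp ((N.fn.obj V).openQuotientMap L hL).lin.toLinearMap.toAddMonoidHom,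
    (continuous_of_discreteTopology (f := g)).comp
      ((N.fn.obj V).openQuotientMap L hL).lin.continuous⟩, hg⟩

end CostalkCharacters

/-! ### A cosheaf is recovered from its family of profinite modules -/

section CosheafCounit

variable {R : Type u} [Ring R] [TopologicalSpace R] [IsTopologicalRing R] [CompactSpace R]

/-- The projections `N_x → N(U)` for `x ∈ U`, as a morphism from the restricted family. -/
def Precosh.projHomTo (N : Precosh.{u} R) (U : Clopens N.base) :
    (N.toPShfObj.restrict U).HomTo (N.fn.obj U) where
  map x := N.proj U (Subtype.val (p := fun y => y ∈ U) x) x.2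
  continuous_map := by
    refine (N.toPShfObj.continuous_comp_restrictIncl U (N.continuous_projZero U)).congr
      fun q => ?_
    exact congrArg (fun g : N.costalk _ →ₗ[R] N.fn.obj U => g q.val) (N.projZero_pos q.pt.2)

/-- The canonical map `⊞_{u ∈ U} N_u ⟶ N(U)`. -/
def Precosh.fromSumCostalks (N : Precosh.{u} R) (U : Clopens N.base) :
    N.toPShfObj.toPrecoshObj.fn.obj U ⟶ N.fn.obj U :=
  (N.projHomTo U).lift

theorem Precosh.fromSumCostalks_ωU (N : Precosh.{u} R) (U : Clopens N.base) (x : N.base)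
    (hx : x ∈ U) (m : N.costalk x) :
    (N.fromSumCostalks U).lin (N.toPShfObj.ωU U x hx m) = N.proj U x hx m :=
  (N.projHomTo U).lift_apply (⟨x, hx⟩ : U) m

theorem Precosh.fromSumCostalks_cor (N : Precosh.{u} R) {U V : Clopens N.base} (h : U ≤ V)
    (s : N.toPShfObj.toPrecoshObj.fn.obj U) :
    (N.fromSumCostalks V).lin ((N.toPShfObj.toPrecoshObj.cor h).lin s) =
      (N.cor h).lin ((N.fromSumCostalks U).lin s) := by
  have e : N.toPShfObj.toPrecoshObj.cor h ≫ N.fromSumCostalks V =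
      N.fromSumCostalks U ≫ N.cor h :=
    PShf.bigsum_ext (M := N.toPShfObj.restrict U) fun x m =>
      (congrArg (N.fromSumCostalks V).lin (N.toPShfObj.cor_ωU h x.1 x.2 m)).trans <|
        (N.fromSumCostalks_ωU V x.1 (h x.2) m).trans <|
          (N.cor_proj h x.1 x.2 m).symm.trans <|
            congrArg (N.cor h).lin (N.fromSumCostalks_ωU U x.1 x.2 m).symm
  exact congrArg (fun g => g.lin s) e

theorem Precosh.IsCosheaf.fromSumCostalks_surjective {N : Precosh.{u} R} (hN : N.IsCosheaf)
    (U : Clopens N.base) : Function.Surjective (N.fromSumCostalks U).lin := by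
  refine PMod.surjective_of_dual_injective _ fun χ h => hN.character_ext fun x hx m => ?_
  rw [← N.fromSumCostalks_ωU U x hx m]
  exact h _

/-- Near `x`, a character of `⊞_{u ∈ U} N_u` is given by a character of some `N(V)`: extend its
restriction to `N_x` and compare the two near `x`. -/
theorem Precosh.exists_local_character (N : Precosh.{u} R) {U : Clopens N.base}
    (ψ : PDual (N.toPShfObj.toPrecoshObj.fn.obj U)) (x : N.base) (hx : x ∈ U) :
    ∃ (V : Clopens N.base) (_ : x ∈ V) (hVU : V ≤ U) (χ : PDual (N.fn.obj V)),
      ∀ y (hy : y ∈ V) m, χ (N.proj V y hy m) = ψ (N.toPShfObj.ωU U y (hVU hy) m) := by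
  have hc : Continuous fun m : N.toPShfObj.fibreMod x => ψ (N.toPShfObj.ωU U x hx m) :=
    ψ.continuous_toFun.comp (PShf.continuous_ωU N.toPShfObj U x hx)
  obtain ⟨V, hxV, θ, hθ⟩ := N.exists_character_extension x
    ⟨ψ.toAddMonoidHom.comp (LinearMap.toAddMonoidHom (M₁ := N.toPShfObj.fibreMod x)
      (PShf.ωU N.toPShfObj U x hx)), hc⟩
  let C := N.toPShfObj.toPrecoshObj
  let i : C.fn.obj (V ⊓ U) ⟶ N.fn.obj V := N.fromSumCostalks (V ⊓ U) ≫ N.cor inf_le_left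
  let j : C.fn.obj (V ⊓ U) ⟶ C.fn.obj U := C.cor inf_le_right
  -- The character `δ` compares `θ` and `ψ`; it vanishes on the image of `N_x`, hence near `x`.
  let δ : PDual (C.fn.obj (V ⊓ U)) :=
    θ.comp ⟨i.lin.toLinearMap.toAddMonoidHom, i.lin.continuous⟩ -
      ψ.comp ⟨j.lin.toLinearMap.toAddMonoidHom, j.lin.continuous⟩
  have hδ : ∀ s, δ s = θ (i.lin s) - ψ (j.lin s) := fun s => rfl
  have hi : ∀ y hy m, i.lin (N.toPShfObj.ωU (V ⊓ U) y hy m) = N.proj V y hy.1 m := fun y hy m =>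
    (congrArg (N.cor inf_le_left).lin (N.fromSumCostalks_ωU (V ⊓ U) y hy m)).trans
      (N.cor_proj inf_le_left y hy m)
  have hj : ∀ y hy m, j.lin (N.toPShfObj.ωU (V ⊓ U) y hy m) = N.toPShfObj.ωU U y hy.2 m :=
    fun y hy m => N.toPShfObj.cor_ωU inf_le_right y hy m
  obtain ⟨V', hV', hxV', h0⟩ := C.exists_character_cor_eq_zero
    (U := V ⊓ U) (x := x) ⟨hxV, hx⟩ δ fun c => by
      obtain ⟨m, rfl⟩ := N.toPShfObj.toCostalk_surjective x c
      refine (hδ _).trans (sub_eq_zero.2 ?_)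
      exact (congrArg θ (hi x ⟨hxV, hx⟩ m)).trans
        ((hθ m).trans (congrArg ψ (hj x ⟨hxV, hx⟩ m)).symm)
  let k : N.fn.obj V' ⟶ N.fn.obj V := N.cor (hV'.trans inf_le_left)
  refine ⟨V', hxV', hV'.trans inf_le_right,
    θ.comp ⟨k.lin.toLinearMap.toAddMonoidHom, k.lin.continuous⟩, fun y hy m => ?_⟩
  have h1 := h0 (N.toPShfObj.ωU V' y hy m)
  have h2 : (C.cor hV').lin (N.toPShfObj.ωU V' y hy m) = N.toPShfObj.ωU (V ⊓ U) y (hV' hy) m :=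
    N.toPShfObj.cor_ωU hV' y hy m
  have h3 := sub_eq_zero.1 ((hδ _).symm.trans ((congrArg δ h2).symm.trans h1))
  exact (congrArg θ ((N.cor_proj _ y hy m).trans (hi y (hV' hy) m).symm)).trans
    (h3.trans (congrArg ψ (hj y (hV' hy) m)))

/-- The local characters of `exists_local_character` glue, as a character of `N(V)` is determined by
its restrictions to the modules `N_y`; so every character of `⊞_{u ∈ U} N_u` comes from `N(U)`. -/
theorem Precosh.IsCosheaf.fromSumCostalks_injective {N : Precosh.{u} R} (hN : N.IsCosheaf)
    (U : Clopens N.base) : Function.Injective (N.fromSumCostalks U).lin := by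
  refine PMod.injective_of_dual_surjective _ fun ψ => ?_
  choose V hxV hVU χ hχ using fun x : {x // x ∈ U} => N.exists_local_character ψ x.1 x.2
  obtain ⟨θ, hθ⟩ := hN.dual.exists_glue (A := N.dualObj) V hxV hVU χ fun x y =>
    hN.character_ext fun z hz m =>
      (congrArg (χ x) (N.cor_proj inf_le_left z hz m)).trans <| (hχ x z hz.1 m).trans <|
        (hχ y z hz.2 m).symm.trans (congrArg (χ y) (N.cor_proj inf_le_right z hz m)).symm
  let ε := N.fromSumCostalks U
  have key : (θ : PDual (N.fn.obj U)).comp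
      ⟨ε.lin.toLinearMap.toAddMonoidHom, ε.lin.continuous⟩ = ψ :=
    (N.toPShfObj.restrict U).bigsum_character_ext fun x m => by
      refine (congrArg (DFunLike.coe (F := PDual (N.fn.obj U)) θ)
        ((N.fromSumCostalks_ωU U x.1 x.2 m).trans (N.cor_proj (hVU x) x.1 (hxV x) m).symm)).trans ?_
      exact (DFunLike.congr_fun (F := PDual (N.fn.obj (V x))) (hθ x) _).trans
        (hχ x x.1 (hxV x) m)
  exact ⟨θ, fun p => DFunLike.congr_fun key p⟩

/-- The cosheaf of the family of a cosheaf is isomorphic to it. -/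
def Precosh.IsCosheaf.sumIso {N : Precosh.{u} R} (hN : N.IsCosheaf) :
    N.toPShfObj.toPrecoshObj ≅ N :=
  Precosh.baseIso (X := N.base) (F := N.toPShfObj.toPrecoshObj.fn) (G := N.fn)
    (NatIso.ofComponents (fun U => PMod.isoOfBijective (N.fromSumCostalks U)
      ⟨hN.fromSumCostalks_injective U, hN.fromSumCostalks_surjective U⟩)
    fun {_ _} h => PMod.Hom.ext <| ContinuousLinearMap.ext fun s =>
      N.fromSumCostalks_cor (leOfHom h) s)

theorem Precosh.IsCosheaf.sumIso_naturality {N M : Precosh.{u} R} (hN : N.IsCosheaf)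
    (hM : M.IsCosheaf) (F : N ⟶ M) :
    (PShf.toPrecosh R).map ((Precosh.toPShf R).map F) ≫ hM.sumIso.hom = hN.sumIso.hom ≫ F :=
  Precosh.baseHom_naturality (N := N.toPShfObj.toPrecoshObj) (M := M.toPShfObj.toPrecoshObj)
    (G := N.fn) (H := M.fn) _ _ ((PShf.toPrecosh R).map ((Precosh.toPShf R).map F))
    (Precosh.Hom.nat F) fun U V s => by
      let G := PShf.Hom.toPrecosh (Precosh.Hom.toPShf F)
      have e : G.app U V ≫ M.fromSumCostalks U =
          N.fromSumCostalks _ ≫ Precosh.Hom.app F U V :=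
        PShf.bigsum_ext fun y n => by
          have hy : y.1 ∈ clopenPreimage (Precosh.Hom.f F) U ⊓ V := y.2
          refine (congrArg (M.fromSumCostalks U).lin (PShf.Hom.bigsumMap_ω (PShf.Hom.restrict
            (Precosh.Hom.toPShf F) (clopenPreimage (Precosh.Hom.f F) U ⊓ V) U
              fun _ hy => hy.1) y n)).trans ?_
          refine (M.fromSumCostalks_ωU U (Precosh.Hom.f F y.1) hy.1
            (Precosh.Hom.costalk F y.1 n)).trans ?_
          refine Eq.trans ?_ (congrArg (Precosh.Hom.app F U V).lin
            (N.fromSumCostalks_ωU _ y.1 hy n)).symm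
          refine Eq.trans ?_ (Precosh.Hom.app_eq_cor F U V _).symm
          exact congrArg (Precosh.Hom.app F U ⊤).lin
            (N.cor_proj (meet_mono (Precosh.Hom.f F) le_rfl le_top) y.1 hy n).symm
      exact congrArg (fun g => g.lin s) e

variable (R) in
/-- Passing to the family and back to the cosheaf is naturally isomorphic to the identity. -/
def CoShf.toPShfCompIso : CoShf.toPShf R ⋙ PShf.toCoShf R ≅ 𝟭 (CoShf.{u} R) :=
  NatIso.ofComponents (fun N => ObjectProperty.isoMk _ N.property.sumIso)
    fun {N M} F => ObjectProperty.hom_ext _ (N.property.sumIso_naturality M.property F.hom)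

variable (R) in
/-- Families of profinite modules are equivalent to cosheaves. -/
def familyCosheafEquivalence : PShf.{u} R ≌ CoShf.{u} R :=
  CategoryTheory.Equivalence.mk (PShf.toCoShf R) (CoShf.toPShf R) (PShf.toCoShfCompIso R)
    (CoShf.toPShfCompIso R)

end CosheafCounit

/-! ### Global values -/

section GlobalValues

variable {R : Type u} [Ring R] [TopologicalSpace R] [IsTopologicalRing R] [CompactSpace R]

/-- Sections over the whole space, as a clopen subset of itself, are global sections. -/
def EtaleSp.topSections (A : EtaleSp.{u} R) :
    A.sectionsMod (clopenIncl (X := A.base) ⊤) →ₗ[Rᵐᵒᵖ] A.sectionsMod (ContinuousMap.id A.base) :=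
  A.sectionsComp (clopenIncl (X := A.base) ⊤) ⟨fun x => ⟨x, trivial⟩, by fun_prop⟩

theorem EtaleSp.topSections_bijective (A : EtaleSp.{u} R) : Function.Bijective A.topSections :=
  ⟨fun _ _ h => Subtype.ext (funext fun x => congrFun (congrArg Subtype.val h) x.1),
    fun s => ⟨⟨fun x => s.1 x.1, s.2.comp continuous_subtype_val⟩, rfl⟩⟩

variable (R) in
/-- The global value of the sheaf of sections is the continuous product. -/
def EtaleSp.toShfCompEvalIso : EtaleSp.toShf R ⋙ Shf.eval R ≅ EtaleSp.contProd R :=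
  NatIso.ofComponents
    (fun A => DMod.isoOfBijective (A := A.sectionsMod (clopenIncl (X := A.base) ⊤))
      A.topSections A.topSections_bijective)
    fun _ => rfl

/-- Restricting a family to the whole base space does not change it. -/
def PShf.restrictTopIso (M : PShf.{u} R) : M.restrict ⊤ ≅ M where
  hom :=
    { f := clopenIncl (X := M.base) ⊤
      ψ := fun _ => LinearMap.id
      continuous_ψ := M.continuous_restrictIncl ⊤ }
  inv :=
    { f := ⟨fun x => (⟨x, trivial⟩ : (⊤ : Clopens M.base)), by fun_prop⟩
      ψ := fun _ => LinearMap.id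
      continuous_ψ := continuous_induced_rng.2 continuous_id }

variable (R) in
/-- The global value of the cosheaf of a family is its profinite direct sum. -/
def PShf.toCoShfCompEvalIso : PShf.toCoShf R ⋙ CoShf.eval R ≅ PShf.bigsum R :=
  NatIso.ofComponents (fun M => (PShf.bigsum R).mapIso M.restrictTopIso) fun {N M} F =>
    let F' := PShf.Hom.restrict F (clopenPreimage (PShf.Hom.f F) ⊤ ⊓ ⊤) ⊤ fun _ _ => trivial
    PShf.bigsum_ext (M := N.restrict ⊤) fun y n =>
      (congrArg (fun s => (PShf.Hom.bigsumMap M.restrictTopIso.hom).lin (F'.bigsumMap.lin s))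
        (PShf.Hom.bigsumMap_ω (N.restrictLE (top_le_meet (PShf.Hom.f F))) y n)).trans <|
      (congrArg (PShf.Hom.bigsumMap M.restrictTopIso.hom).lin (F'.bigsumMap_ω
        (⟨y.1, trivial, trivial⟩ :
          (clopenPreimage (PShf.Hom.f F) ⊤ ⊓ ⊤ : Clopens N.base)) n)).trans <|
      (PShf.Hom.bigsumMap_ω M.restrictTopIso.hom _ _).trans <|
        ((congrArg (PShf.Hom.bigsumMap F).lin
          (PShf.Hom.bigsumMap_ω N.restrictTopIso.hom y n)).trans
            (PShf.Hom.bigsumMap_ω F _ _)).symm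

end GlobalValues

end

theorem mainTheorem2 (R : Type u) [Ring R] [TopologicalSpace R] [IsTopologicalRing R]
    [CompactSpace R] [T2Space R] [TotallyDisconnectedSpace R] :
    -- the four equivalences of the diagram, given by the stated functors in both directions
    (∃ e : (EtaleSp.{u} R)ᵒᵖ ≌ (Shf.{u} R)ᵒᵖ,
      e.functor = (EtaleSp.toShf R).op ∧ e.inverse = (Shf.toEtale R).op) ∧
    (∃ e : (Shf.{u} R)ᵒᵖ ≌ CoShf.{u} R,
      e.functor = Shf.dual R ∧ e.inverse = (CoShf.dual R).rightOp) ∧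
    (∃ e : PShf.{u} R ≌ CoShf.{u} R,
      e.functor = PShf.toCoShf R ∧ e.inverse = CoShf.toPShf R) ∧
    (∃ e : (DMod.{u} R)ᵒᵖ ≌ PMod.{u} R,
      e.functor = DMod.dual R ∧ e.inverse = (PMod.dual R).rightOp) ∧
    -- the upper triangle
    Nonempty ((EtaleSp.toShf R).op ⋙ (Shf.eval R).op ≅ (EtaleSp.contProd R).op) ∧
    Nonempty ((Shf.toEtale R).op ⋙ (EtaleSp.contProd R).op ≅ (Shf.eval R).op) ∧
    -- the square
    Nonempty ((Shf.eval R).op ⋙ DMod.dual R ≅ Shf.dual R ⋙ CoShf.eval R) ∧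
    Nonempty ((CoShf.dual R).rightOp ⋙ (Shf.eval R).op ≅ CoShf.eval R ⋙ (PMod.dual R).rightOp) ∧
    -- the lower triangle
    Nonempty (PShf.toCoShf R ⋙ CoShf.eval R ≅ PShf.bigsum R) ∧
    Nonempty (CoShf.toPShf R ⋙ PShf.bigsum R ≅ CoShf.eval R) := by
  -- A triangle for one direction of an equivalence follows from the one for the other direction.
  have étale : Shf.toEtale R ⋙ EtaleSp.contProd R ≅ Shf.eval R :=
    Functor.isoWhiskerLeft (Shf.toEtale R) (EtaleSp.toShfCompEvalIso R).symm ≪≫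
      (Functor.associator _ _ _).symm ≪≫
        Functor.isoWhiskerRight (Shf.germIso R).symm (Shf.eval R) ≪≫ Functor.leftUnitor _
  have family : CoShf.toPShf R ⋙ PShf.bigsum R ≅ CoShf.eval R :=
    Functor.isoWhiskerLeft (CoShf.toPShf R) (PShf.toCoShfCompEvalIso R).symm ≪≫
      (Functor.associator _ _ _).symm ≪≫
        Functor.isoWhiskerRight (CoShf.toPShfCompIso R) (CoShf.eval R) ≪≫ Functor.leftUnitor _
  exact ⟨⟨etaleSheafEquivalence R, rfl, rfl⟩, ⟨sheafCosheafEquivalence R, rfl, rfl⟩,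
    ⟨familyCosheafEquivalence R, rfl, rfl⟩, ⟨pontryaginEquivalence R, rfl, rfl⟩,
    ⟨NatIso.op (EtaleSp.toShfCompEvalIso R).symm⟩, ⟨NatIso.op étale.symm⟩,
    ⟨NatIso.ofComponents (fun _ => Iso.refl _) fun _ => rfl⟩,
    ⟨NatIso.ofComponents (fun _ => Iso.refl _) fun _ => rfl⟩,
    ⟨PShf.toCoShfCompEvalIso R⟩, ⟨family⟩⟩
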